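/- Let $\mathbb K$ be a field of characteristic $0$, let $\mathfrak g$ and $V$ be $\mathbb K$-vector spaces, and let $L=\bigoplus_{n\ge 0}\mathrm{Hom}(\wedge^{n+1}(\mathfrak g\oplus V),\mathfrak g\oplus V)$, with the $n$-th summand in degree $n$, carry the Nijenhuis–Richardson bracket $[P,Q]=P\bar\circ Q-(-1)^{pq}Q\bar\circ P$ ($|P|=p$, $|Q|=q$), where $(P\bar\circ Q)(x_1,\dots,x_{p+q+1})=\sum_{\sigma}(-1)^\sigma P(Q(x_{\sigma(1)},\dots,x_{\sigma(q+1)}),x_{\sigma(q+2)},\dots,x_{\sigma(p+q+1)})$, the sum being over $(q+1,p)$-shuffles. Let $C^{k|l}\subset\mathrm{Hom}(\wedge^{k+l+1}(\mathfrak g\oplus V),\mathfrak g\oplus V)$ consist of the maps that send $\wedge^{k+1}\mathfrak g\otimes\wedge^{l}V$ to $\mathfrak g$, send $\wedge^{k}\mathfrak g\otimes\wedge^{l+1}V$ to $V$, and vanish on the other summands. Put $L'=\bigoplus_{n\ge0}C^{n|0}$ and $\mathfrak h=\bigoplus_{n\ge0}C^{-1|n+1}=\bigoplus_{n\ge0}\mathrm{Hom}(\wedge^{n+1}V,\mathfrak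 g)$, and let $P:L\to\mathfrak h$ be the projection along the other bidegrees. Let $s^{-1}$ denote desuspension, $(s^{-1}L')^i=L'^{\,i+1}$. An $L_\infty$-algebra is a $\mathbb Z$-graded vector space $E$ with graded symmetric multilinear operations $l_k$ ($k\ge1$) of degree $1$ such that $\sum_{i=1}^n\sum_{\sigma}\varepsilon(\sigma)\,l_{n-i+1}(l_i(x_{\sigma(1)},\dots,x_{\sigma(i)}),x_{\sigma(i+1)},\dots,x_{\sigma(n)})=0$ for all $n\ge1$ and homogeneous $x_1,\dots,x_n$, the inner sum being over $(i,n-i)$-shuffles and $\varepsilon(\sigma)$ being the Koszul sign. It is weakly filtered, with integer $N\ge 1$, by graded subspaces $E=\mathcal F_1\supset\mathcal F_2\supset\cdots$ if $l_k(E,\dots,E)\subset\mathcal F_k$ for all $k\ge N$ and $E\cong\varprojlim E/\mathcal F_k$ canonically as graded vector spaces. A Maurer–Cartan element of it is an $\alpha$ of degree $0$ with $\sum_{k\ge1}\frac1{k!}l_k(\alpha,\dots,\alpha)=0$, the series converging in the topology of the filtration. (1) There is exactly one $L_\infty$-algebra structure on $s^{-1}L'\oplus\mathfrak h$ with $$l_2(s^{-1}Q,s^{-1}Q')=(-1)^{|Q|}s^{-1}[Q,Q'],\qquad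 l_k(s^{-1}Q,\theta_1,\dots,\theta_{k-1})=P[\cdots[[Q,\theta_1],\theta_2],\cdots,\theta_{k-1}]\quad(k\ge2)$$ for homogeneous $Q,Q'\in L'$ and $\theta_i\in\mathfrak h$, and such that $l_k$ vanishes on all combinations of arguments from $s^{-1}L'$ and $\mathfrak h$ that are not obtained from these by permutation (Voronov's higher derived brackets, with $\Delta=0$). (2) This $L_\infty$-algebra is weakly filtered, with $N=3$, by $\mathcal F_1=s^{-1}L'\oplus\mathfrak h$ and, for $k\ge 2$, $\mathcal F_k=P[\cdots[[L'+\mathfrak h,\mathfrak h],\mathfrak h],\cdots,\mathfrak h]\subset\mathfrak h$ with $k-1$ brackets, where brackets of subspaces mean linear spans. (3) Let $\mu\in\mathrm{Hom}(\wedge^2\mathfrak g,\mathfrak g)$, $\rho\in\mathrm{Hom}(\mathfrak g\otimes V,V)$ and $T\in\mathrm{Hom}(V,\mathfrak g)$, and let $\mu+\rho\in C^{1|0}$ be the map $((x,u),(y,v))\mapsto(\mu(x,y),\rho(x)v-\rho(y)u)$. Then $((\mathfrak g,\mu),\rho,T)$ is a relative Rota–Baxter Lie algebra, i.e. $\mu$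 is a Lie bracket, $\rho$ is a representation of $(\mathfrak g,\mu)$ on $V$ and $\mu(Tu,Tv)=T(\rho(Tu)v-\rho(Tv)u)$ for all $u,v\in V$, if and only if $(s^{-1}(\mu+\rho),T)$ is a Maurer–Cartan element of this weakly filtered $L_\infty$-algebra. -/

import Mathlib

noncomputable section

namespace RelRB

/-! ### Shuffles -/

/-- The `(i, n - i)`-shuffles: permutations that are increasing on the first `i` indices and
increasing on the remaining `n - i` indices. -/
def shuffles (i n : ℕ) : Finset (Equiv.Perm (Fin n)) :=
  Finset.univ.filter fun σ =>
    (∀ a b : Fin n, a < b → (b : ℕ) < i → σ a < σ b) ∧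
    (∀ a b : Fin n, a < b → i ≤ (a : ℕ) → σ a < σ b)

/-- The permutation of `Fin n`, `n = i + j`, acting by `α` on the first `i` indices and by `β` on
the last `j` indices. -/
def blockPerm {i j n : ℕ} (h : i + j = n) (α : Equiv.Perm (Fin i)) (β : Equiv.Perm (Fin j)) :
    Equiv.Perm (Fin n) :=
  (finSumFinEquiv.trans (finCongr h)).permCongr (Equiv.Perm.sumCongr α β)

theorem blockPerm_left {i j n : ℕ} (h : i + j = n) (α : Equiv.Perm (Fin i))
    (β : Equiv.Perm (Fin j)) (a : Fin i) :
    blockPerm h α β (Fin.castLE (by omega) a) = Fin.castLE (by omega) (α a) := by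
  subst h
  have : finSumFinEquiv.symm (Fin.castLE (by omega) a : Fin (i + j)) = Sum.inl a :=
    finSumFinEquiv_symm_apply_castAdd a
  simp only [blockPerm, Equiv.permCongr_apply, Equiv.symm_trans_apply, finCongr_symm, finCongr_apply,
    Fin.cast_refl, id, Equiv.trans_apply]
  rw [this]; rfl

theorem blockPerm_right {i j n : ℕ} (h : i + j = n) (α : Equiv.Perm (Fin i))
    (β : Equiv.Perm (Fin j)) (b : Fin j) :
    blockPerm h α β ⟨i + b, by omega⟩ = ⟨i + β b, by omega⟩ := by
  subst h
  have : finSumFinEquiv.symm (⟨i + b, by omega⟩ : Fin (i + j)) = Sum.inr b :=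
    finSumFinEquiv_symm_apply_natAdd b
  simp only [blockPerm, Equiv.permCongr_apply, Equiv.symm_trans_apply, finCongr_symm, finCongr_apply,
    Fin.cast_refl, id, Equiv.trans_apply]
  rw [this]; rfl

theorem sign_blockPerm {i j n : ℕ} (h : i + j = n) (α : Equiv.Perm (Fin i))
    (β : Equiv.Perm (Fin j)) :
    Equiv.Perm.sign (blockPerm h α β) = Equiv.Perm.sign α * Equiv.Perm.sign β := by
  simp [blockPerm]

theorem mem_shuffles_iff {i j n : ℕ} (h : i + j = n) (σ : Equiv.Perm (Fin n)) :
    σ ∈ shuffles i n ↔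
      StrictMono (fun a : Fin i => σ (Fin.castLE (by omega) a)) ∧
      StrictMono (fun b : Fin j => σ ⟨i + b, by omega⟩) := by
  simp only [shuffles, Finset.mem_filter, Finset.mem_univ, true_and]
  constructor
  · rintro ⟨h1, h2⟩
    exact ⟨fun a b hab => h1 _ _ hab b.2, fun a b hab => h2 _ _ (by simpa using hab) (by simp)⟩
  · rintro ⟨h1, h2⟩
    refine ⟨fun a b hab hb => ?_, fun a b hab ha => ?_⟩
    · exact h1 (a := ⟨a, by have : (a : ℕ) < b := hab
                            omega⟩) (b := ⟨b, hb⟩) hab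
    · have hab' : (a : ℕ) < b := hab
      have := h2 (a := ⟨a - i, by omega⟩) (b := ⟨b - i, by omega⟩)
        (by simp only [Fin.mk_lt_mk]; omega)
      have e1 : (⟨i + (a - i), by omega⟩ : Fin n) = a := Fin.ext (by simp; omega)
      have e2 : (⟨i + (b - i), by omega⟩ : Fin n) = b := Fin.ext (by simp; omega)
      simpa only [e1, e2] using this

theorem perm_eq_one_of_strictMono {m : ℕ} {X : Type*} [LinearOrder X] (f : Fin m → X)
    (α : Equiv.Perm (Fin m)) (hf : StrictMono f) (hα : StrictMono (fun a => f (α a))) :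
    α = 1 := by
  have : f ∘ α = f := by
    exact (StrictMono.range_inj hα hf).1 (α.surjective.range_comp f)
  ext a
  have := hf.injective (congrFun this a)
  simp [this]

theorem blockPerm_ext {i j n : ℕ} (h : i + j = n) {σ τ : Equiv.Perm (Fin n)}
    (h1 : ∀ a : Fin i, σ (Fin.castLE (by omega) a) = τ (Fin.castLE (by omega) a))
    (h2 : ∀ b : Fin j, σ ⟨i + b, by omega⟩ = τ ⟨i + b, by omega⟩) : σ = τ := by
  ext c
  congr 1
  by_cases hc : (c : ℕ) < i
  · exact h1 ⟨c, hc⟩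
  · have := h2 ⟨c - i, by omega⟩
    have e1 : (⟨i + (c - i), by omega⟩ : Fin n) = c := Fin.ext (by simp; omega)
    simpa only [e1] using this

theorem blockPerm_mul {i j n : ℕ} (h : i + j = n) (α α' : Equiv.Perm (Fin i))
    (β β' : Equiv.Perm (Fin j)) :
    blockPerm h α β * blockPerm h α' β' = blockPerm h (α * α') (β * β') := by
  apply blockPerm_ext h <;> intro a <;>
    simp [blockPerm_left, blockPerm_right]

theorem sum_perm_eq_sum_shuffles {i j n : ℕ} (h : i + j = n) {N : Type*} [AddCommGroup N]
    (g : Equiv.Perm (Fin n) → N) (hg : ∀ σ α β, g (σ * blockPerm h α β) = g σ) :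
    ∑ σ, g σ = (i.factorial * j.factorial) • ∑ σ ∈ shuffles i n, g σ := by
  have key : ∑ x ∈ shuffles i n ×ˢ
      (Finset.univ : Finset (Equiv.Perm (Fin i) × Equiv.Perm (Fin j))), g x.1 = ∑ σ, g σ := by
    refine Finset.sum_bij (fun x _ => x.1 * blockPerm h x.2.1 x.2.2) (fun _ _ => Finset.mem_univ _)
      ?_ ?_ ?_
    · rintro ⟨τ, α, β⟩ hx ⟨τ', α', β'⟩ hx' heq
      simp only [Finset.mem_product, Finset.mem_univ, and_true] at hx hx'
      rw [mem_shuffles_iff h] at hx hx'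
      simp only at heq
      have e : τ' = τ * blockPerm h (α * α'⁻¹) (β * β'⁻¹) := by
        rw [← blockPerm_mul, ← mul_assoc, heq, mul_assoc, blockPerm_mul]
        have : blockPerm h (α' * α'⁻¹) (β' * β'⁻¹) = 1 := by
          apply blockPerm_ext h <;> intro a <;> simp [blockPerm_left, blockPerm_right]
        rw [this, mul_one]
      subst e
      have hα := perm_eq_one_of_strictMono _ (α * α'⁻¹) hx.1
        (by simpa only [Equiv.Perm.mul_apply (f := τ), blockPerm_left] using hx'.1)
      have hβ := perm_eq_one_of_strictMono _ (β * β'⁻¹) hx.2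
        (by simpa only [Equiv.Perm.mul_apply (f := τ), blockPerm_right] using hx'.2)
      rw [mul_inv_eq_one] at hα hβ
      subst hα hβ
      have : blockPerm h (α * α⁻¹) (β * β⁻¹) = 1 := by
        apply blockPerm_ext h <;> intro a <;> simp [blockPerm_left, blockPerm_right]
      rw [this, mul_one]
    · intro σ _
      let f1 : Fin i → Fin n := fun a => σ (Fin.castLE (by omega) a)
      let f2 : Fin j → Fin n := fun b => σ ⟨i + b, by omega⟩
      have i1 : Function.Injective f1 := σ.injective.comp (Fin.castLE_injective _)
      have i2 : Function.Injective f2 := fun a b hab => by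
        have := σ.injective hab
        simp only [Fin.mk.injEq] at this
        exact Fin.ext (by omega)
      refine ⟨(σ * blockPerm h (Tuple.sort f1) (Tuple.sort f2),
        (Tuple.sort f1)⁻¹, (Tuple.sort f2)⁻¹), ?_, ?_⟩
      · simp only [Finset.mem_product, Finset.mem_univ, and_true]
        rw [mem_shuffles_iff h]
        simp only [Equiv.Perm.mul_apply, blockPerm_left, blockPerm_right]
        exact ⟨(Tuple.monotone_sort f1).strictMono_of_injective (i1.comp (Equiv.injective _)),
          (Tuple.monotone_sort f2).strictMono_of_injective (i2.comp (Equiv.injective _))⟩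
      · simp only [mul_assoc, blockPerm_mul]
        have : blockPerm h (Tuple.sort f1 * (Tuple.sort f1)⁻¹)
            (Tuple.sort f2 * (Tuple.sort f2)⁻¹) = 1 := by
          apply blockPerm_ext h <;> intro a <;> simp [blockPerm_left, blockPerm_right]
        rw [this, mul_one]
    · rintro ⟨τ, α, β⟩ _
      exact (hg _ _ _).symm
  rw [← key, Finset.sum_product]
  simp [Finset.sum_const, Finset.smul_sum, Fintype.card_perm]

/-! ### The Nijenhuis–Richardson bracket -/

section NijenhuisRichardson

variable (K : Type*) [Field K] (M : Type*) [AddCommGroup M] [Module K M]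

/-- `C^n(M, M) = Hom(⋀^{n+1} M, M)`. -/
abbrev Cochain (n : ℕ) := M [⋀^Fin (n + 1)]→ₗ[K] M

/-- `C^*(M, M) = ⨁_{n ≥ 0} Hom(⋀^{n+1} M, M)`. -/
abbrev CochainSum := DirectSum ℕ (Cochain K M)

variable {K M}

/-- A cochain in `C^*(M, M)` is homogeneous of degree `p`. -/
def IsHomogeneousOfDegree (p : ℕ) (Q : CochainSum K M) : Prop := ∀ n, n ≠ p → Q n = 0

/-- The multilinear map `(x_1, …, x_{p+q+1}) ↦ P(Q(x_1, …, x_{q+1}), x_{q+2}, …, x_{p+q+1})`. -/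
def insertFirst {p q : ℕ} (P : Cochain K M p) (Q : Cochain K M q) :
    MultilinearMap K (fun _ : Fin (p + q + 1) => M) M :=
  (MultilinearMap.uncurrySum (N := fun _ : Fin (q + 1) ⊕ Fin p => M)
    (((AlternatingMap.toMultilinearMapLM (S := K)).comp P.curryLeft).compMultilinearMap
      Q.toMultilinearMap)).domDomCongr
    (finSumFinEquiv.trans (finCongr (by omega : q + 1 + p = p + q + 1)))

theorem insertFirst_apply {p q : ℕ} (P : Cochain K M p) (Q : Cochain K M q)
    (x : Fin (p + q + 1) → M) :
    insertFirst P Q x =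
      P (Fin.cons (Q fun a : Fin (q + 1) => x (Fin.castLE (by omega) a))
        fun b : Fin p => x ⟨q + 1 + b, by omega⟩) := rfl

theorem insertFirst_blockPerm {p q : ℕ} (P : Cochain K M p) (Q : Cochain K M q)
    (x : Fin (p + q + 1) → M) (α : Equiv.Perm (Fin (q + 1))) (β : Equiv.Perm (Fin p)) :
    insertFirst P Q (fun c => x (blockPerm (by omega : q + 1 + p = p + q + 1) α β c)) =
      Equiv.Perm.sign α • Equiv.Perm.sign β • insertFirst P Q x := by
  simp only [insertFirst_apply, blockPerm_left, blockPerm_right]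
  have h1 := Q.map_perm (fun a : Fin (q + 1) => x (Fin.castLE (by omega) a)) α
  have h2 := fun z : M => (P.curryLeft z).map_perm (fun b : Fin p => x ⟨q + 1 + b, by omega⟩) β
  simp only [Function.comp_def] at h1 h2
  change P.curryLeft _ _ = _ • _ • P.curryLeft _ _
  rw [h1, h2, smul_comm]
  congr 1
  rcases Int.units_eq_one_or (Equiv.Perm.sign α) with h | h <;> simp [h]

/-- The sum over the `(q+1, p)`-shuffles underlying `nrCirc`. -/
def shuffleSum {p q : ℕ} (P : Cochain K M p) (Q : Cochain K M q) :
    MultilinearMap K (fun _ : Fin (p + q + 1) => M) M :=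
  ∑ σ ∈ shuffles (q + 1) (p + q + 1), Equiv.Perm.sign σ • (insertFirst P Q).domDomCongr σ

theorem shuffleSum_apply {p q : ℕ} (P : Cochain K M p) (Q : Cochain K M q)
    (x : Fin (p + q + 1) → M) :
    shuffleSum P Q x =
      ∑ σ ∈ shuffles (q + 1) (p + q + 1), Equiv.Perm.sign σ •
        P (Fin.cons (Q fun a : Fin (q + 1) => x (σ (Fin.castLE (by omega) a)))
          fun b : Fin p => x (σ ⟨q + 1 + b, by omega⟩)) := by
  simp only [shuffleSum, sum_apply, smul_apply]
  rfl

theorem alternatization_insertFirst {p q : ℕ} (P : Cochain K M p) (Q : Cochain K M q)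
    (x : Fin (p + q + 1) → M) :
    MultilinearMap.alternatization (insertFirst P Q) x =
      ((q + 1).factorial * p.factorial) • shuffleSum P Q x := by
  rw [MultilinearMap.alternatization_apply]
  rw [sum_perm_eq_sum_shuffles (by omega : q + 1 + p = p + q + 1)]
  · simp only [shuffleSum, sum_apply, smul_apply]
  · intro σ α β
    have := insertFirst_blockPerm P Q (fun c => x (σ c)) α β
    simp only [MultilinearMap.domDomCongr_apply,
      Equiv.Perm.mul_apply, this, Equiv.Perm.sign_mul, sign_blockPerm, smul_smul]
    congr 1
    rw [mul_assoc, mul_mul_mul_comm, Int.units_mul_self, Int.units_mul_self]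
    simp

variable [CharZero K]

/-- The product `(P ∘̄ Q)(x_1, …, x_{p+q+1}) = ∑_{σ ∈ S_{(q+1,p)}} (-1)^σ
P(Q(x_{σ(1)}, …, x_{σ(q+1)}), x_{σ(q+2)}, …, x_{σ(p+q+1)})`. -/
def nrCirc {p q : ℕ} (P : Cochain K M p) (Q : Cochain K M q) : Cochain K M (p + q) :=
  { shuffleSum P Q with
    map_eq_zero_of_eq' := fun x i j hx hij => by
      have h := alternatization_insertFirst P Q x
      rw [AlternatingMap.map_eq_zero_of_eq _ x hx hij] at h
      have : CharZero K := inferInstance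
      rw [← Nat.cast_smul_eq_nsmul K] at h
      rcases smul_eq_zero.1 h.symm with h | h
      · exact absurd h (by exact_mod_cast (by positivity))
      · exact h }

theorem nrCirc_apply {p q : ℕ} (P : Cochain K M p) (Q : Cochain K M q)
    (x : Fin (p + q + 1) → M) :
    nrCirc P Q x =
      ∑ σ ∈ shuffles (q + 1) (p + q + 1), Equiv.Perm.sign σ •
        P (Fin.cons (Q fun a : Fin (q + 1) => x (σ (Fin.castLE (by omega) a)))
          fun b : Fin p => x (σ ⟨q + 1 + b, by omega⟩)) :=
  shuffleSum_apply P Q x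

variable (K M)

/-- `nrCirc` as a bilinear map. -/
def nrCircLin (p q : ℕ) : Cochain K M p →ₗ[K] Cochain K M q →ₗ[K] Cochain K M (p + q) :=
  LinearMap.mk₂ K nrCirc
    (fun P P' Q => by
      ext x
      simp [nrCirc_apply, Finset.sum_add_distrib])
    (fun c P Q => by
      ext x
      simp only [nrCirc_apply, AlternatingMap.smul_apply, Finset.smul_sum]
      exact Finset.sum_congr rfl fun σ _ => smul_comm _ _ _)
    (fun P Q Q' => by
      ext x
      simp only [nrCirc_apply, AlternatingMap.add_apply, ← Finset.sum_add_distrib, ← smul_add]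
      refine Finset.sum_congr rfl fun σ _ => ?_
      congr 1
      exact DFunLike.congr_fun (map_add P.curryLeft _ _) _)
    (fun c P Q => by
      ext x
      simp only [nrCirc_apply, AlternatingMap.smul_apply, Finset.smul_sum]
      refine Finset.sum_congr rfl fun σ _ => ?_
      rw [smul_comm c]
      congr 1
      exact DFunLike.congr_fun (map_smul P.curryLeft c _) _)

/-- The Nijenhuis–Richardson bracket: the bilinear map on `C^*(M, M)` given by
`[P, Q] = P ∘̄ Q - (-1)^{pq} Q ∘̄ P` for `P` of degree `p` and `Q` of degree `q`. -/
def nrBracket : CochainSum K M →ₗ[K] CochainSum K M →ₗ[K] CochainSum K M :=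
  DirectSum.toModule K ℕ _ fun p =>
    (DirectSum.toModule K ℕ _ fun q =>
      ((nrCircLin K M p q).compr₂ (DirectSum.lof K ℕ (Cochain K M) (p + q)) +
        (-(-1 : K) ^ (p * q)) • ((nrCircLin K M q p).flip.compr₂
          (DirectSum.lof K ℕ (Cochain K M) (q + p)))).flip).flip

theorem nrBracket_lof {p q : ℕ} (P : Cochain K M p) (Q : Cochain K M q) :
    nrBracket K M (DirectSum.lof K ℕ _ p P) (DirectSum.lof K ℕ _ q Q) =
      DirectSum.lof K ℕ _ (p + q) (nrCirc P Q) -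
        (-1 : K) ^ (p * q) • DirectSum.lof K ℕ _ (q + p) (nrCirc Q P) := by
  simp [nrBracket, nrCircLin, sub_eq_add_neg]

end NijenhuisRichardson

/-! ### `L∞`-algebras -/

section LInfinity

/-- The Koszul sign `ε(σ; v_1, …, v_n)` for `v_i` of degree `d i`, so that
`v_1 ⊙ ⋯ ⊙ v_n = ε(σ) v_{σ(1)} ⊙ ⋯ ⊙ v_{σ(n)}`. -/
def koszulSign {n : ℕ} (σ : Equiv.Perm (Fin n)) (d : Fin n → ℤ) : ℤˣ :=
  ∏ i, ∏ j, if i < j ∧ σ j < σ i then (d (σ i) * d (σ j)).negOnePow else 1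

variable {K : Type*} [Field K] {E : Type*} [AddCommGroup E] [Module K E]

/-- An `L∞`-algebra structure on the vector space `E` with the `ℤ`-grading `𝒜`: graded symmetric
operations `l k` (`k ≥ 1`) of degree `1` satisfying the generalized Jacobi identities. The operation
`l 0` is not part of the data and is set to `0`. -/
@[ext]
structure LInfinityAlgebra (𝒜 : ℤ → Submodule K E) where
  /-- the operations -/
  l : ∀ k : ℕ, MultilinearMap K (fun _ : Fin k => E) E
  l_zero : l 0 = 0
  isInternal : DirectSum.IsInternal 𝒜
  degree_one : ∀ (k : ℕ) (d : Fin k → ℤ) (x : Fin k → E), (∀ i, x i ∈ 𝒜 (d i)) →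
    l k x ∈ 𝒜 (∑ i, d i + 1)
  graded_symm : ∀ (n : ℕ) (d : Fin n → ℤ) (x : Fin n → E), (∀ i, x i ∈ 𝒜 (d i)) →
    ∀ σ : Equiv.Perm (Fin n), l n (fun i => x (σ i)) = koszulSign σ d • l n x
  jacobi : ∀ (n : ℕ) (d : Fin n → ℤ) (x : Fin n → E), 1 ≤ n → (∀ i, x i ∈ 𝒜 (d i)) →
    ∑ i ∈ (Finset.Icc 1 n).attach, ∑ σ ∈ shuffles i n, koszulSign σ d •
      l (n - i + 1) (Fin.cons
        (l i fun a : Fin i => x (σ (Fin.castLE (Finset.mem_Icc.1 i.2).2 a)))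
        (fun b : Fin (n - i) => x (σ ⟨i + b, by omega⟩))) = 0

variable {𝒜 : ℤ → Submodule K E}

/-- The `L∞`-algebra `A` is weakly filtered by the subspaces `F 1 ⊇ F 2 ⊇ ⋯` (the value `F 0` plays
no role), where `l_k` takes values in `F k` for all `k ≥ n`. Completeness says that for every degree
the canonical map from `𝒜 i` to the inverse limit of the quotients `𝒜 i / (F k ∩ 𝒜 i)` is injective
and surjective. -/
structure IsWeaklyFiltered (A : LInfinityAlgebra 𝒜) (F : ℕ → Submodule K E) (n : ℕ) : Prop where
  one_le : 1 ≤ n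
  first : F 1 = ⊤
  descending : ∀ k, 1 ≤ k → F (k + 1) ≤ F k
  graded : ∀ k, 1 ≤ k → F k = ⨆ i, F k ⊓ 𝒜 i
  l_mem : ∀ k, n ≤ k → ∀ x : Fin k → E, A.l k x ∈ F k
  complete_injective : ∀ (i : ℤ), ∀ a ∈ 𝒜 i, (∀ k, 1 ≤ k → a ∈ F k) → a = 0
  complete_surjective : ∀ (i : ℤ) (a : ℕ → E), (∀ k, a k ∈ 𝒜 i) →
    (∀ k, 1 ≤ k → a (k + 1) - a k ∈ F k) →
    ∃ b ∈ 𝒜 i, ∀ k, 1 ≤ k → b - a k ∈ F k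

/-- `α` is a Maurer–Cartan element: it has degree `0` and the series `∑_{k ≥ 1} (1/k!) l_k(α, …, α)`
converges to `0` in the topology of the filtration `F 1 ⊇ F 2 ⊇ ⋯`. -/
def IsMaurerCartan (A : LInfinityAlgebra 𝒜) (F : ℕ → Submodule K E) (α : E) : Prop :=
  α ∈ 𝒜 0 ∧ ∀ m, 1 ≤ m → ∃ N₀ : ℕ, ∀ N ≥ N₀,
    ∑ k ∈ Finset.Icc 1 N, (k.factorial : K)⁻¹ • A.l k (fun _ => α) ∈ F m

end LInfinity

/-! ### The graded spaces `L'`, `𝔥` and `s⁻¹L' ⊕ 𝔥` -/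

section Controlling

variable (K : Type*) [Field K] (𝔤 V : Type*) [AddCommGroup 𝔤] [Module K 𝔤]
  [AddCommGroup V] [Module K V]

/-- `C^{k|l}(𝔤 ⊕ V, 𝔤 ⊕ V)` inside `Hom(⋀^{n+1}(𝔤 ⊕ V), 𝔤 ⊕ V)`. On arguments of which those in
positions `S` lie in `𝔤` and the others in `V`, a map of bidegree `k|l` takes values in `𝔤` if there
are `k + 1` of the former and `l` of the latter, takes values in `V` if there are `k` of the former
and `l + 1` of the latter, and vanishes otherwise. (It is the zero space unless `k + l = n`.) -/
def bidegree (k l : ℤ) (n : ℕ) : Submodule K (Cochain K (𝔤 × V) n) where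
  carrier := {f | ∀ (S : Finset (Fin (n + 1))) (x : Fin (n + 1) → 𝔤 × V),
    (∀ i ∈ S, (x i).2 = 0) → (∀ i ∈ Sᶜ, (x i).1 = 0) →
      (((S.card : ℤ) = k + 1 ∧ (Sᶜ.card : ℤ) = l) → (f x).2 = 0) ∧
      (((S.card : ℤ) = k ∧ (Sᶜ.card : ℤ) = l + 1) → (f x).1 = 0) ∧
      (¬((S.card : ℤ) = k + 1 ∧ (Sᶜ.card : ℤ) = l) →
        ¬((S.card : ℤ) = k ∧ (Sᶜ.card : ℤ) = l + 1) → f x = 0)}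
  zero_mem' := fun S x _ _ => by simp
  add_mem' := fun {f g} hf hg S x h1 h2 => by
    obtain ⟨a, b, c⟩ := hf S x h1 h2
    obtain ⟨a', b', c'⟩ := hg S x h1 h2
    refine ⟨fun h => ?_, fun h => ?_, fun h h' => ?_⟩
    · simp [a h, a' h]
    · simp [b h, b' h]
    · simp [c h h', c' h h']
  smul_mem' := fun r f hf S x h1 h2 => by
    obtain ⟨a, b, c⟩ := hf S x h1 h2
    refine ⟨fun h => ?_, fun h => ?_, fun h h' => ?_⟩
    · simp [a h]
    · simp [b h]
    · simp [c h h']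

/-- `L' = ⨁_{n ≥ 0} C^{n|0}(𝔤 ⊕ V, 𝔤 ⊕ V)`, as a subspace of `L = C^*(𝔤 ⊕ V, 𝔤 ⊕ V)`. -/
def LPrime : Submodule K (CochainSum K (𝔤 × V)) :=
  ⨅ n : ℕ, (bidegree K 𝔤 V n 0 n).comap (DirectSum.component K ℕ (Cochain K (𝔤 × V)) n)

/-- `𝔥 = ⨁_{n ≥ 0} C^{-1|n+1}(𝔤 ⊕ V, 𝔤 ⊕ V)`, as a subspace of `L = C^*(𝔤 ⊕ V, 𝔤 ⊕ V)`; the space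
`C^{-1|n+1}(𝔤 ⊕ V, 𝔤 ⊕ V)` is `Hom(⋀^{n+1} V, 𝔤)`. -/
def hSub : Submodule K (CochainSum K (𝔤 × V)) :=
  ⨅ n : ℕ, (bidegree K 𝔤 V (-1) (n + 1) n).comap (DirectSum.component K ℕ (Cochain K (𝔤 × V)) n)

theorem mem_LPrime {Q : CochainSum K (𝔤 × V)} :
    Q ∈ LPrime K 𝔤 V ↔ ∀ n : ℕ, Q n ∈ bidegree K 𝔤 V n 0 n := by
  simp only [LPrime, Submodule.mem_iInf, Submodule.mem_comap]
  rfl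

theorem mem_hSub {Q : CochainSum K (𝔤 × V)} :
    Q ∈ hSub K 𝔤 V ↔ ∀ n : ℕ, Q n ∈ bidegree K 𝔤 V (-1) (n + 1) n := by
  simp only [hSub, Submodule.mem_iInf, Submodule.mem_comap]
  rfl

/-- The projection `P : L → L` onto `𝔥` along the other bidegrees: on each `Hom(⋀^{n+1}(𝔤 ⊕ V), 𝔤 ⊕ V)`
it restricts a map to the arguments in `V` and keeps the `𝔤`-component of the value. -/
def projH : CochainSum K (𝔤 × V) →ₗ[K] CochainSum K (𝔤 × V) :=
  DirectSum.lmap fun n : ℕ =>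
    { toFun := fun f : Cochain K (𝔤 × V) n =>
        (LinearMap.inl K 𝔤 V ∘ₗ LinearMap.fst K 𝔤 V).compAlternatingMap
          (f.compLinearMap (LinearMap.inr K 𝔤 V ∘ₗ LinearMap.snd K 𝔤 V))
      map_add' := fun f g => by ext <;> simp
      map_smul' := fun c f => by ext <;> simp }

/-- The vector space underlying `s⁻¹L' ⊕ 𝔥`; the desuspension only affects the grading. -/
abbrev Ctrl := LPrime K 𝔤 V × hSub K 𝔤 V

/-- The grading of `s⁻¹L' ⊕ 𝔥`: the degree `i` part consists of the pairs `(s⁻¹Q, θ)` with `Q` of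
degree `i + 1` in `L'` and `θ` of degree `i` in `𝔥`. -/
def ctrlGrading (i : ℤ) : Submodule K (Ctrl K 𝔤 V) where
  carrier := {x | ∀ n : ℕ, ((n : ℤ) ≠ i + 1 → (x.1 : CochainSum K (𝔤 × V)) n = 0) ∧
    ((n : ℤ) ≠ i → (x.2 : CochainSum K (𝔤 × V)) n = 0)}
  zero_mem' := fun n => by simp
  add_mem' := fun {x y} hx hy n => by
    refine ⟨fun h => ?_, fun h => ?_⟩
    · simp [(hx n).1 h, (hy n).1 h]
    · simp [(hx n).2 h, (hy n).2 h]
  smul_mem' := fun c x hx n => by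
    refine ⟨fun h => ?_, fun h => ?_⟩
    · change c • (x.1 : CochainSum K (𝔤 × V)) n = 0
      rw [(hx n).1 h, smul_zero]
    · change c • (x.2 : CochainSum K (𝔤 × V)) n = 0
      rw [(hx n).2 h, smul_zero]

variable [CharZero K]

variable {K 𝔤 V} in
/-- The iterated bracket `[⋯[[a, θ_1], θ_2], ⋯, θ_m]`. -/
def iterBracket {m : ℕ} (a : CochainSum K (𝔤 × V)) (θ : Fin m → CochainSum K (𝔤 × V)) :
    CochainSum K (𝔤 × V) :=
  Fin.foldl m (fun b i => nrBracket K (𝔤 × V) b (θ i)) a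

variable {K 𝔤 V} in
/-- The graded symmetric operations `l` on `s⁻¹L' ⊕ 𝔥` are the higher derived brackets (of Voronov,
for `Δ = 0`): `l_2(s⁻¹Q, s⁻¹Q') = (-1)^{|Q|} s⁻¹[Q, Q']`,
`l_k(s⁻¹Q, θ_1, …, θ_{k-1}) = P[⋯[[Q, θ_1], θ_2], ⋯, θ_{k-1}]` for `k ≥ 2`, and `l_k` vanishes on
all other combinations of arguments from `s⁻¹L'` (those in the positions `S`) and from `𝔥`
that do not arise from these two by permutation. -/
structure IsHigherDerivedBrackets
    (l : ∀ k : ℕ, MultilinearMap K (fun _ : Fin k => Ctrl K 𝔤 V) (Ctrl K 𝔤 V)) : Prop where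
  l_two_fst : ∀ (p : ℕ) (Q Q' : LPrime K 𝔤 V), IsHomogeneousOfDegree p Q.1 →
    ((l 2 ![(Q, 0), (Q', 0)]).1 : CochainSum K (𝔤 × V)) =
      (-1 : K) ^ p • nrBracket K (𝔤 × V) Q Q'
  l_two_snd : ∀ (Q Q' : LPrime K 𝔤 V), (l 2 ![(Q, 0), (Q', 0)]).2 = 0
  l_mixed_fst : ∀ (m : ℕ), 1 ≤ m → ∀ (Q : LPrime K 𝔤 V) (θ : Fin m → hSub K 𝔤 V),
    (l (m + 1) (Fin.cons (Q, 0) fun i => (0, θ i))).1 = 0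
  l_mixed_snd : ∀ (m : ℕ), 1 ≤ m → ∀ (Q : LPrime K 𝔤 V) (θ : Fin m → hSub K 𝔤 V),
    ((l (m + 1) (Fin.cons (Q, 0) fun i => (0, θ i))).2 : CochainSum K (𝔤 × V)) =
      projH K 𝔤 V (iterBracket (Q : CochainSum K (𝔤 × V)) fun i => (θ i : CochainSum K (𝔤 × V)))
  l_other : ∀ (k : ℕ) (S : Finset (Fin k)) (x : Fin k → Ctrl K 𝔤 V),
    (∀ i ∈ S, (x i).2 = 0) → (∀ i ∉ S, (x i).1 = 0) →
    ¬(k = 2 ∧ S.card = 2) → ¬(2 ≤ k ∧ S.card = 1) → l k x = 0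

/-- The iterated bracket spaces `[⋯[s⁻¹L' ⊕ 𝔥, 𝔥], ⋯, 𝔥]` with `m` brackets, as subspaces of `L`. -/
def iterSpace : ℕ → Submodule K (CochainSum K (𝔤 × V))
  | 0 => LPrime K 𝔤 V ⊔ hSub K 𝔤 V
  | m + 1 => Submodule.map₂ (nrBracket K (𝔤 × V)) (iterSpace m) (hSub K 𝔤 V)

/-- The filtration of `s⁻¹L' ⊕ 𝔥`: `F_1 = s⁻¹L' ⊕ 𝔥`, and for `k ≥ 2` the subspace `F_k` of `𝔥` is
`P[⋯[s⁻¹L' ⊕ 𝔥, 𝔥], ⋯, 𝔥]` with `k - 1` brackets. -/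
def ctrlFiltration : ℕ → Submodule K (Ctrl K 𝔤 V)
  | 0 => ⊤
  | 1 => ⊤
  | k + 2 => Submodule.prod ⊥
      (((iterSpace K 𝔤 V (k + 1)).map (projH K 𝔤 V)).comap (hSub K 𝔤 V).subtype)

end Controlling

/-! ### Relative Rota–Baxter Lie algebras -/

section RotaBaxter

variable {K : Type*} [Field K] {𝔤 V : Type*} [AddCommGroup 𝔤] [Module K 𝔤]
  [AddCommGroup V] [Module K V]

/-- `((𝔤, μ), ρ, T)` is a relative Rota–Baxter Lie algebra: `μ` is a Lie bracket on `𝔤`, `ρ` is a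
representation of `(𝔤, μ)` on `V`, and `T` is a relative Rota–Baxter operator. -/
structure IsRelRotaBaxterLie (μ : 𝔤 [⋀^Fin 2]→ₗ[K] 𝔤) (ρ : 𝔤 →ₗ[K] V →ₗ[K] V) (T : V →ₗ[K] 𝔤) :
    Prop where
  jacobi : ∀ x y z : 𝔤, μ ![μ ![x, y], z] + μ ![μ ![y, z], x] + μ ![μ ![z, x], y] = 0
  rep : ∀ (x y : 𝔤) (v : V), ρ (μ ![x, y]) v = ρ x (ρ y v) - ρ y (ρ x v)
  rotaBaxter : ∀ u v : V, μ ![T u, T v] = T (ρ (T u) v - ρ (T v) u)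

theorem vec_left (μ : 𝔤 [⋀^Fin 2]→ₗ[K] 𝔤) (a b c : 𝔤) :
    μ ![a + b, c] = μ ![a, c] + μ ![b, c] := μ.toMultilinearMap.cons_add ![c] a b

theorem vec_left_smul (μ : 𝔤 [⋀^Fin 2]→ₗ[K] 𝔤) (r : K) (a c : 𝔤) :
    μ ![r • a, c] = r • μ ![a, c] := μ.toMultilinearMap.cons_smul ![c] r a

theorem vec_swap (μ : 𝔤 [⋀^Fin 2]→ₗ[K] 𝔤) (a b : 𝔤) : μ ![a, b] = -μ ![b, a] := by
  have := μ.map_swap ![b, a] (i := 0) (j := 1) (by simp)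
  rw [← this]
  congr 1
  ext i
  fin_cases i <;> simp

theorem vec_right (μ : 𝔤 [⋀^Fin 2]→ₗ[K] 𝔤) (a b c : 𝔤) :
    μ ![c, a + b] = μ ![c, a] + μ ![c, b] := by
  rw [vec_swap, vec_left, vec_swap μ a, vec_swap μ b]; abel

theorem vec_right_smul (μ : 𝔤 [⋀^Fin 2]→ₗ[K] 𝔤) (r : K) (a c : 𝔤) :
    μ ![c, r • a] = r • μ ![c, a] := by
  rw [vec_swap, vec_left_smul, vec_swap μ a, smul_neg, neg_neg]

/-- The element `π = μ + ρ` of `C^1(𝔤 ⊕ V, 𝔤 ⊕ V)`, i.e. the map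
`((x, u), (y, v)) ↦ (μ(x, y), ρ(x)v - ρ(y)u)`. -/
def liftPi (μ : 𝔤 [⋀^Fin 2]→ₗ[K] 𝔤) (ρ : 𝔤 →ₗ[K] V →ₗ[K] V) : Cochain K (𝔤 × V) 1 where
  toFun x := (μ ![(x 0).1, (x 1).1], ρ (x 0).1 (x 1).2 - ρ (x 1).1 (x 0).2)
  map_update_add' x i a b := by
    fin_cases i <;> ext <;> simp [vec_left, vec_right, Function.update_of_ne] <;> abel
  map_update_smul' x i c a := by
    fin_cases i <;> ext <;> simp [vec_left_smul, vec_right_smul, smul_sub]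
  map_eq_zero_of_eq' x i j h hij := by
    have h01 : x 0 = x 1 := by
      fin_cases i <;> fin_cases j <;> simp_all
    ext
    · exact μ.map_eq_zero_of_eq _ (i := 0) (j := 1) (by simp [h01]) (by simp)
    · simp [h01]

/-- The lift of `T` to `C^0(𝔤 ⊕ V, 𝔤 ⊕ V)`, i.e. the map `(x, v) ↦ (T v, 0)`. -/
def liftT (T : V →ₗ[K] 𝔤) : Cochain K (𝔤 × V) 0 :=
  AlternatingMap.ofSubsingleton K (𝔤 × V) (𝔤 × V) (0 : Fin 1)
    (LinearMap.inl K 𝔤 V ∘ₗ T ∘ₗ LinearMap.snd K 𝔤 V)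

theorem liftPi_mem (μ : 𝔤 [⋀^Fin 2]→ₗ[K] 𝔤) (ρ : 𝔤 →ₗ[K] V →ₗ[K] V) :
    DirectSum.lof K ℕ (Cochain K (𝔤 × V)) 1 (liftPi μ ρ) ∈ LPrime K 𝔤 V := by
  rw [mem_LPrime]
  intro n
  by_cases hn : n = 1
  · subst hn
    rw [DirectSum.lof_apply]
    intro S x h1 h2
    have e0 : ∀ y : 𝔤, μ ![0, y] = 0 := fun y => μ.map_coord_zero 0 rfl
    have e1 : ∀ y : 𝔤, μ ![y, 0] = 0 := fun y => μ.map_coord_zero 1 rfl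
    have hx : liftPi μ ρ x =
      (μ ![(x 0).1, (x 1).1], ρ (x 0).1 (x 1).2 - ρ (x 1).1 (x 0).2) := rfl
    rw [hx]
    by_cases h0 : (0 : Fin 2) ∈ S <;> by_cases h1' : (1 : Fin 2) ∈ S
    · have hS : S = {0, 1} := by ext i; fin_cases i <;> simp [h0, h1']
      have hc : ({1}ᶜ : Finset (Fin 2)).card = 1 := rfl
      subst hS
      simp [h1 0 h0, h1 1 h1', hc]
    · have hS : S = {0} := by ext i; fin_cases i <;> simp [h0, h1']
      have hc : ({0}ᶜ : Finset (Fin 2)).card = 1 := rfl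
      subst hS
      simp [h1 0 h0, h2 1 (by simp), e1, hc]
    · have hS : S = {1} := by ext i; fin_cases i <;> simp [h0, h1']
      have hc : ({1}ᶜ : Finset (Fin 2)).card = 1 := rfl
      subst hS
      simp [h1 1 h1', h2 0 (by simp), e0, hc]
    · have hS : S = ∅ := by ext i; fin_cases i <;> simp [h0, h1']
      subst hS
      simp [h2 0 (by simp), h2 1 (by simp), e0]
  · rw [DirectSum.lof_eq_of, DirectSum.of_eq_of_ne _ _ _ hn]
    exact Submodule.zero_mem _

theorem liftT_mem (T : V →ₗ[K] 𝔤) :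
    DirectSum.lof K ℕ (Cochain K (𝔤 × V)) 0 (liftT T) ∈ hSub K 𝔤 V := by
  rw [mem_hSub]
  intro n
  by_cases hn : n = 0
  · subst hn
    rw [DirectSum.lof_apply]
    intro S x h1 h2
    have hx : liftT T x = (T (x 0).2, 0) := rfl
    rw [hx]
    by_cases h0 : (0 : Fin 1) ∈ S
    · simp [h1 0 h0]
    · have hS : S = ∅ := by
        ext i
        fin_cases i
        simpa using h0
      subst hS
      simp
  · rw [DirectSum.lof_eq_of, DirectSum.of_eq_of_ne _ _ _ hn]
    exact Submodule.zero_mem _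

/-- The element `(s⁻¹(μ + ρ), T)` of `s⁻¹L' ⊕ 𝔥`. -/
def ctrlPoint (μ : 𝔤 [⋀^Fin 2]→ₗ[K] 𝔤) (ρ : 𝔤 →ₗ[K] V →ₗ[K] V) (T : V →ₗ[K] 𝔤) : Ctrl K 𝔤 V :=
  (⟨_, liftPi_mem μ ρ⟩, ⟨_, liftT_mem T⟩)

end RotaBaxter

end RelRB

end

open RelRB

set_option linter.unusedSectionVars false

-- The elaborator sorts universe parameters by name; in this order `Type (max w v)` has one form only,
-- which makes the kernel check of the results on `𝔤 × V` much faster.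
universe w v

namespace RelRB

/-! ### Composition of functions on lists -/

section ListCalculus

variable {M N : Type*} [AddCommGroup M] [AddCommGroup N]

/-! A cochain is regarded as a function on lists of arguments (`hat`), and `circ` computes ∘̄ by
feeding in the arguments one at a time: each goes into the inner map or, with a sign, into a
remaining slot of the outer one. Identities between shuffle sums thus become inductions along a
list. In this form ∘̄ is a graded pre-Lie product (`circ_preLie`), so its graded commutator is a
graded Lie bracket (`nrBracket_jacobi`). Shuffle sums with Koszul signs are equally recursive
(`sum_shuffles_eq_splitSum`), which covers both ∘̄, with all arguments of degree 1, and the L∞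
identities.

For the L∞ structure, bracketing with elements of the abelian subalgebra 𝔥 acts by commuting
derivations, so formally [e^θ Q, e^θ Q] = e^θ [Q, Q]; `splitSum_derivedSum` is the polarised form.
Applying P and using P[a, b] = P[Pa, b] + P[a, Pb] (`projH_nrBracket`) turns it into the generalized
Jacobi identities in 𝔥 (`splitSum_projH`); in L' they are the Jacobi identity of the bracket.
Uniqueness holds because the operations are prescribed on a spanning set up to graded symmetry.

Bidegrees are detected by the dilation that doubles V: bidegree k|l means weight l, weights add
under brackets, L' has weight 0, and P keeps only weight = degree + 1. Hence P[⋯[Q, θ_1], ⋯, θ_m]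
vanishes unless Q has degree m - 1 (`projH_foldBr_eq_zero`). So the k-th step of the filtration, k ≥
2, lives in degrees ≥ k - 2, which gives completeness.

The hard point is that the filtration decreases: an iterated bracket of Q of degree m with m + 1
elements of 𝔥 must be rewritten with m elements of 𝔥. The idea is to encode two of them, θ_1 and
θ_2, in a single θ with values "(θ_1, θ_2)" in 𝔤, and to replace Q by Q' = Q composed with a
decoding p of one argument into a formal sum of pairs. For this 𝔤 is cut into at least m blocks,
each absorbing products of blocks (`exists_blocks`); by linearity each element of 𝔥 may be taken
with values in one block, and the m - 1 elements that are not encoded leave a block free for the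
code, so that p does not see their values. If dim 𝔤 < m there are too few blocks, but then Q = 0
(`eq_zero_of_finrank_lt`). A further obstacle is that a bracket [f, θ] also contains θ ∘̄ f, whereas
the encoding needs θ_1 and θ_2 inserted into Q. Averaging over all ways to replace two brackets by
∘̄ reproduces the full bracket with a nonzero binomial factor (`projH_foldBr_mem_of_pairs`), which
is invertible in characteristic 0.

For α = (s⁻¹(μ + ρ), T) only l_2 and l_3 survive, so the Maurer–Cartan series is -½[μ + ρ, μ + ρ] in
L' plus ½P[[μ + ρ, T], T] in 𝔥. The first component vanishes exactly when μ is a Lie bracket and ρ a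
representation, the second exactly when T is a relative Rota–Baxter operator. -/

/-- Insertion of `x` as the first argument. -/
def contr (x : M) (f : List M → N) : List M → N := fun ys => f (x :: ys)

/-- The parity operator on functions of lists; a function of `n` arguments has degree `n - 1`. -/
def parity (f : List M → N) : List M → N := fun ys => (-1 : ℤ) ^ (ys.length + 1) • f ys

/-- The composition `f ∘̄ g`, computed by inserting the arguments one by one. -/
def circ : (List M → N) → (List M → M) → List M → N
  | f, g, [] => f [g []]
  | f, g, x :: xs => circ f (contr x g) xs + circ (contr x f) (parity g) xs

theorem contr_apply (x : M) (f : List M → N) (ys : List M) : contr x f ys = f (x :: ys) := rfl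

theorem contr_circ (x : M) (f : List M → N) (g : List M → M) :
    contr x (circ f g) = circ f (contr x g) + circ (contr x f) (parity g) := rfl

@[simp] theorem contr_zero (x : M) : contr x (0 : List M → N) = 0 := rfl

@[simp] theorem contr_add (x : M) (f g : List M → N) : contr x (f + g) = contr x f + contr x g := rfl

@[simp] theorem contr_zsmul (x : M) (c : ℤ) (f : List M → N) : contr x (c • f) = c • contr x f := rfl

@[simp] theorem contr_neg (x : M) (f : List M → N) : contr x (-f) = -contr x f := rfl

@[simp] theorem parity_zero : parity (0 : List M → N) = 0 := by
  funext; simp [parity]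

@[simp] theorem parity_add (f g : List M → N) : parity (f + g) = parity f + parity g := by
  funext; simp [parity]

@[simp] theorem parity_sub (f g : List M → N) : parity (f - g) = parity f - parity g := by
  funext; simp [parity, smul_sub]

@[simp] theorem parity_zsmul (c : ℤ) (f : List M → N) : parity (c • f) = c • parity f := by
  funext; simp [parity, smul_comm c]

@[simp] theorem parity_parity (f : List M → N) : parity (parity f) = f := by
  funext ys
  simp only [parity, smul_smul, ← pow_add, ← two_mul]
  simp

theorem parity_contr (x : M) (f : List M → N) : parity (contr x f) = -contr x (parity f) := by
  funext ys
  simp [parity, contr, pow_succ]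

theorem contr_parity (x : M) (f : List M → N) : contr x (parity f) = -parity (contr x f) := by
  rw [parity_contr, neg_neg]

theorem parity_nil (f : List M → N) : parity f [] = -f [] := by simp [parity]

theorem circ_add_left (f f' : List M → N) (g : List M → M) :
    circ (f + f') g = circ f g + circ f' g := by
  funext xs
  induction xs generalizing f f' g with
  | nil => rfl
  | cons x xs ih =>
    simp only [circ, Pi.add_apply] at *
    rw [ih, contr_add, ih]; abel

theorem circ_neg_left (f : List M → N) (g : List M → M) : circ (-f) g = -circ f g := by
  funext xs
  induction xs generalizing f g with
  | nil => rfl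
  | cons x xs ih =>
    simp only [circ, Pi.neg_apply] at *
    rw [ih, contr_neg, ih]; abel

theorem circ_zero_left (g : List M → M) : circ (0 : List M → N) g = 0 := by
  have := circ_add_left (0 : List M → N) 0 g
  simpa using this

theorem circ_sub_left (f f' : List M → N) (g : List M → M) :
    circ (f - f') g = circ f g - circ f' g := by
  rw [sub_eq_add_neg, circ_add_left, circ_neg_left, sub_eq_add_neg]

theorem circ_zsmul_left (c : ℤ) (f : List M → N) (g : List M → M) :
    circ (c • f) g = c • circ f g := by
  let F : (List M → N) →+ (List M → N) :=
    { toFun := fun f => circ f g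
      map_zero' := circ_zero_left g
      map_add' := fun f f' => circ_add_left f f' g }
  exact map_zsmul F c f

variable {K : Type*} [Field K] [Module K M] [Module K N]

theorem circ_smul_left (c : K) (f : List M → N) (g : List M → M) :
    circ (c • f) g = c • circ f g := by
  funext xs
  induction xs generalizing f g with
  | nil => rfl
  | cons x xs ih =>
    simp only [circ, Pi.smul_apply, smul_add] at *
    rw [ih f, ← ih (contr x f)]; rfl

variable (K) in
/-- `f` is linear in its last argument. -/
def EndLin (f : List M → N) : Prop := ∀ B, IsLinearMap K fun y => f (B ++ [y])

variable (K) in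
/-- `f` is multilinear and alternating. -/
structure IsAlt (f : List M → N) : Prop where
  lin : ∀ A B, IsLinearMap K fun y => f (A ++ y :: B)
  swap : ∀ A x y B, f (A ++ x :: y :: B) = -f (A ++ y :: x :: B)

theorem EndLin.contr {f : List M → N} (hf : EndLin K f) (x : M) : EndLin K (contr x f) :=
  fun B => hf (x :: B)

theorem EndLin.parity {f : List M → N} (hf : EndLin K f) : EndLin K (parity f) :=
  fun B => ⟨fun x y => by simp [RelRB.parity, (hf B).map_add],
    fun c x => by simp [RelRB.parity, (hf B).map_smul, smul_comm c]⟩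

theorem IsAlt.contr {f : List M → N} (hf : IsAlt K f) (x : M) : IsAlt K (contr x f) :=
  ⟨fun A B => hf.lin (x :: A) B, fun A => hf.swap (x :: A)⟩

theorem IsAlt.endLin {f : List M → N} (hf : IsAlt K f) : EndLin K f := fun B => hf.lin B []

theorem EndLin.map_zero {f : List M → N} (hf : EndLin K f) : f [0] = 0 := (hf []).map_zero

theorem circ_add_right {f : List M → N} (hf : EndLin K f) (g g' : List M → M) :
    circ f (g + g') = circ f g + circ f g' := by
  funext xs
  induction xs generalizing f g g' with
  | nil => exact (hf []).map_add _ _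
  | cons x xs ih =>
    simp only [circ, Pi.add_apply] at *
    rw [contr_add, ih hf, parity_add, ih (hf.contr x)]; abel

theorem circ_zero_right {f : List M → N} (hf : EndLin K f) : circ f 0 = 0 := by
  have := circ_add_right hf 0 0
  simpa using this

variable (K) in
/-- `circ f` as an additive map. -/
def circHom (f : List M → N) (hf : EndLin K f) : (List M → M) →+ (List M → N) where
  toFun := circ f
  map_zero' := circ_zero_right hf
  map_add' := circ_add_right hf

theorem circ_neg_right {f : List M → N} (hf : EndLin K f) (g : List M → M) :
    circ f (-g) = -circ f g := map_neg (circHom K f hf) g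

theorem circ_sub_right {f : List M → N} (hf : EndLin K f) (g g' : List M → M) :
    circ f (g - g') = circ f g - circ f g' := map_sub (circHom K f hf) g g'

theorem circ_zsmul_right {f : List M → N} (hf : EndLin K f) (c : ℤ) (g : List M → M) :
    circ f (c • g) = c • circ f g := map_zsmul (circHom K f hf) c g

theorem parity_smul (c : K) (f : List M → N) : parity (c • f) = c • parity f := by
  funext; simp [parity, smul_comm c]

theorem circ_smul_right {f : List M → N} (hf : EndLin K f) (c : K) (g : List M → M) :
    circ f (c • g) = c • circ f g := by
  funext xs
  induction xs generalizing f g with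
  | nil => exact (hf []).map_smul _ _
  | cons x xs ih =>
    simp only [circ, Pi.smul_apply, smul_add] at *
    rw [parity_smul, ih (hf.contr x), ← ih hf]; rfl

/-- Linearity in the last argument is all that additivity of `circ` on the right needs, and it
passes to `circ f g` by a short induction, with no proof that `circ f g` is alternating. Alternation
of `f` brings the second summand of the base case into the form `f [g [], y]`. -/
theorem EndLin.circ {f : List M → N} {g : List M → M} (hf : IsAlt K f) (hg : EndLin K g) :
    EndLin K (circ f g) := by
  intro B
  induction B generalizing f g with
  | nil =>
    have h1 : ∀ y, RelRB.circ f g ([] ++ [y]) = f [g [y]] + f [g [], y] := by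
      intro y
      simp only [RelRB.circ, List.nil_append, RelRB.contr, parity_nil]
      have := (hf.lin [y] []).map_neg (g [])
      simp only [List.cons_append, List.nil_append] at this
      rw [this]
      have := hf.swap [] y (g []) []
      simp only [List.nil_append] at this
      rw [this, neg_neg]
    simp only [h1]
    have a := hf.lin [] []
    have b := hf.lin [g []] []
    have c := hg []
    simp only [List.nil_append, List.cons_append] at a b c
    constructor
    · intro x y
      simp only [b.map_add, c.map_add, a.map_add]; abel
    · intro r x
      simp only [b.map_smul, c.map_smul, a.map_smul, smul_add]
  | cons x B ih =>
    have h1 := ih hf (hg.contr x)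
    have h2 := ih (hf.contr x) hg.parity
    constructor
    · intro y z
      simp only [List.cons_append, RelRB.circ, h1.map_add, h2.map_add]; abel
    · intro r y
      simp only [List.cons_append, RelRB.circ, h1.map_smul, h2.map_smul, smul_add]

/-- Degrees add under ∘̄, since the value of `g` occupies one slot of `f`; so the sign operator is
multiplicative. -/
theorem parity_circ (f : List M → N) {g : List M → M} (hf : EndLin K f) :
    parity (circ f g) = circ (parity f) (parity g) := by
  funext xs
  induction xs generalizing f g with
  | nil =>
    simp only [parity_nil, circ]
    have := (hf []).map_neg (g [])
    simp only [List.nil_append] at this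
    simp [parity, this]
  | cons x xs ih =>
    have h : parity (circ f g) (x :: xs) = -parity (contr x (circ f g)) xs := by
      rw [parity_contr]; simp [contr]
    rw [h, contr_circ, parity_add, Pi.add_apply, ih f hf, ih _ (hf.contr x)]
    simp only [circ]
    rw [parity_contr, parity_contr, circ_neg_left, contr_parity, contr_parity, parity_parity,
      circ_neg_right hf.parity, circ_neg_left]
    simp only [Pi.neg_apply, neg_neg, neg_add]

theorem parity_circ_of {f : List M → N} {g : List M → M} (hf : EndLin K f) {p q : ℕ}
    (hp : parity f = (-1 : ℤ) ^ p • f) (hq : parity g = (-1 : ℤ) ^ q • g) :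
    parity (circ f g) = (-1 : ℤ) ^ (p + q) • circ f g := by
  rw [parity_circ f hf, hp, hq, circ_zsmul_left, circ_zsmul_right hf, smul_smul, pow_add]

theorem parity_contr_of {g : List M → N} {q : ℕ} (hq : parity g = (-1 : ℤ) ^ q • g) (x : M) :
    parity (contr x g) = (-1 : ℤ) ^ (q + 1) • contr x g := by
  rw [parity_contr, hq, pow_succ]; simp

/-- The pre-Lie identity: the associator is graded symmetric in its last two arguments. -/
theorem circ_preLie {f : List M → N} {g h : List M → M} (hf : IsAlt K f) (hg : EndLin K g)
    (hh : EndLin K h) {q r : ℕ} (hq : parity g = (-1 : ℤ) ^ q • g)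
    (hr : parity h = (-1 : ℤ) ^ r • h) :
    circ (circ f g) h - circ f (circ g h) =
      (-1 : ℤ) ^ (q * r) • (circ (circ f h) g - circ f (circ h g)) := by
  funext xs
  induction xs generalizing f g h q r with
  | nil =>
    have e : ∀ g h : List M → M, (circ (circ f g) h - circ f (circ g h)) [] =
        - f [h [], g []] := by
      intro g h
      simp only [Pi.sub_apply, circ, contr, parity_nil]
      have := (hf.lin [h []] []).map_neg (g [])
      simp only [List.cons_append, List.nil_append] at this
      rw [this]; abel
    rw [e, Pi.smul_apply, e]
    have hq0 := congrFun hq []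
    have hr0 := congrFun hr []
    rw [parity_nil] at hq0 hr0
    have l1 := (hf.lin [] [h []])
    have l2 := (hf.lin [g []] [])
    have z1 := l1.map_zero
    have z2 := l2.map_zero
    have s := hf.swap [] (h []) (g []) []
    simp only [List.nil_append, List.cons_append] at z1 z2 s
    rw [s]
    -- On the empty list `parity` is -1, so homogeneity of even degree makes the value 2-torsion and
    -- the sign in the claim immaterial. If both degrees are odd, the sign is the one from swapping
    -- two arguments of `f`.
    have ev : ∀ {n : ℕ} {z : M}, Even n → -z = (-1 : ℤ) ^ n • z → z + z = 0 := by
      intro n z hn hz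
      rw [hn.neg_one_pow, one_smul] at hz
      rw [← sub_neg_eq_add, hz, sub_self]
    rcases Nat.even_or_odd q with hqe | hqo
    · have hz : g [] + g [] = 0 := ev hqe hq0
      have := congrArg (fun z => f [z, h []]) hz
      have l := l1.map_add (g []) (g [])
      simp only [List.nil_append] at l
      simp only [l, z1] at this
      rw [(hqe.mul_right r).neg_one_pow, one_smul, neg_neg]
      rw [eq_neg_iff_add_eq_zero]; exact this
    rcases Nat.even_or_odd r with hre | hro
    · have hz : h [] + h [] = 0 := ev hre hr0
      have := congrArg (fun z => f [g [], z]) hz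
      have l := l2.map_add (h []) (h [])
      simp only [List.nil_append, List.cons_append] at l
      simp only [l, z2] at this
      rw [(hre.mul_left q).neg_one_pow, one_smul, neg_neg]
      rw [eq_neg_iff_add_eq_zero]; exact this
    · rw [(hqo.mul hro).neg_one_pow]; simp
  | cons x xs ih =>
    -- Contracting the associator with `x` gives three associators, with `x` in `h`, in `g` or in
    -- `f`, up to sign. The induction hypothesis applies to each.
    have key : ∀ {g h : List M → M} {q r : ℕ} (hg : EndLin K g) (hh : EndLin K h)
        (hq : parity g = (-1 : ℤ) ^ q • g) (hr : parity h = (-1 : ℤ) ^ r • h),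
        (circ (circ f g) h - circ f (circ g h)) (x :: xs) =
          (circ (circ f g) (contr x h) - circ f (circ g (contr x h))) xs +
          (-1 : ℤ) ^ r • (circ (circ f (contr x g)) h - circ f (circ (contr x g) h)) xs +
          (-1 : ℤ) ^ (q + r) • (circ (circ (contr x f) g) h - circ (contr x f) (circ g h)) xs := by
      intro g h q r hg hh hq hr
      simp only [Pi.sub_apply, circ]
      rw [contr_circ, circ_add_left, contr_circ, circ_add_right hf.endLin, hr,
        circ_zsmul_right (EndLin.circ hf (hg.contr x)), hq,
        circ_zsmul_right (hf.contr x).endLin, circ_zsmul_left,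
        circ_zsmul_right (EndLin.circ (hf.contr x) hg), circ_zsmul_right (hg.contr x),
        circ_zsmul_right hf.endLin, parity_circ_of hg hq hr, circ_zsmul_right (hf.contr x).endLin]
      simp only [Pi.add_apply, Pi.smul_apply, pow_add, smul_smul, smul_sub]
      abel
    rw [key hg hh hq hr, Pi.smul_apply, key hh hg hr hq,
      ih hf hg (hh.contr x) hq (parity_contr_of hr x),
      ih hf (hg.contr x) hh (parity_contr_of hq x) hr,
      ih (hf.contr x) hg hh hq hr]
    simp only [Pi.smul_apply, smul_add, smul_smul]
    have e1 : (-1 : ℤ) ^ r * (-1) ^ ((q + 1) * r) = (-1) ^ (q * r) := by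
      rw [add_mul, pow_add, one_mul, mul_left_comm, ← pow_add, ← two_mul, pow_mul]; simp
    have e2 : (-1 : ℤ) ^ (q * r) * (-1) ^ q = (-1) ^ (q * (r + 1)) := by
      rw [mul_add, pow_add, mul_one]
    have e3 : (-1 : ℤ) ^ (q + r) * (-1) ^ (q * r) = (-1) ^ (q * r) * (-1) ^ (r + q) := by
      rw [mul_comm, add_comm]
    rw [e1, e2, e3]
    abel

/-- If `f` has at most one argument, composition is associative. -/
theorem circ_assoc_of_le_one {f : List M → N} {g h : List M → M} (hf : IsAlt K f)
    (hf1 : ∀ x y xs, f (x :: y :: xs) = 0) (hg : EndLin K g) (hh : EndLin K h) {q r : ℕ}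
    (hq : parity g = (-1 : ℤ) ^ q • g)
    (hr : parity h = (-1 : ℤ) ^ r • h) :
    circ (circ f g) h = circ f (circ g h) := by
  funext xs
  induction xs generalizing f g h q r with
  | nil =>
    simp only [circ, contr, parity_nil, hf1, add_zero]
  | cons x xs ih =>
    simp only [circ]
    rw [contr_circ, circ_add_left, contr_circ, circ_add_right hf.endLin, hr,
        circ_zsmul_right (EndLin.circ hf (hg.contr x)), hq,
        circ_zsmul_right (hf.contr x).endLin, circ_zsmul_left,
        circ_zsmul_right (EndLin.circ (hf.contr x) hg), circ_zsmul_right (hg.contr x),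
        circ_zsmul_right hf.endLin, parity_circ_of hg hq hr, circ_zsmul_right (hf.contr x).endLin]
    simp only [Pi.add_apply, Pi.smul_apply]
    rw [ih hf hf1 hg (hh.contr x) hq (parity_contr_of hr x),
      ih hf hf1 (hg.contr x) hh (parity_contr_of hq x) hr,
      ih (hf.contr x) (fun _ _ _ => hf1 _ _ _) hg hh hq hr, smul_smul, pow_add, add_assoc, mul_comm]

end ListCalculus


/-! ### Recursion for shuffles -/

section Shuffles

/-- The permutation of `Fin (n + 1)` sending `i` to `0` and acting as `τ` on the other indices. -/
def insPerm {n : ℕ} (i : Fin (n + 1)) (τ : Equiv.Perm (Fin n)) : Equiv.Perm (Fin (n + 1)) :=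
  Equiv.Perm.decomposeFin.symm (0, τ) * i.cycleRange

@[simp] theorem insPerm_self {n : ℕ} (i : Fin (n + 1)) (τ : Equiv.Perm (Fin n)) :
    insPerm i τ i = 0 := by
  simp [insPerm]

@[simp] theorem insPerm_succAbove {n : ℕ} (i : Fin (n + 1)) (τ : Equiv.Perm (Fin n)) (j : Fin n) :
    insPerm i τ (i.succAbove j) = (τ j).succ := by
  simp [insPerm]

theorem insPerm_bijective (n : ℕ) :
    Function.Bijective fun p : Fin (n + 1) × Equiv.Perm (Fin n) => insPerm p.1 p.2 := by
  constructor
  · rintro ⟨i, τ⟩ ⟨j, τ'⟩ h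
    have h' : insPerm i τ = insPerm j τ' := h
    have hij : i = j := by
      apply (insPerm i τ).injective
      rw [insPerm_self, h', insPerm_self]
    subst hij
    congr 1
    ext a
    have := congrArg (fun σ : Equiv.Perm _ => σ (i.succAbove a)) h'
    simpa using congrArg Fin.val this
  · intro σ
    set i := σ.symm 0 with hi
    obtain ⟨⟨p, τ⟩, hp⟩ := Equiv.Perm.decomposeFin.symm.surjective (σ * (i.cycleRange)⁻¹)
    have h0 : p = 0 := by
      rw [← Equiv.Perm.decomposeFin_symm_apply_zero p τ, hp]
      simp [hi, Equiv.Perm.inv_def]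
    subst h0
    exact ⟨(i, τ), by simp only [insPerm, hp, inv_mul_cancel_right]⟩

theorem exists_insPerm {n : ℕ} (σ : Equiv.Perm (Fin (n + 1))) :
    ∃ (i : Fin (n + 1)) (τ : Equiv.Perm (Fin n)), σ = insPerm i τ := by
  obtain ⟨⟨i, τ⟩, h⟩ := (insPerm_bijective n).2 σ
  exact ⟨i, τ, h.symm⟩

/-- The inversions that involve the value 0 are the positions before `i`; each costs `d₀` times the
degree found there. All other inversions are those of `τ`. -/
theorem koszulSign_insPerm {n : ℕ} (i : Fin (n + 1)) (τ : Equiv.Perm (Fin n)) (d₀ : ℤ)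
    (d : Fin n → ℤ) :
    koszulSign (insPerm i τ) (Fin.cons d₀ d : Fin (n + 1) → ℤ) =
      (∏ a : Fin n, if a.castSucc < i then (d₀ * d (τ a)).negOnePow else 1) * koszulSign τ d := by
  unfold koszulSign
  rw [Fin.prod_univ_succAbove _ i]
  have h1 : (∏ j, if i < j ∧ insPerm i τ j < insPerm i τ i then
      ((Fin.cons d₀ d : Fin (n + 1) → ℤ) (insPerm i τ i) *
        (Fin.cons d₀ d : Fin (n + 1) → ℤ) (insPerm i τ j)).negOnePow else 1) = 1 :=
    Finset.prod_eq_one fun j _ => by simp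
  rw [h1, one_mul, ← Finset.prod_mul_distrib]
  refine Finset.prod_congr rfl fun a _ => ?_
  rw [Fin.prod_univ_succAbove _ i]
  congr 1
  · simp [Fin.succAbove_lt_iff_castSucc_lt, mul_comm]
  · refine Finset.prod_congr rfl fun b _ => ?_
    simp

/-- Arguments of cochains count as elements of degree 1. This lets the signs of ∘̄ and those of the
L∞ identities be treated by one recursion. -/
theorem koszulSign_one {n : ℕ} (σ : Equiv.Perm (Fin n)) :
    koszulSign σ (fun _ => 1) = Equiv.Perm.sign σ := by
  rw [Equiv.Perm.sign_eq_prod_prod_Ioi]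
  refine Finset.prod_congr rfl fun i _ => ?_
  rw [← Finset.prod_subset (Finset.subset_univ (Finset.Ioi i))]
  · refine Finset.prod_congr rfl fun j hj => ?_
    rw [Finset.mem_Ioi] at hj
    have : σ i ≠ σ j := fun h => hj.ne (σ.injective h)
    rcases lt_or_gt_of_ne this with h | h
    · simp [h, h.le]
    · simp [h, hj, h.not_gt]
  · intro j _ hj
    rw [Finset.mem_Ioi] at hj
    simp [hj]

/-- The least value must open one of the two increasing blocks, so it stands at position 0 or `i`,
and deleting it leaves a shuffle. For `i = 0` the two places coincide; the condition `1 ≤ i`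
prevents counting them twice. -/
theorem insPerm_mem_shuffles {n i : ℕ} (j : Fin (n + 1)) (τ : Equiv.Perm (Fin n)) :
    insPerm j τ ∈ shuffles i (n + 1) ↔
      (1 ≤ i ∧ j = 0 ∧ τ ∈ shuffles (i - 1) n) ∨ ((j : ℕ) = i ∧ τ ∈ shuffles i n) := by
  simp only [shuffles, Finset.mem_filter, Finset.mem_univ, true_and]
  have hz : ∀ c, ¬ insPerm j τ c < insPerm j τ j := by simp
  constructor
  · rintro ⟨h1, h2⟩
    by_cases hj : (j : ℕ) < i
    · have hj0 : j = 0 := by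
        by_contra h0
        exact hz _ (h1 0 j (Fin.pos_of_ne_zero h0) hj)
      subst hj0
      refine Or.inl ⟨by omega, rfl, fun a b hab hb => ?_, fun a b hab ha => ?_⟩
      · have := h1 (Fin.succAbove 0 a) (Fin.succAbove 0 b) (by simpa using hab)
          (by simp; omega)
        simpa only [insPerm_succAbove, Fin.succ_lt_succ_iff] using this
      · have := h2 (Fin.succAbove 0 a) (Fin.succAbove 0 b) (by simpa using hab)
          (by simp; omega)
        simpa only [insPerm_succAbove, Fin.succ_lt_succ_iff] using this
    · have hji : (j : ℕ) = i := by
        by_contra h0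
        refine hz ⟨i, by omega⟩ (h2 ⟨i, by omega⟩ j ?_ le_rfl)
        rw [Fin.lt_def]; simp only; omega
      refine Or.inr ⟨hji, fun a b hab hb => ?_, fun a b hab ha => ?_⟩
      · have := h1 (j.succAbove a) (j.succAbove b) (by simpa using hab)
          (by rw [Fin.succAbove_of_castSucc_lt _ _ (by rw [Fin.lt_def]; simp; omega)]; simpa)
        simpa only [insPerm_succAbove, Fin.succ_lt_succ_iff] using this
      · have := h2 (j.succAbove a) (j.succAbove b) (by simpa using hab)
          (by rw [Fin.succAbove_of_le_castSucc _ _ (by rw [Fin.le_def]; simp; omega)]; simp; omega)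
        simpa only [insPerm_succAbove, Fin.succ_lt_succ_iff] using this
  · have hcases : ∀ c : Fin (n + 1), c = j ∨ ∃ a, c = j.succAbove a := fun c => by
      by_cases h : c = j
      · exact Or.inl h
      · obtain ⟨a, ha⟩ := Fin.exists_succAbove_eq h
        exact Or.inr ⟨a, ha.symm⟩
    rintro (⟨hi, rfl, h1, h2⟩ | ⟨hji, h1, h2⟩)
    · refine ⟨fun a b hab hb => ?_, fun a b hab ha => ?_⟩
      · rcases hcases a with rfl | ⟨a, rfl⟩ <;> rcases hcases b with rfl | ⟨b, rfl⟩
        · exact absurd hab (lt_irrefl _)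
        · rw [insPerm_self, insPerm_succAbove]; exact Fin.succ_pos _
        · simp at hab
        · rw [insPerm_succAbove, insPerm_succAbove, Fin.succ_lt_succ_iff]
          exact h1 a b (by simpa using hab) (by simp at hb; omega)
      · rcases hcases a with rfl | ⟨a, rfl⟩
        · simp at ha; omega
        rcases hcases b with rfl | ⟨b, rfl⟩
        · simp at hab
        · rw [insPerm_succAbove, insPerm_succAbove, Fin.succ_lt_succ_iff]
          exact h2 a b (by simpa using hab) (by simp at ha; omega)
    · have hlt : ∀ a : Fin n, ((j.succAbove a : Fin (n + 1)) : ℕ) < i → (a : ℕ) < i := fun a h => by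
        by_contra hcon
        rw [Fin.succAbove_of_le_castSucc _ _ (by rw [Fin.le_def]; simp; omega)] at h
        simp at h; omega
      have hle : ∀ a : Fin n, i ≤ ((j.succAbove a : Fin (n + 1)) : ℕ) → i ≤ (a : ℕ) := fun a h => by
        by_contra hcon
        rw [Fin.succAbove_of_castSucc_lt _ _ (by rw [Fin.lt_def]; simp; omega)] at h
        simp at h; omega
      refine ⟨fun a b hab hb => ?_, fun a b hab ha => ?_⟩
      · rcases hcases a with rfl | ⟨a, rfl⟩
        · rw [Fin.lt_def] at hab; omega
        rcases hcases b with rfl | ⟨b, rfl⟩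
        · omega
        · rw [insPerm_succAbove, insPerm_succAbove, Fin.succ_lt_succ_iff]
          exact h1 a b (by simpa using hab) (hlt b hb)
      · rcases hcases b with rfl | ⟨b, rfl⟩
        · rw [Fin.lt_def] at hab; omega
        rcases hcases a with rfl | ⟨a, rfl⟩
        · rw [insPerm_self, insPerm_succAbove]; exact Fin.succ_pos _
        · rw [insPerm_succAbove, insPerm_succAbove, Fin.succ_lt_succ_iff]
          exact h2 a b (by simpa using hab) (hle a ha)

theorem sum_shuffles_succ {N : Type*} [AddCommMonoid N] (i n : ℕ)
    (G : Equiv.Perm (Fin (n + 1)) → N) :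
    ∑ σ ∈ shuffles i (n + 1), G σ =
      (if 1 ≤ i then ∑ τ ∈ shuffles (i - 1) n, G (insPerm 0 τ) else 0) +
      (if h : i < n + 1 then ∑ τ ∈ shuffles i n, G (insPerm ⟨i, h⟩ τ) else 0) := by
  have e1 : ∑ σ ∈ shuffles i (n + 1), G σ =
      ∑ σ, if σ ∈ shuffles i (n + 1) then G σ else 0 := by
    rw [Finset.sum_ite_mem, Finset.univ_inter]
  rw [e1, ← (Equiv.ofBijective _ (insPerm_bijective n)).sum_comp, Fintype.sum_prod_type]
  have e2 : ∀ (j : Fin (n + 1)) (τ : Equiv.Perm (Fin n)),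
      (if insPerm j τ ∈ shuffles i (n + 1) then G (insPerm j τ) else 0) =
      (if j = 0 then (if 1 ≤ i ∧ τ ∈ shuffles (i - 1) n then G (insPerm 0 τ) else 0) else 0) +
      (if (j : ℕ) = i then (if τ ∈ shuffles i n then G (insPerm j τ) else 0) else 0) := by
    intro j τ
    rw [if_congr (insPerm_mem_shuffles j τ) rfl rfl]
    by_cases hj : j = 0
    · subst hj
      by_cases hi : 1 ≤ i
      · have : ¬ 0 = i := by omega
        simp [hi, this]
      · have : i = 0 := by omega
        simp [this]
    · simp only [hj, false_and, and_false, false_or, if_false, zero_add]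
      by_cases hji : (j : ℕ) = i <;> simp [hji]
  simp only [Equiv.ofBijective_apply, e2, Finset.sum_add_distrib]
  congr 1
  · rw [Finset.sum_comm]
    by_cases hi : 1 ≤ i <;> simp [hi, Finset.sum_ite_mem]
  · rw [Finset.sum_comm]
    split_ifs with h
    · have : ∀ τ, (∑ j : Fin (n + 1), if (j : ℕ) = i then
          (if τ ∈ shuffles i n then G (insPerm j τ) else 0) else 0) =
          if τ ∈ shuffles i n then G (insPerm ⟨i, h⟩ τ) else 0 := by
        intro τ
        rw [Finset.sum_eq_single ⟨i, h⟩]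
        · simp
        · intro j _ hj
          rw [if_neg (fun h' => hj (Fin.ext h'))]
        · simp
      simp only [this, Finset.sum_ite_mem, Finset.univ_inter]
    · refine Finset.sum_eq_zero fun τ _ => Finset.sum_eq_zero fun j _ => ?_
      rw [if_neg (by omega)]

end Shuffles

/-! ### Sums over splittings of a list -/

section SplitSum

variable {X N : Type*} [AddCommGroup N]

/-- The total degree of a list of elements with assigned degrees. -/
def totalDeg (A : List (ℤ × X)) : ℤ := (A.map Prod.fst).sum

@[simp] theorem totalDeg_nil : totalDeg ([] : List (ℤ × X)) = 0 := rfl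

@[simp] theorem totalDeg_cons (y : ℤ × X) (A : List (ℤ × X)) :
    totalDeg (y :: A) = y.1 + totalDeg A := by simp [totalDeg]

@[simp] theorem totalDeg_append (A B : List (ℤ × X)) :
    totalDeg (A ++ B) = totalDeg A + totalDeg B := by simp [totalDeg]

/-- The sum of `F A B`, with Koszul signs, over all ways of splitting a list of elements with
degrees into complementary sublists `A` and `B`. -/
def splitSum : (List (ℤ × X) → List (ℤ × X) → N) → List (ℤ × X) → N
  | F, [] => F [] []
  | F, y :: xs => splitSum (fun A B => F (y :: A) B) xs +
      splitSum (fun A B => (y.1 * totalDeg A).negOnePow • F A (y :: B)) xs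

theorem splitSum_add (F G : List (ℤ × X) → List (ℤ × X) → N) (xs : List (ℤ × X)) :
    splitSum (fun A B => F A B + G A B) xs = splitSum F xs + splitSum G xs := by
  induction xs generalizing F G with
  | nil => rfl
  | cons y xs ih =>
    simp only [splitSum, smul_add]
    rw [ih, ih]; abel

theorem splitSum_map {N' : Type*} [AddCommGroup N'] (φ : N →+ N')
    (F : List (ℤ × X) → List (ℤ × X) → N) (xs : List (ℤ × X)) :
    splitSum (fun A B => φ (F A B)) xs = φ (splitSum F xs) := by
  induction xs generalizing F with
  | nil => rfl
  | cons y xs ih =>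
    simp only [splitSum]
    rw [map_add, ← ih, ← ih]
    simp only [Units.smul_def, map_zsmul]

theorem splitSum_zero (xs : List (ℤ × X)) :
    splitSum (fun _ _ => (0 : N)) xs = 0 :=
  splitSum_map (0 : N →+ N) (fun _ _ => 0) xs

theorem splitSum_smul (u : ℤˣ) (F : List (ℤ × X) → List (ℤ × X) → N) (xs : List (ℤ × X)) :
    splitSum (fun A B => u • F A B) xs = u • splitSum F xs :=
  splitSum_map (DistribSMul.toAddMonoidHom N u) F xs

theorem splitSum_neg (F : List (ℤ × X) → List (ℤ × X) → N) (xs : List (ℤ × X)) :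
    splitSum (fun A B => -F A B) xs = -splitSum F xs :=
  splitSum_map (-AddMonoidHom.id N) F xs

theorem splitSum_sub (F G : List (ℤ × X) → List (ℤ × X) → N) (xs : List (ℤ × X)) :
    splitSum (fun A B => F A B - G A B) xs = splitSum F xs - splitSum G xs := by
  simp only [sub_eq_add_neg, splitSum_add, splitSum_neg]

theorem splitSum_congr {F G : List (ℤ × X) → List (ℤ × X) → N} {xs : List (ℤ × X)}
    (h : ∀ A B, A ⊆ xs → B ⊆ xs → totalDeg A + totalDeg B = totalDeg xs →
      A.length + B.length = xs.length → F A B = G A B) :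
    splitSum F xs = splitSum G xs := by
  induction xs generalizing F G with
  | nil => exact h [] [] (by simp) (by simp) (by simp) (by simp)
  | cons y xs ih =>
    simp only [splitSum]
    congr 1
    · refine ih fun A B hA hB hd hl => h _ _ ?_ ?_ ?_ ?_
      · exact List.cons_subset_cons _ hA
      · exact List.subset_cons_of_subset _ hB
      · simp only [totalDeg_cons]; omega
      · simp; omega
    · refine ih fun A B hA hB hd hl => ?_
      rw [h A (y :: B) (List.subset_cons_of_subset _ hA) (List.cons_subset_cons _ hB)
        (by simp only [totalDeg_cons]; omega) (by simp; omega)]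

theorem splitSum_swap (F : List (ℤ × X) → List (ℤ × X) → N) (xs : List (ℤ × X)) :
    splitSum F xs =
      splitSum (fun A B => (totalDeg A * totalDeg B).negOnePow • F B A) xs := by
  induction xs generalizing F with
  | nil => simp [splitSum]
  | cons y xs ih =>
    simp only [splitSum]
    rw [ih fun A B => F (y :: A) B, ih fun A B => (y.1 * totalDeg A).negOnePow • F A (y :: B),
      add_comm]
    congr 1 <;> congr 1 <;> funext A B <;> simp only [smul_smul, totalDeg_cons, ← Int.negOnePow_add]
    · congr 1; congr 1; ring
    · congr 1
      rw [Int.negOnePow_eq_iff]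
      exact ⟨-(y.1 * totalDeg A), by ring⟩

theorem ofFn_eq_take_append {n : ℕ} {Z : Type*} (z : Fin (n + 1) → Z) (i : Fin (n + 1)) :
    List.ofFn z = (List.ofFn fun a => z (i.succAbove a)).take i ++
      z i :: (List.ofFn fun a => z (i.succAbove a)).drop i := by
  apply List.ext_getElem
  · simp; omega
  · intro m h1 h2
    have hm : m < n + 1 := by simpa using h1
    have hlen : ((List.ofFn fun a => z (i.succAbove a)).take i).length = i := by simp; omega
    rw [List.getElem_append]
    simp only [hlen]
    split_ifs with hmi
    · simp only [List.getElem_ofFn, List.getElem_take]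
      rw [Fin.succAbove_of_castSucc_lt _ _ (by rw [Fin.lt_def]; simpa)]
      rfl
    · rw [List.getElem_cons]
      split_ifs with h0
      · rw [List.getElem_ofFn]
        congr 1
        ext; simp; omega
      · simp only [List.getElem_ofFn, List.getElem_drop]
        rw [Fin.succAbove_of_le_castSucc _ _ (by rw [Fin.le_def]; simp)]
        congr 1
        ext; simp; omega

theorem prod_negOnePow_eq_totalDeg_take {n : ℕ} (d₀ : ℤ) (w : Fin n → ℤ × X) (i : ℕ) :
    (∏ a : Fin n, if (a : ℕ) < i then (d₀ * (w a).1).negOnePow else 1) =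
      (d₀ * totalDeg ((List.ofFn w).take i)).negOnePow := by
  induction n generalizing i with
  | zero => simp
  | succ n ih =>
    cases i with
    | zero => simp
    | succ i =>
      rw [Fin.prod_univ_succ]
      simp [ih, mul_add, Int.negOnePow_add]

theorem koszulSign_insPerm_eq_totalDeg {n : ℕ} (y : Fin (n + 1) → ℤ × X) (i : Fin (n + 1))
    (τ : Equiv.Perm (Fin n)) :
    koszulSign (insPerm i τ) (fun a => (y a).1) =
      ((y 0).1 * totalDeg ((List.ofFn fun a => y (τ a).succ).take i)).negOnePow *
        koszulSign τ (fun a => (y a.succ).1) := by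
  have h : (fun a => (y a).1) = (Fin.cons (y 0).1 fun a => (y a.succ).1 : Fin (n + 1) → ℤ) := by
    funext a; cases a using Fin.cases <;> simp
  rw [h, koszulSign_insPerm, ← prod_negOnePow_eq_totalDeg_take]
  rfl

theorem ofFn_insPerm {n : ℕ} {Z : Type*} (y : Fin (n + 1) → Z) (i : Fin (n + 1))
    (τ : Equiv.Perm (Fin n)) :
    List.ofFn (fun a => y (insPerm i τ a)) = (List.ofFn fun a => y (τ a).succ).take i ++
      y 0 :: (List.ofFn fun a => y (τ a).succ).drop i := by
  rw [ofFn_eq_take_append _ i]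
  simp

/-- Where a shuffle puts the value 0 is the same choice as whether the first list element joins `A`
or `B`. In the second case it has to pass all of `A`, which is the sign in `splitSum`. -/
theorem sum_shuffles_eq_splitSum (F : List (ℤ × X) → List (ℤ × X) → N) {n : ℕ}
    (y : Fin n → ℤ × X) :
    ∑ i ∈ Finset.range (n + 1), ∑ σ ∈ shuffles i n, koszulSign σ (fun a => (y a).1) •
      F ((List.ofFn fun a => y (σ a)).take i) ((List.ofFn fun a => y (σ a)).drop i) =
    splitSum F (List.ofFn y) := by
  induction n generalizing F with
  | zero =>
    have : shuffles 0 0 = Finset.univ := by ext; simp [shuffles]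
    simp [splitSum, this, koszulSign]
  | succ n ih =>
    have hF : ∀ (i : ℕ) (σ : Equiv.Perm (Fin (n + 1))) (P Q : List (ℤ × X)), P.length = i →
        List.ofFn (fun a => y (σ a)) = P ++ Q →
        F ((List.ofFn fun a => y (σ a)).take i) ((List.ofFn fun a => y (σ a)).drop i) = F P Q := by
      intro i σ P Q hP h
      rw [h, ← hP]; simp
    have hle : ∀ (i : ℕ) (τ : Equiv.Perm (Fin n)), i ≤ n →
        ((List.ofFn fun a => y (τ a).succ).take i).length = i := by
      intro i τ hi; simp [hi]
    simp only [sum_shuffles_succ]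
    rw [Finset.sum_add_distrib, List.ofFn_succ, splitSum, ← ih, ← ih]
    congr 1
    · rw [Finset.sum_range_succ']
      rw [if_neg (by omega), add_zero]
      refine Finset.sum_congr rfl fun i hi => ?_
      rw [if_pos (by omega), Nat.add_sub_cancel]
      refine Finset.sum_congr rfl fun τ _ => ?_
      rw [Finset.mem_range] at hi
      rw [koszulSign_insPerm_eq_totalDeg, hF (i + 1) (insPerm 0 τ)
        (y 0 :: (List.ofFn fun a => y (τ a).succ).take i)
        ((List.ofFn fun a => y (τ a).succ).drop i) (by rw [List.length_cons, hle _ _ (by omega)])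
        (by rw [ofFn_insPerm]; simp)]
      simp
    · rw [Finset.sum_range_succ]
      simp only [lt_irrefl, dif_neg, not_false_eq_true, add_zero]
      refine Finset.sum_congr rfl fun i hi => ?_
      rw [Finset.mem_range] at hi
      rw [dif_pos hi]
      refine Finset.sum_congr rfl fun τ _ => ?_
      rw [koszulSign_insPerm_eq_totalDeg, hF i _ _ _ _ (ofFn_insPerm y ⟨i, hi⟩ τ)]
      · rw [mul_comm, mul_smul]
      · exact hle _ _ (by omega)

end SplitSum


/-! ### Graded symmetry from adjacent transpositions -/

section GradedSymmetry

variable {X N : Type*} [AddCommGroup N]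

theorem graded_move {p : ℤ × X → Prop} {f : List (ℤ × X) → N}
    (hf : ∀ A x y B, (∀ z ∈ A ++ x :: y :: B, p z) →
      f (A ++ x :: y :: B) = (x.1 * y.1).negOnePow • f (A ++ y :: x :: B))
    (A B : List (ℤ × X)) (x : ℤ × X) (h : ∀ z ∈ A ++ x :: B, p z) :
    f (A ++ x :: B) = (x.1 * totalDeg A).negOnePow • f (x :: (A ++ B)) := by
  induction A using List.reverseRecOn generalizing B with
  | nil => simp
  | append_singleton A y ih =>
    have e : A ++ [y] ++ x :: B = A ++ y :: x :: B := by simp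
    rw [e] at h ⊢
    have h' : ∀ z ∈ A ++ x :: y :: B, p z := fun z hz => h z (by simp at hz ⊢; tauto)
    rw [hf A y x B h, ih (y :: B) h', smul_smul, ← Int.negOnePow_add]
    congr 2
    · simp; ring
    · simp

/-- Bring the first element back to the front past the elements before it, then apply induction to
the function with this element inserted. -/
theorem graded_perm {p : ℤ × X → Prop} {f : List (ℤ × X) → N}
    (hf : ∀ A x y B, (∀ z ∈ A ++ x :: y :: B, p z) →
      f (A ++ x :: y :: B) = (x.1 * y.1).negOnePow • f (A ++ y :: x :: B))
    {n : ℕ} (y : Fin n → ℤ × X) (hy : ∀ a, p (y a)) (σ : Equiv.Perm (Fin n)) :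
    f (List.ofFn fun a => y (σ a)) = koszulSign σ (fun a => (y a).1) • f (List.ofFn y) := by
  induction n generalizing f with
  | zero => simp [koszulSign]
  | succ n ih =>
    obtain ⟨i, τ, rfl⟩ := exists_insPerm σ
    have hmem : ∀ z ∈ List.ofFn (fun a => y (insPerm i τ a)), p z := by
      intro z hz
      obtain ⟨a, rfl⟩ := (List.mem_ofFn' _ _).1 hz
      exact hy _
    rw [ofFn_insPerm] at hmem ⊢
    rw [graded_move hf _ _ _ hmem, koszulSign_insPerm_eq_totalDeg, mul_smul,
      List.take_append_drop]
    congr 1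
    have := ih (f := fun l => f (y 0 :: l)) (fun A x z B h => hf (y 0 :: A) x z B (by
      intro w hw
      rw [List.cons_append, List.mem_cons] at hw
      rcases hw with rfl | hw
      · exact hy 0
      · exact h w hw)) (fun a => y a.succ) (fun a => hy _) τ
    rw [this, List.ofFn_succ]

end GradedSymmetry

/-! ### Cochains as functions on lists -/

section Hat

variable {K : Type*} [Field K] {M : Type*} [AddCommGroup M] [Module K M]

/-- An element of `C^*(M, M)` as a function on lists. -/
def hat (Q : CochainSum K M) : List M → M
  | [] => 0
  | x :: xs => Q xs.length fun i => (x :: xs).get i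

theorem hat_of_length {n : ℕ} (Q : CochainSum K M) (l : List M) (h : l.length = n + 1) :
    hat Q l = Q n fun i => l.get (i.cast h.symm) := by
  cases l with
  | nil => simp at h
  | cons x xs =>
    simp only [List.length_cons, Nat.add_right_cancel_iff] at h
    subst h
    rfl

@[simp] theorem hat_nil (Q : CochainSum K M) : hat Q [] = 0 := rfl

theorem hat_ofFn {n : ℕ} (Q : CochainSum K M) (x : Fin (n + 1) → M) :
    hat Q (List.ofFn x) = Q n x := by
  rw [hat_of_length Q _ (List.length_ofFn)]
  congr 1
  funext i
  simp only [List.get_eq_getElem, List.getElem_ofFn, Fin.val_cast]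

theorem hat_injective : Function.Injective (hat : CochainSum K M → List M → M) := by
  intro Q Q' h
  refine DFinsupp.ext fun n => ?_
  ext x
  have := congrFun h (List.ofFn x)
  rwa [hat_ofFn, hat_ofFn] at this

@[simp] theorem hat_zero : hat (0 : CochainSum K M) = 0 := by
  funext l; cases l <;> simp [hat]

@[simp] theorem hat_add (Q Q' : CochainSum K M) : hat (Q + Q') = hat Q + hat Q' := by
  funext l; cases l <;> simp [hat]

@[simp] theorem hat_smul (c : K) (Q : CochainSum K M) : hat (c • Q) = c • hat Q := by
  funext l
  cases l with
  | nil => simp [hat]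
  | cons x xs =>
    simp only [hat, Pi.smul_apply]
    rfl

variable (K M) in
/-- `hat` as a linear map. -/
def hatLin : CochainSum K M →ₗ[K] List M → M where
  toFun := hat
  map_add' := hat_add
  map_smul' := hat_smul

@[simp] theorem hat_sub (Q Q' : CochainSum K M) : hat (Q - Q') = hat Q - hat Q' :=
  map_sub (hatLin K M) Q Q'

@[simp] theorem hat_zsmul (c : ℤ) (Q : CochainSum K M) : hat (c • Q) = c • hat Q :=
  map_zsmul (hatLin K M) c Q

theorem hat_lof_of_ne {n : ℕ} (P : Cochain K M n) {l : List M} (h : l.length ≠ n + 1) :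
    hat (DirectSum.lof K ℕ (Cochain K M) n P) l = 0 := by
  cases l with
  | nil => rfl
  | cons x xs =>
    simp only [List.length_cons, ne_eq, Nat.add_right_cancel_iff] at h
    simp only [hat]
    rw [DirectSum.lof_eq_of, DirectSum.of_eq_of_ne _ _ _ h]
    rfl

theorem get_append_cons_eq_update (A B : List M) (y : M) (n : ℕ)
    (h : ∀ z : M, (A ++ z :: B).length = n + 1) (i : Fin (n + 1)) (hi : (i : ℕ) = A.length) :
    (fun j : Fin (n + 1) => (A ++ y :: B).get (j.cast (h y).symm)) =
      Function.update (fun j : Fin (n + 1) => (A ++ (0 : M) :: B).get (j.cast (h 0).symm)) i y := by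
  funext j
  by_cases hj : j = i
  · subst hj
    simp [List.getElem_append, hi]
  · have : (j : ℕ) ≠ A.length := fun e => hj (Fin.ext (e.trans hi.symm))
    rw [Function.update_of_ne hj]
    simp only [List.get_eq_getElem, Fin.val_cast, List.getElem_append, List.getElem_cons]
    split_ifs with h1 h2
    · rfl
    · omega
    · rfl

theorem isAlt_hat (Q : CochainSum K M) : IsAlt K (hat Q) := by
  constructor
  · intro A B
    have h : ∀ z : M, (A ++ z :: B).length = (A.length + B.length) + 1 := by
      intro z; simp; omega
    let i : Fin (A.length + B.length + 1) := ⟨A.length, by omega⟩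
    have e : ∀ y, hat Q (A ++ y :: B) = Q _ (Function.update
        (fun j : Fin (A.length + B.length + 1) => (A ++ (0 : M) :: B).get (j.cast (h 0).symm)) i y) :=
      fun y => by rw [hat_of_length Q _ (h y), get_append_cons_eq_update A B y _ h i rfl]
    exact ⟨fun x y => by simp only [e, AlternatingMap.map_update_add],
      fun c x => by simp only [e, AlternatingMap.map_update_smul]⟩
  · intro A x y B
    have h : ∀ z w : M, (A ++ z :: w :: B).length = (A.length + B.length + 1) + 1 := by
      intro z w; simp; omega
    let i : Fin (A.length + B.length + 1 + 1) := ⟨A.length, by omega⟩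
    let j : Fin (A.length + B.length + 1 + 1) := ⟨A.length + 1, by omega⟩
    have hij : i ≠ j := by simp [i, j]
    rw [hat_of_length Q _ (h x y), hat_of_length Q _ (h y x), ← AlternatingMap.map_swap _ _ hij]
    congr 1
    funext k
    simp only [Function.comp_apply]
    by_cases hki : k = i
    · subst hki
      simp [Equiv.swap_apply_left, List.getElem_cons, i, j]
    by_cases hkj : k = j
    · subst hkj
      simp [Equiv.swap_apply_right, List.getElem_cons, i, j]
    rw [Equiv.swap_apply_of_ne_of_ne hki hkj]
    have h1 : (k : ℕ) ≠ A.length := fun e => hki (Fin.ext e)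
    have h2 : (k : ℕ) ≠ A.length + 1 := fun e => hkj (Fin.ext e)
    simp only [List.get_eq_getElem, Fin.val_cast, List.getElem_append, List.getElem_cons]
    split_ifs
    · rfl
    · omega
    · omega
    · rfl

/-- An argument `x` that goes to the outer map passes the arguments `A` of `g` and also the value of
`g` in the first slot of `f`. The swap in `f` accounts for the extra 1 in the exponent of `parity`.
-/
theorem circ_eq_splitSum {f : List M → M} (hf : IsAlt K f) (g : List M → M) (xs : List M) :
    circ f g xs = splitSum (fun A B => f (g (A.map Prod.snd) :: B.map Prod.snd))
      (xs.map fun x => ((1 : ℤ), x)) := by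
  induction xs generalizing f g with
  | nil => rfl
  | cons x xs ih =>
    simp only [circ, List.map_cons, splitSum]
    rw [ih hf, ih (hf.contr x)]
    congr 1
    refine splitSum_congr fun A B hA _ _ _ => ?_
    have hdeg : totalDeg A = A.length := by
      have : ∀ z ∈ A.map Prod.fst, z = 1 := by
        intro z hz
        obtain ⟨w, hw, rfl⟩ := List.mem_map.1 hz
        obtain ⟨v, _, rfl⟩ := List.mem_map.1 (hA hw)
        rfl
      rw [totalDeg, List.eq_replicate_of_mem this]
      simp
    have h1 : ∀ (c : ℤ) z, f (x :: (c • z) :: B.map Prod.snd) = c • f (x :: z :: B.map Prod.snd) :=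
      fun c z => map_zsmul ((hf.lin [x] (B.map Prod.snd)).mk' _).toAddMonoidHom c z
    have h2 := hf.swap [] x (g (A.map Prod.snd)) (B.map Prod.snd)
    simp only [List.nil_append] at h2
    simp only [contr, parity, h1, h2, hdeg, List.length_map, one_mul]
    rw [smul_neg, pow_succ, mul_neg_one, neg_smul, neg_neg, Int.negOnePow_def]
    simp [Units.smul_def]

variable [CharZero K]

variable (K M) in
/-- The product `∘̄` on `C^*(M, M)`. -/
def circL : CochainSum K M →ₗ[K] CochainSum K M →ₗ[K] CochainSum K M :=
  DirectSum.toModule K ℕ _ fun p =>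
    (DirectSum.toModule K ℕ _ fun q =>
      ((nrCircLin K M p q).compr₂ (DirectSum.lof K ℕ (Cochain K M) (p + q))).flip).flip

theorem circL_lof {p q : ℕ} (P : Cochain K M p) (Q : Cochain K M q) :
    circL K M (DirectSum.lof K ℕ _ p P) (DirectSum.lof K ℕ _ q Q) =
      DirectSum.lof K ℕ _ (p + q) (nrCirc P Q) := by
  simp [circL, nrCircLin]

theorem hat_circL_lof {p q : ℕ} (P : Cochain K M p) (Q : Cochain K M q) :
    hat (DirectSum.lof K ℕ _ (p + q) (nrCirc P Q)) =
      circ (hat (DirectSum.lof K ℕ _ p P)) (hat (DirectSum.lof K ℕ _ q Q)) := by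
  have hP := isAlt_hat (DirectSum.lof K ℕ (Cochain K M) p P)
  have hP0 : ∀ B, hat (DirectSum.lof K ℕ (Cochain K M) p P) (0 :: B) = 0 :=
    fun B => (hP.lin [] B).map_zero
  funext l
  by_cases hl : l.length = p + q + 1
  · obtain ⟨x, rfl⟩ : ∃ x : Fin (p + q + 1) → M, l = List.ofFn x :=
      ⟨fun i => l.get (i.cast hl.symm), by
        apply List.ext_getElem
        · simp [hl]
        · intro i h1 h2
          simp only [List.get_eq_getElem, List.getElem_ofFn, Fin.val_cast]⟩
    rw [hat_ofFn, circ_eq_splitSum hP]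
    have e : (List.ofFn x).map (fun x => ((1 : ℤ), x)) = List.ofFn fun a => ((1 : ℤ), x a) := by
      simp [List.map_ofFn, Function.comp_def]
    -- Of all block sizes only `q + 1` contributes, because `Q` vanishes on lists of any other
    -- length.
    rw [e, ← sum_shuffles_eq_splitSum, Finset.sum_eq_single (q + 1), DirectSum.lof_apply,
      nrCirc_apply]
    · refine Finset.sum_congr rfl fun σ _ => ?_
      rw [koszulSign_one]
      congr 1
      rw [← DirectSum.lof_apply (R := K) p P, ← hat_ofFn, List.ofFn_cons, DirectSum.lof_apply,
        ← DirectSum.lof_apply (R := K) q Q, ← hat_ofFn]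
      simp only [DirectSum.lof_apply]
      congr 2
      · congr 1
        apply List.ext_getElem
        · simp
        · intro i h1 h2
          simp only [List.getElem_ofFn, List.getElem_map, List.getElem_take]
          rfl
      · apply List.ext_getElem
        · simp
        · intro i h1 h2
          simp only [List.getElem_ofFn, List.getElem_map, List.getElem_drop]
    · intro i _ hi
      refine Finset.sum_eq_zero fun σ _ => ?_
      by_cases hip : i < p + q + 2
      · rw [hat_lof_of_ne Q (by simp; omega), hP0, smul_zero]
      · simp at *; omega
    · intro h; simp at h
  · rw [hat_lof_of_ne _ hl, circ_eq_splitSum hP]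
    refine Eq.symm (Eq.trans (splitSum_congr fun A B _ _ _ h => ?_) (splitSum_zero _))
    rw [List.length_map] at h
    by_cases hA : A.length = q + 1
    · rw [hat_lof_of_ne P]
      simp; omega
    · rw [hat_lof_of_ne Q (by simpa), hP0]

theorem hat_circL (a b : CochainSum K M) : hat (circL K M a b) = circ (hat a) (hat b) := by
  induction a using DirectSum.induction_on with
  | zero => simp [circ_zero_left]
  | add a a' h h' => simp [h, h', circ_add_left]
  | of p P =>
    induction b using DirectSum.induction_on with
    | zero => simp [circ_zero_right (isAlt_hat _).endLin]
    | add b b' h h' => simp [h, h', circ_add_right (isAlt_hat _).endLin]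
    | of q Q =>
      rw [← DirectSum.lof_eq_of K, ← DirectSum.lof_eq_of K, circL_lof, hat_circL_lof]

end Hat


/-! ### The graded Lie algebra `C^*(M, M)` -/

theorem negOnePow_eq_ite (n : ℤ) : n.negOnePow = if Even n then 1 else -1 := by
  split_ifs with h
  · exact Int.negOnePow_even n h
  · exact Int.negOnePow_odd n (Int.not_even_iff_odd.1 h)

section GradedLie

variable {K : Type*} [Field K] {M : Type*} [AddCommGroup M] [Module K M]

variable (K M) in
/-- The elements of degree `d`. -/
def homog (d : ℤ) : Submodule K (CochainSum K M) where
  carrier := {a | ∀ n : ℕ, (n : ℤ) ≠ d → a n = 0}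
  zero_mem' := fun n _ => by simp
  add_mem' := fun {a b} ha hb n h => by simp [ha n h, hb n h]
  smul_mem' := fun c a ha n h => by
    change c • a n = 0
    rw [ha n h, smul_zero]

theorem lof_mem_homog {n : ℕ} (P : Cochain K M n) :
    DirectSum.lof K ℕ (Cochain K M) n P ∈ homog K M n := by
  intro m hm
  rw [DirectSum.lof_eq_of, DirectSum.of_eq_of_ne]
  exact_mod_cast hm

theorem eq_lof_of_mem_homog {n : ℕ} {a : CochainSum K M} (ha : a ∈ homog K M n) :
    a = DirectSum.lof K ℕ (Cochain K M) n (a n) := by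
  refine DFinsupp.ext fun m => ?_
  by_cases h : m = n
  · subst h
    exact (DirectSum.lof_apply K m (a m)).symm
  · rw [DirectSum.lof_eq_of, DirectSum.of_eq_of_ne _ _ _ h]
    exact ha m (by exact_mod_cast h)

theorem homog_cases {d : ℤ} {a : CochainSum K M} (ha : a ∈ homog K M d) :
    (∃ (n : ℕ) (P : Cochain K M n), d = n ∧ a = DirectSum.lof K ℕ (Cochain K M) n P) ∨ a = 0 := by
  rcases lt_or_ge d 0 with h | h
  · right
    refine DFinsupp.ext fun m => ha m (by omega)
  · left
    obtain ⟨n, rfl⟩ := Int.eq_ofNat_of_zero_le h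
    exact ⟨n, _, rfl, eq_lof_of_mem_homog ha⟩

@[elab_as_elim]
theorem homog_induction {p : CochainSum K M → Prop} (a : CochainSum K M)
    (h : ∀ d a, a ∈ homog K M d → p a) (hadd : ∀ a b, p a → p b → p (a + b)) : p a := by
  induction a using DirectSum.induction_on with
  | zero => exact h 0 0 (Submodule.zero_mem _)
  | of n P => exact h n _ (by rw [← DirectSum.lof_eq_of K]; exact lof_mem_homog P)
  | add a b ha hb => exact hadd a b ha hb

variable (K M) in
/-- The parity operator `a ↦ (-1)^{|a|} a`. -/
def par : CochainSum K M →ₗ[K] CochainSum K M :=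
  DirectSum.lmap fun n : ℕ => ((-1 : K) ^ n) • LinearMap.id

theorem par_apply (a : CochainSum K M) (n : ℕ) : par K M a n = (-1 : K) ^ n • a n := by
  simp [par, DirectSum.lmap_apply]

theorem par_of_mem {d : ℤ} {a : CochainSum K M} (ha : a ∈ homog K M d) :
    par K M a = d.negOnePow • a := by
  have key : ∀ n : ℕ, par K M a n = (d.negOnePow : ℤ) • a n := by
    intro n
    by_cases h : (n : ℤ) = d
    · subst h
      rw [par_apply, negOnePow_eq_ite]
      rcases Nat.even_or_odd n with h | h
      · simp [h, h.neg_one_pow]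
      · simp [h.neg_one_pow, Nat.not_even_iff_odd.2 h]
    · rw [par_apply, ha n h]; simp
  refine DFinsupp.ext fun n => ?_
  rw [key, Units.smul_def]
  rfl

theorem par_mem {d : ℤ} {a : CochainSum K M} (ha : a ∈ homog K M d) :
    par K M a ∈ homog K M d := fun n hn => by rw [par_apply, ha n hn, smul_zero]

theorem par_par (a : CochainSum K M) : par K M (par K M a) = a := by
  refine DFinsupp.ext fun n => ?_
  rw [par_apply, par_apply, smul_smul, ← pow_add, ← two_mul, pow_mul]
  simp

theorem units_smul_mem {d : ℤ} (u : ℤˣ) {a : CochainSum K M} (ha : a ∈ homog K M d) :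
    u • a ∈ homog K M d := by
  rcases Int.units_eq_one_or u with rfl | rfl
  · simpa
  · rw [Units.neg_smul, one_smul]
    exact Submodule.neg_mem _ ha

theorem hat_of_mem_homog {d : ℤ} {a : CochainSum K M} (ha : a ∈ homog K M d) {l : List M}
    (hl : (l.length : ℤ) ≠ d + 1) : hat a l = 0 := by
  rcases homog_cases ha with ⟨n, P, rfl, rfl⟩ | rfl
  · exact hat_lof_of_ne P (by omega)
  · simp

/-- The calculus on lists takes natural numbers as degrees and uses only their parity, so the
absolute value serves for integer degrees as well. -/
theorem exists_parity_hat {d : ℤ} {a : CochainSum K M} (ha : a ∈ homog K M d) :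
    ∃ q : ℕ, (Even q ↔ Even d) ∧ parity (hat a) = (-1 : ℤ) ^ q • hat a := by
  refine ⟨d.natAbs, by simp, ?_⟩
  rcases homog_cases ha with ⟨n, P, rfl, rfl⟩ | rfl
  · funext l
    by_cases hl : l.length = n + 1
    · simp [parity, hl, pow_add]
    · simp [parity, hat_lof_of_ne P hl]
  · simp

variable [CharZero K]

theorem circL_mem {d e : ℤ} {a b : CochainSum K M} (ha : a ∈ homog K M d) (hb : b ∈ homog K M e) :
    circL K M a b ∈ homog K M (d + e) := by
  rcases homog_cases ha with ⟨n, P, rfl, rfl⟩ | rfl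
  · rcases homog_cases hb with ⟨m, Q, rfl, rfl⟩ | rfl
    · rw [circL_lof]
      exact_mod_cast lof_mem_homog _
    · simp
  · simp

theorem nrBracket_eq {d e : ℤ} {a b : CochainSum K M} (ha : a ∈ homog K M d)
    (hb : b ∈ homog K M e) :
    nrBracket K M a b = circL K M a b - (d * e).negOnePow • circL K M b a := by
  rcases homog_cases ha with ⟨n, P, rfl, rfl⟩ | rfl
  · rcases homog_cases hb with ⟨m, Q, rfl, rfl⟩ | rfl
    · rw [nrBracket_lof, circL_lof, circL_lof]
      congr 1
      rw [negOnePow_eq_ite]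
      rcases Nat.even_or_odd (n * m) with h | h
      · have h' : Even ((n : ℤ) * m) := by exact_mod_cast h
        simp [h.neg_one_pow, h']
      · have h' : ¬ Even ((n : ℤ) * m) := by
          rw [Int.not_even_iff_odd]; exact_mod_cast h
        rw [h.neg_one_pow, if_neg h', Units.neg_smul, one_smul]
        exact neg_one_smul K (DirectSum.lof K ℕ (Cochain K M) (m + n) (nrCirc Q P))
    · simp
  · simp

theorem nrBracket_mem {d e : ℤ} {a b : CochainSum K M} (ha : a ∈ homog K M d)
    (hb : b ∈ homog K M e) : nrBracket K M a b ∈ homog K M (d + e) := by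
  rw [nrBracket_eq ha hb]
  refine Submodule.sub_mem _ (circL_mem ha hb) (units_smul_mem _ ?_)
  rw [add_comm]
  exact circL_mem hb ha

theorem circL_preLie (a : CochainSum K M) {e f : ℤ} {b c : CochainSum K M}
    (hb : b ∈ homog K M e) (hc : c ∈ homog K M f) :
    circL K M (circL K M a b) c - circL K M a (circL K M b c) =
      (e * f).negOnePow •
        (circL K M (circL K M a c) b - circL K M a (circL K M c b)) := by
  obtain ⟨q, hq, hq'⟩ := exists_parity_hat hb
  obtain ⟨r, hr, hr'⟩ := exists_parity_hat hc
  apply hat_injective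
  have := circ_preLie (isAlt_hat a) (isAlt_hat b).endLin (isAlt_hat c).endLin hq' hr'
  have hs : ((e * f).negOnePow : ℤ) = (-1) ^ (q * r) := by
    have he : Even (e * f) ↔ Even (q * r) := by rw [Int.even_mul, ← hq, ← hr, ← Nat.even_mul]
    rw [negOnePow_eq_ite]
    rcases Nat.even_or_odd (q * r) with h | h
    · simp [he, h, h.neg_one_pow]
    · simp [he, Nat.not_even_iff_odd.2 h, h.neg_one_pow]
  rw [Units.smul_def, hat_zsmul, hs]
  simp only [hat_sub, hat_circL]
  exact this

theorem nrBracket_comm {d e : ℤ} {a b : CochainSum K M} (ha : a ∈ homog K M d)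
    (hb : b ∈ homog K M e) :
    nrBracket K M a b = -((d * e).negOnePow • nrBracket K M b a) := by
  rw [nrBracket_eq ha hb, nrBracket_eq hb ha]
  by_cases h1 : Even d <;> by_cases h2 : Even e <;>
    simp [negOnePow_eq_ite, Int.even_mul, h1, h2]

/-- After expansion into ∘̄ only associators remain. Each of `a`, `b`, `c` is the outer map in two
of them, and the pre-Lie identity for that outer map cancels these two. The signs depend only on the
parities, hence the eight cases. -/
theorem nrBracket_jacobi {d e f : ℤ} {a b c : CochainSum K M} (ha : a ∈ homog K M d)
    (hb : b ∈ homog K M e) (hc : c ∈ homog K M f) :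
    nrBracket K M (nrBracket K M a b) c = nrBracket K M a (nrBracket K M b c) +
      (e * f).negOnePow • nrBracket K M (nrBracket K M a c) b := by
  rw [nrBracket_eq (nrBracket_mem ha hb) hc, nrBracket_eq ha (nrBracket_mem hb hc),
    nrBracket_eq (nrBracket_mem ha hc) hb, nrBracket_eq ha hb, nrBracket_eq hb hc,
    nrBracket_eq ha hc]
  have h1 := circL_preLie a hb hc
  have h2 := circL_preLie b ha hc
  have h3 := circL_preLie c ha hb
  rw [sub_eq_iff_eq_add] at h1 h2 h3
  by_cases hd : Even d <;> by_cases he : Even e <;> by_cases hf : Even f <;>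
    simp only [negOnePow_eq_ite, Int.even_mul, Int.even_add, hd, he, hf, if_true, if_false,
      one_smul, Units.neg_smul, or_true, or_self, iff_true, iff_false, not_true_eq_false,
      or_false, map_sub, map_neg, LinearMap.sub_apply,
      LinearMap.neg_apply] at h1 h2 h3 ⊢ <;>
    rw [h1, h2, h3] <;> abel

end GradedLie


/-! ### Iterated brackets with an abelian subalgebra -/

section Derived

variable {K : Type*} [Field K] {M : Type*} [AddCommGroup M] [Module K M] [CharZero K]

theorem nrBracket_jacobi_left {d e f : ℤ} {a b c : CochainSum K M} (ha : a ∈ homog K M d)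
    (hb : b ∈ homog K M e) (hc : c ∈ homog K M f) :
    nrBracket K M a (nrBracket K M b c) = nrBracket K M (nrBracket K M a b) c +
      (d * e).negOnePow • nrBracket K M b (nrBracket K M a c) := by
  rw [nrBracket_jacobi ha hb hc, nrBracket_comm hb (nrBracket_mem ha hc), smul_neg, smul_smul,
    ← Int.negOnePow_add]
  have : (d * e + e * (d + f)).negOnePow = (e * f).negOnePow := by
    rw [Int.negOnePow_eq_iff]
    exact ⟨d * e, by ring⟩
  rw [this]; abel

/-- The operator `a ↦ -[(-1)^{|θ|} θ, a]`. -/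
def lop (θ : CochainSum K M) : CochainSum K M →ₗ[K] CochainSum K M :=
  -nrBracket K M (par K M θ)

/-- The operator `a ↦ [⋯[a, θ_1], ⋯, θ_m]` for a list of triples `(d_i, Q_i, θ_i)`. -/
def rop : List (ℤ × (CochainSum K M × CochainSum K M)) → CochainSum K M →ₗ[K] CochainSum K M
  | [] => LinearMap.id
  | x :: xs => rop xs ∘ₗ (nrBracket K M).flip x.2.2

/-- The sum over `j` of the iterated brackets of `Q_j` with the `θ_i`, `i ≠ j`, where the `θ_i` with
`i < j` act from the left. -/
def derivedSum : List (ℤ × (CochainSum K M × CochainSum K M)) → CochainSum K M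
  | [] => 0
  | x :: xs => lop x.2.2 (derivedSum xs) + rop xs x.2.1

/-- The element `(-1)^{|a|} [a, Q]` on a list with a single entry `(d, Q, θ)`. -/
def bracketSingle (a : CochainSum K M) : List (ℤ × (CochainSum K M × CochainSum K M)) →
    CochainSum K M
  | [x] => nrBracket K M (par K M a) x.2.1
  | _ => 0

/-- The element `(-1)^{|Q|} [Q, Q']` on a list with two entries. -/
def bracketPair : List (ℤ × (CochainSum K M × CochainSum K M)) → CochainSum K M
  | [] => 0
  | x :: xs => bracketSingle x.2.1 xs

/-- The triple `(d, Q, θ)` consists of `Q` of degree `d + 1` and `θ ∈ 𝔥` of degree `d`. -/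
def IsGood (h : Submodule K (CochainSum K M)) (x : ℤ × (CochainSum K M × CochainSum K M)) : Prop :=
  x.2.1 ∈ homog K M (x.1 + 1) ∧ x.2.2 ∈ homog K M x.1 ∧ x.2.2 ∈ h

theorem lop_apply (θ a : CochainSum K M) : lop θ a = -nrBracket K M (par K M θ) a := rfl

theorem rop_cons (x : ℤ × (CochainSum K M × CochainSum K M)) (xs) (a : CochainSum K M) :
    rop (x :: xs) a = rop xs (nrBracket K M a x.2.2) := rfl

theorem derivedSum_cons (x : ℤ × (CochainSum K M × CochainSum K M)) (xs) :
    derivedSum (x :: xs) = lop x.2.2 (derivedSum xs) + rop xs x.2.1 := rfl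

theorem bracketPair_cons (x : ℤ × (CochainSum K M × CochainSum K M)) (xs) :
    bracketPair (x :: xs) = bracketSingle x.2.1 xs := rfl

theorem lop_mem {d e : ℤ} {θ a : CochainSum K M} (hθ : θ ∈ homog K M d) (ha : a ∈ homog K M e) :
    lop θ a ∈ homog K M (d + e) :=
  Submodule.neg_mem _ (nrBracket_mem (par_mem hθ) ha)

/-- Explains the sign chosen in `lop`: `e - 1` is the degree of `a` after desuspension, so acting by
θ from the left is the right bracket with the Koszul sign of moving θ past `s⁻¹a`. Writing this
through `par` keeps `lop` linear in θ. -/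
theorem lop_eq {d e : ℤ} {θ a : CochainSum K M} (hθ : θ ∈ homog K M d) (ha : a ∈ homog K M e) :
    lop θ a = (d * (e - 1)).negOnePow • nrBracket K M a θ := by
  rw [lop_apply, nrBracket_comm (par_mem hθ) ha, par_of_mem hθ, neg_neg, Units.smul_def,
    Units.smul_def, map_zsmul, ← Units.smul_def, ← Units.smul_def, smul_smul, ← Int.negOnePow_add]
  congr 1
  rw [Int.negOnePow_eq_iff]
  exact ⟨d, by ring⟩

theorem map_units_smul {N N' : Type*} [AddCommGroup N] [AddCommGroup N'] [Module K N] [Module K N']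
    (f : N →ₗ[K] N') (u : ℤˣ) (x : N) : f (u • x) = u • f x := by
  rw [Units.smul_def, map_zsmul, ← Units.smul_def]

theorem nrBracket_units_smul_left (u : ℤˣ) (a b : CochainSum K M) :
    nrBracket K M (u • a) b = u • nrBracket K M a b :=
  map_units_smul ((nrBracket K M).flip b) u a

theorem nrBracket_units_smul_right (u : ℤˣ) (a b : CochainSum K M) :
    nrBracket K M a (u • b) = u • nrBracket K M a b :=
  map_units_smul (nrBracket K M a) u b

theorem lop_nrBracket {d e : ℤ} {θ a : CochainSum K M} (hθ : θ ∈ homog K M d)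
    (ha : a ∈ homog K M e) {f : ℤ} {b : CochainSum K M} (hb : b ∈ homog K M f) :
    lop θ (nrBracket K M a b) =
      nrBracket K M (lop θ a) b + (d * e).negOnePow • nrBracket K M a (lop θ b) := by
  simp only [lop_apply]
  rw [nrBracket_jacobi_left (par_mem hθ) ha hb, map_neg, map_neg, LinearMap.neg_apply, smul_neg]
  abel

theorem par_lop {d e : ℤ} {θ a : CochainSum K M} (hθ : θ ∈ homog K M d) (ha : a ∈ homog K M e) :
    par K M (lop θ a) = d.negOnePow • lop θ (par K M a) := by
  rw [par_of_mem (lop_mem hθ ha), par_of_mem ha, map_units_smul, smul_smul, Int.negOnePow_add]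

theorem par_nrBracket {d e : ℤ} {a b : CochainSum K M} (ha : a ∈ homog K M d)
    (hb : b ∈ homog K M e) :
    par K M (nrBracket K M a b) = e.negOnePow • nrBracket K M (par K M a) b := by
  rw [par_of_mem (nrBracket_mem ha hb), par_of_mem ha, nrBracket_units_smul_left, smul_smul,
    add_comm, Int.negOnePow_add]

variable {h : Submodule K (CochainSum K M)}

theorem rop_mem {e : ℤ} {a : CochainSum K M} (ha : a ∈ homog K M e)
    {xs : List (ℤ × (CochainSum K M × CochainSum K M))} (hx : ∀ x ∈ xs, IsGood h x) :
    rop xs a ∈ homog K M (e + totalDeg xs) := by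
  induction xs generalizing a e with
  | nil => simpa [rop] using ha
  | cons x xs ih =>
    rw [rop_cons, totalDeg_cons, ← add_assoc]
    exact ih (nrBracket_mem ha (hx x (by simp)).2.1) fun y hy => hx y (by simp [hy])

theorem derivedSum_mem {xs : List (ℤ × (CochainSum K M × CochainSum K M))}
    (hx : ∀ x ∈ xs, IsGood h x) : derivedSum xs ∈ homog K M (totalDeg xs + 1) := by
  induction xs with
  | nil => exact Submodule.zero_mem _
  | cons x xs ih =>
    have hx' : ∀ y ∈ xs, IsGood h y := fun y hy => hx y (by simp [hy])
    rw [derivedSum_cons, totalDeg_cons]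
    refine Submodule.add_mem _ ?_ ?_
    · rw [add_assoc]
      exact lop_mem (hx x (by simp)).2.1 (ih hx')
    · rw [add_right_comm]
      exact rop_mem (hx x (by simp)).1 hx'

theorem bracketSingle_mem {e : ℤ} {a : CochainSum K M} (ha : a ∈ homog K M e)
    {xs : List (ℤ × (CochainSum K M × CochainSum K M))} (hx : ∀ x ∈ xs, IsGood h x) :
    bracketSingle a xs ∈ homog K M (e + totalDeg xs + 1) := by
  match xs, hx with
  | [], _ => exact Submodule.zero_mem _
  | [x], hx =>
    have := nrBracket_mem (par_mem ha) (hx x (by simp)).1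
    simpa [bracketSingle, add_assoc] using this
  | _ :: _ :: _, _ => exact Submodule.zero_mem _

theorem bracketPair_mem {xs : List (ℤ × (CochainSum K M × CochainSum K M))}
    (hx : ∀ x ∈ xs, IsGood h x) : bracketPair xs ∈ homog K M (totalDeg xs + 2) := by
  match xs, hx with
  | [], _ => exact Submodule.zero_mem _
  | x :: xs, hx =>
    have := bracketSingle_mem (hx x (by simp)).1 (xs := xs) fun y hy => hx y (by simp [hy])
    have e : totalDeg (x :: xs) + 2 = x.1 + 1 + totalDeg xs + 1 := by
      rw [totalDeg_cons]; ring
    rw [e]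
    exact this

/-- Left and right brackets with elements of an abelian subalgebra commute: the term of the Jacobi
identity that contains [θ, θ'] vanishes. -/
theorem nrBracket_lop (hab : ∀ a ∈ h, ∀ b ∈ h, nrBracket K M a b = 0) {d e : ℤ}
    {θ θ' : CochainSum K M} (hθ : θ ∈ homog K M d)
    (hθ' : θ' ∈ homog K M e) (h1 : θ ∈ h) (h2 : θ' ∈ h) (a : CochainSum K M) :
    nrBracket K M (lop θ a) θ' = lop θ (nrBracket K M a θ') := by
  induction a using homog_induction with
  | h f a ha =>
    have h0 : nrBracket K M (par K M θ) θ' = 0 := by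
      rw [par_of_mem hθ, nrBracket_units_smul_left, hab _ h1 _ h2, smul_zero]
    rw [lop_apply, lop_apply, map_neg, LinearMap.neg_apply, nrBracket_jacobi (par_mem hθ) ha hθ',
      h0]
    simp
  | hadd a b ha hb => simp only [map_add, LinearMap.add_apply, ha, hb]

theorem rop_lop (hab : ∀ a ∈ h, ∀ b ∈ h, nrBracket K M a b = 0) {d : ℤ} {θ : CochainSum K M}
    (hθ : θ ∈ homog K M d) (h1 : θ ∈ h) {xs : List (ℤ × (CochainSum K M × CochainSum K M))}
    (hx : ∀ x ∈ xs, IsGood h x) (a : CochainSum K M) :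
    rop xs (lop θ a) = lop θ (rop xs a) := by
  induction xs generalizing a with
  | nil => rfl
  | cons x xs ih =>
    rw [rop_cons, rop_cons, nrBracket_lop hab hθ (hx x (by simp)).2.1 h1 (hx x (by simp)).2.2]
    exact ih (fun y hy => hx y (by simp [hy])) _

theorem rop_par {e : ℤ} {a : CochainSum K M} (ha : a ∈ homog K M e)
    {xs : List (ℤ × (CochainSum K M × CochainSum K M))} (hx : ∀ x ∈ xs, IsGood h x) :
    rop xs (par K M a) = (totalDeg xs).negOnePow • par K M (rop xs a) := by
  rw [par_of_mem (rop_mem ha hx), par_of_mem ha, map_units_smul, smul_smul, ← Int.negOnePow_add]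
  congr 1
  rw [Int.negOnePow_eq_iff]
  exact ⟨-totalDeg xs, by ring⟩

theorem rop_swap (hab : ∀ a ∈ h, ∀ b ∈ h, nrBracket K M a b = 0)
    (A : List (ℤ × (CochainSum K M × CochainSum K M)))
    (x y : ℤ × (CochainSum K M × CochainSum K M)) (B)
    (hx : ∀ z ∈ A ++ x :: y :: B, IsGood h z) (a : CochainSum K M) :
    rop (A ++ x :: y :: B) a = (x.1 * y.1).negOnePow • rop (A ++ y :: x :: B) a := by
  induction A generalizing a with
  | nil =>
    have h1 := hx x (by simp)
    have h2 := hx y (by simp)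
    simp only [List.nil_append, rop_cons]
    rw [← map_units_smul]
    congr 1
    induction a using homog_induction with
    | h f a ha =>
      rw [nrBracket_jacobi ha h1.2.1 h2.2.1, hab _ h1.2.2 _ h2.2.2, map_zero, zero_add]
    | hadd a b ha hb => simp only [map_add, LinearMap.add_apply, ha, hb, smul_add]
  | cons z A ih =>
    simp only [List.cons_append, rop_cons]
    exact ih (fun w hw => hx w (by simp at hw ⊢; tauto)) _

/-- The terms whose `Q` lies beyond both entries are exchanged with themselves (`e1`). The term with
`Q` from one of the two entries and θ from the other acting on the left is matched with the term
where that θ acts on the right (`e2`). -/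
theorem derivedSum_swap (hab : ∀ a ∈ h, ∀ b ∈ h, nrBracket K M a b = 0)
    (A : List (ℤ × (CochainSum K M × CochainSum K M)))
    (x y : ℤ × (CochainSum K M × CochainSum K M)) (B)
    (hx : ∀ z ∈ A ++ x :: y :: B, IsGood h z) :
    derivedSum (A ++ x :: y :: B) = (x.1 * y.1).negOnePow • derivedSum (A ++ y :: x :: B) := by
  induction A with
  | nil =>
    have h1 := hx x (by simp)
    have h2 := hx y (by simp)
    have hB : ∀ z ∈ B, IsGood h z := fun z hz => hx z (by simp [hz])
    simp only [List.nil_append, derivedSum_cons, rop_cons, map_add]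
    have e1 : lop x.2.2 (lop y.2.2 (derivedSum B)) =
        (x.1 * y.1).negOnePow • lop y.2.2 (lop x.2.2 (derivedSum B)) := by
      have hm := derivedSum_mem hB
      rw [lop_eq h1.2.1 (lop_mem h2.2.1 hm), nrBracket_lop hab h2.2.1 h1.2.1 h2.2.2 h1.2.2,
        lop_eq h1.2.1 hm, map_units_smul, smul_smul, ← Int.negOnePow_add]
      congr 1
      rw [Int.negOnePow_eq_iff]
      exact ⟨0, by ring⟩
    have e2 : ∀ {x y : ℤ × (CochainSum K M × CochainSum K M)}, IsGood h x → IsGood h y →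
        lop x.2.2 (rop B y.2.1) = (x.1 * y.1).negOnePow • rop B (nrBracket K M y.2.1 x.2.2) := by
      intro x y h1 h2
      rw [← rop_lop hab h1.2.1 h1.2.2 hB, lop_eq h1.2.1 h2.1, map_units_smul, add_sub_cancel_right]
    rw [e1, e2 h1 h2, e2 h2 h1, smul_add, smul_add, smul_smul, mul_comm y.1 x.1,
      Int.units_mul_self, one_smul]
    abel
  | cons z A ih =>
    have hx' : ∀ w ∈ A ++ x :: y :: B, IsGood h w := fun w hw => hx w (by simp at hw ⊢; tauto)
    simp only [List.cons_append, derivedSum_cons]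
    rw [ih hx', rop_swap hab A x y B hx', map_units_smul, smul_add]

/-- The factor (-1)^{|Q|} converts the antisymmetry of the bracket on L' into graded symmetry for
the desuspended degrees. -/
theorem bracketPair_swap (A : List (ℤ × (CochainSum K M × CochainSum K M)))
    (x y : ℤ × (CochainSum K M × CochainSum K M)) (B)
    (hx : ∀ z ∈ A ++ x :: y :: B, IsGood h z) :
    bracketPair (A ++ x :: y :: B) = (x.1 * y.1).negOnePow • bracketPair (A ++ y :: x :: B) := by
  match A, B with
  | [], [] =>
    have h1 := (hx x (by simp)).1
    have h2 := (hx y (by simp)).1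
    simp only [List.nil_append, bracketPair, bracketSingle]
    rw [par_of_mem h1, par_of_mem h2, nrBracket_units_smul_left, nrBracket_units_smul_left,
      nrBracket_comm h1 h2, smul_neg, smul_smul, smul_smul, ← Units.neg_smul,
      ← Int.negOnePow_add, ← Int.negOnePow_add, ← Int.negOnePow_succ]
    congr 1
    rw [Int.negOnePow_eq_iff]
    exact ⟨x.1 + 1, by ring⟩
  | [], _ :: _ => simp [bracketPair, bracketSingle]
  | [_], _ => simp [bracketPair, bracketSingle]
  | _ :: _ :: _, _ => simp [bracketPair, bracketSingle]

theorem splitSum_linearMap {X N N' : Type*} [AddCommGroup N] [AddCommGroup N'] [Module K N]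
    [Module K N'] (φ : N →ₗ[K] N') (F : List (ℤ × X) → List (ℤ × X) → N) (xs : List (ℤ × X)) :
    splitSum (fun A B => φ (F A B)) xs = φ (splitSum F xs) :=
  splitSum_map φ.toAddMonoidHom F xs

theorem splitSum_of_nil_left {X N : Type*} [AddCommGroup N]
    (F : List (ℤ × X) → List (ℤ × X) → N) (hF : ∀ y A B, F (y :: A) B = 0) (xs : List (ℤ × X)) :
    splitSum F xs = F [] xs := by
  induction xs generalizing F with
  | nil => rfl
  | cons x xs ih =>
    simp only [splitSum, hF, splitSum_zero, zero_add]
    rw [ih _ (fun y A B => by simp [hF])]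
    simp

/-- Right brackets with the θ's are graded derivations; this is the Leibniz rule for an iterated
derivation. -/
theorem rop_nrBracket {e f : ℤ} {a b : CochainSum K M} (ha : a ∈ homog K M e)
    (hb : b ∈ homog K M f) {xs : List (ℤ × (CochainSum K M × CochainSum K M))}
    (hx : ∀ x ∈ xs, IsGood h x) :
    rop xs (nrBracket K M a b) = splitSum (fun A B => (f * totalDeg A).negOnePow •
      nrBracket K M (rop A a) (rop B b)) xs := by
  induction xs generalizing a b e f with
  | nil => simp [splitSum, rop]
  | cons x xs ih =>
    have h1 := (hx x (by simp)).2.1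
    have hx' : ∀ y ∈ xs, IsGood h y := fun y hy => hx y (by simp [hy])
    rw [rop_cons, nrBracket_jacobi ha hb h1, map_add, map_units_smul,
      ih ha (nrBracket_mem hb h1) hx', ih (nrBracket_mem ha h1) hb hx', splitSum, add_comm,
      ← splitSum_smul]
    congr 1
    · refine splitSum_congr fun A B _ _ _ _ => ?_
      rw [smul_smul, ← Int.negOnePow_add, totalDeg_cons, mul_add]
      rfl
    · refine splitSum_congr fun A B _ _ _ _ => ?_
      rw [smul_smul, ← Int.negOnePow_add, add_mul, add_comm]
      rfl

/-- The polarised form of [e^θ a, e^θ Q] = e^θ [a, Q], with `a` fixed and `Q` running over the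
entries of the list. The induction needs all `a` at once, since the first θ may act on it. -/
theorem splitSum_rop_derivedSum (hab : ∀ a ∈ h, ∀ b ∈ h, nrBracket K M a b = 0) {e : ℤ}
    {a : CochainSum K M} (ha : a ∈ homog K M e)
    {xs : List (ℤ × (CochainSum K M × CochainSum K M))} (hx : ∀ x ∈ xs, IsGood h x) :
    splitSum (fun A B => nrBracket K M (par K M (rop A a)) (derivedSum B)) xs =
      splitSum (fun A B => rop B (bracketSingle a A)) xs := by
  induction xs generalizing a e with
  | nil => simp [splitSum, derivedSum, bracketSingle]
  | cons x xs ih =>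
    obtain ⟨hQ, hθ, hh⟩ := hx x (by simp)
    have hx' : ∀ y ∈ xs, IsGood h y := fun y hy => hx y (by simp [hy])
    simp only [splitSum, derivedSum_cons, rop_cons, map_add, smul_add, splitSum_add]
    rw [ih (nrBracket_mem ha hθ) hx']
    -- As `lop θ` is a derivation, it can be taken out of the sum at the cost of a term where it
    -- acts on `a`. The same correction occurs in `e4`, so the induction hypotheses for `a`, `[a,
    -- θ]` and `lop θ a` finish the proof.
    have e1 : splitSum (fun A B => (x.1 * totalDeg A).negOnePow •
        nrBracket K M (par K M (rop A a)) (lop x.2.2 (derivedSum B))) xs =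
        (x.1 * e).negOnePow • (lop x.2.2 (splitSum (fun A B =>
          nrBracket K M (par K M (rop A a)) (derivedSum B)) xs) -
          x.1.negOnePow • splitSum (fun A B =>
          nrBracket K M (par K M (rop A (lop x.2.2 a))) (derivedSum B)) xs) := by
      rw [← splitSum_smul, ← splitSum_linearMap, ← splitSum_sub,
        ← splitSum_smul]
      refine splitSum_congr fun A B hA hB _ _ => ?_
      have hA' : ∀ y ∈ A, IsGood h y := fun y hy => hx' y (hA hy)
      have hB' : ∀ y ∈ B, IsGood h y := fun y hy => hx' y (hB hy)
      rw [rop_lop hab hθ hh hA', par_lop hθ (rop_mem ha hA'), nrBracket_units_smul_left, smul_smul,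
        Int.units_mul_self, one_smul,
        lop_nrBracket hθ (par_mem (rop_mem ha hA')) (derivedSum_mem hB'), add_sub_cancel_left,
        smul_smul, ← Int.negOnePow_add]
      congr 1
      rw [Int.negOnePow_eq_iff]
      exact ⟨-(x.1 * e), by ring⟩
    have e2 : splitSum (fun A B => (x.1 * totalDeg A).negOnePow •
        nrBracket K M (par K M (rop A a)) (rop B x.2.1)) xs =
        rop xs (nrBracket K M (par K M a) x.2.1) := by
      rw [rop_nrBracket (par_mem ha) hQ hx']
      refine splitSum_congr fun A B hA _ _ _ => ?_
      have hA' : ∀ y ∈ A, IsGood h y := fun y hy => hx' y (hA hy)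
      rw [rop_par ha hA', nrBracket_units_smul_left, smul_smul, ← Int.negOnePow_add]
      congr 1
      rw [Int.negOnePow_eq_iff]
      exact ⟨-totalDeg A, by ring⟩
    have e3 : splitSum (fun A B => rop B (bracketSingle a (x :: A))) xs =
        rop xs (nrBracket K M (par K M a) x.2.1) := by
      rw [splitSum_of_nil_left _ (fun y A B => by simp [bracketSingle])]
      rfl
    have e4 : splitSum (fun A B => (x.1 * totalDeg A).negOnePow •
        rop B (nrBracket K M (bracketSingle a A) x.2.2)) xs =
        splitSum (fun A B => rop B (bracketSingle (nrBracket K M a x.2.2) A)) xs +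
        (x.1 * e).negOnePow • (lop x.2.2 (splitSum (fun A B =>
          rop B (bracketSingle a A)) xs) -
          x.1.negOnePow • splitSum (fun A B => rop B (bracketSingle (lop x.2.2 a) A)) xs) := by
      rw [← splitSum_smul, ← splitSum_linearMap, ← splitSum_sub,
        ← splitSum_smul, ← splitSum_add]
      refine splitSum_congr fun A B hA hB _ _ => ?_
      have hB' : ∀ y ∈ B, IsGood h y := fun y hy => hx' y (hB hy)
      rw [← rop_lop hab hθ hh hB', ← map_units_smul (rop B),
        ← map_units_smul (rop B), ← map_sub, ← map_units_smul (rop B), ← map_add]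
      congr 1
      match A, hA with
      | [], _ => simp [bracketSingle]
      | _ :: _ :: _, _ => simp [bracketSingle]
      | [y], hA =>
        have hy := (hx' y (hA (by simp))).1
        simp only [bracketSingle, totalDeg_cons, totalDeg_nil, add_zero]
        rw [nrBracket_jacobi (par_mem ha) hy hθ, lop_nrBracket hθ (par_mem ha) hy, par_lop hθ ha,
          nrBracket_units_smul_left, smul_smul x.1.negOnePow, Int.units_mul_self, one_smul,
          add_sub_cancel_left, lop_eq hθ hy, par_nrBracket ha hθ, nrBracket_units_smul_left,
          nrBracket_units_smul_right, smul_smul, smul_smul, smul_add, smul_smul,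
          ← Int.negOnePow_add, ← Int.negOnePow_add, ← Int.negOnePow_add, add_comm]
        congr 2
        · rw [Int.negOnePow_eq_iff]
          exact ⟨x.1 * y.1, by ring⟩
        · rw [Int.negOnePow_eq_iff]
          exact ⟨-(x.1 * e), by ring⟩
    rw [e1, e2, e3, e4, ih ha hx', ih (lop_mem hθ ha) hx']
    abel

/-- The polarised form of [e^θ Q, e^θ Q] = e^θ [Q, Q]. The factor 2 appears because the left side
takes each pair of entries in both orders, `bracketPair` only in the order of the list. -/
theorem splitSum_derivedSum (hab : ∀ a ∈ h, ∀ b ∈ h, nrBracket K M a b = 0)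
    {xs : List (ℤ × (CochainSum K M × CochainSum K M))} (hx : ∀ x ∈ xs, IsGood h x) :
    splitSum (fun A B => nrBracket K M (par K M (derivedSum A)) (derivedSum B)) xs =
      (2 : ℤ) • splitSum (fun A B => rop B (bracketPair A)) xs := by
  induction xs with
  | nil => simp [splitSum, derivedSum, bracketPair]
  | cons x xs ih =>
    obtain ⟨hQ, hθ, hh⟩ := hx x (by simp)
    have hx' : ∀ y ∈ xs, IsGood h y := fun y hy => hx y (by simp [hy])
    simp only [splitSum, derivedSum_cons, rop_cons, map_add, smul_add, splitSum_add,
      LinearMap.add_apply, bracketPair_cons]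
    rw [splitSum_rop_derivedSum hab hQ hx']
    have e1 : splitSum (fun A B => nrBracket K M (par K M (lop x.2.2 (derivedSum A)))
          (derivedSum B)) xs +
        splitSum (fun A B => (x.1 * totalDeg A).negOnePow •
          nrBracket K M (par K M (derivedSum A)) (lop x.2.2 (derivedSum B))) xs =
        x.1.negOnePow • lop x.2.2 (splitSum (fun A B =>
          nrBracket K M (par K M (derivedSum A)) (derivedSum B)) xs) := by
      rw [← splitSum_linearMap, ← splitSum_smul, ← splitSum_add]
      refine splitSum_congr fun A B hA hB _ _ => ?_
      have hA' : ∀ y ∈ A, IsGood h y := fun y hy => hx' y (hA hy)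
      have hB' : ∀ y ∈ B, IsGood h y := fun y hy => hx' y (hB hy)
      rw [par_lop hθ (derivedSum_mem hA'),
        lop_nrBracket hθ (par_mem (derivedSum_mem hA')) (derivedSum_mem hB'), smul_add,
        nrBracket_units_smul_left, smul_smul, ← Int.negOnePow_add]
      congr 2
      rw [Int.negOnePow_eq_iff]
      exact ⟨-x.1, by ring⟩
    -- The cross term with `Q` of the first entry on the right equals the one with it on the left,
    -- by exchanging the two sublists and graded antisymmetry. This is where the factor 2 arises.
    have e2 : splitSum (fun A B => (x.1 * totalDeg A).negOnePow •
          nrBracket K M (par K M (derivedSum A)) (rop B x.2.1)) xs =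
        splitSum (fun A B => rop B (bracketSingle x.2.1 A)) xs := by
      rw [← splitSum_rop_derivedSum hab hQ hx', splitSum_swap]
      refine splitSum_congr fun A B hA hB _ _ => ?_
      have hA' : ∀ y ∈ A, IsGood h y := fun y hy => hx' y (hA hy)
      have hB' : ∀ y ∈ B, IsGood h y := fun y hy => hx' y (hB hy)
      rw [par_of_mem (derivedSum_mem hB'), par_of_mem (rop_mem hQ hA'), nrBracket_units_smul_left,
        nrBracket_units_smul_left, nrBracket_comm (derivedSum_mem hB') (rop_mem hQ hA'),
        smul_neg, smul_smul, smul_neg, smul_smul, smul_smul, ← Units.neg_smul,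
        ← Int.negOnePow_add, ← Int.negOnePow_add, ← Int.negOnePow_add, ← Int.negOnePow_succ]
      congr 1
      rw [Int.negOnePow_eq_iff]
      exact ⟨totalDeg B * totalDeg A + x.1 * totalDeg B + totalDeg B + 1, by ring⟩
    have e3 : splitSum (fun A B => (x.1 * totalDeg A).negOnePow •
          rop B (nrBracket K M (bracketPair A) x.2.2)) xs =
        x.1.negOnePow • lop x.2.2 (splitSum (fun A B => rop B (bracketPair A)) xs) := by
      rw [← splitSum_linearMap, ← splitSum_smul]
      refine splitSum_congr fun A B hA hB _ _ => ?_
      have hA' : ∀ y ∈ A, IsGood h y := fun y hy => hx' y (hA hy)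
      have hB' : ∀ y ∈ B, IsGood h y := fun y hy => hx' y (hB hy)
      rw [← rop_lop hab hθ hh hB', lop_eq hθ (bracketPair_mem hA'),
        map_units_smul, smul_smul, ← Int.negOnePow_add]
      congr 1
      rw [Int.negOnePow_eq_iff]
      exact ⟨-x.1, by ring⟩
    rw [e2, e3, add_add_add_comm, e1, ih hx']
    rw [map_zsmul, smul_comm]
    abel

end Derived


/-! ### Change of arguments in `∘̄` -/

section ListMaps

variable {M M' N N' : Type*} [AddCommGroup M] [AddCommGroup M'] [AddCommGroup N] [AddCommGroup N']

theorem circ_map (φ : M' →+ M) (f : List M → N) {g : List M → M} {g' : List M' → M'}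
    (h : ∀ xs, g (xs.map φ) = φ (g' xs)) (xs : List M') :
    circ f g (xs.map φ) = circ (fun ys => f (ys.map φ)) g' xs := by
  induction xs generalizing f g g' with
  | nil => simpa [circ] using congrArg (fun z => f [z]) (h [])
  | cons x xs ih =>
    simp only [List.map_cons, circ]
    rw [ih f (g := contr (φ x) g) (g' := contr x g') fun ys => h (x :: ys),
      ih (contr (φ x) f) (g := parity g) (g' := parity g') fun ys => by simp [parity, h]]
    rfl

theorem circ_comp (φ : N →+ N') (f : List M → N) (g : List M → M) (xs : List M) :
    circ (fun ys => φ (f ys)) g xs = φ (circ f g xs) := by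
  induction xs generalizing f g with
  | nil => rfl
  | cons x xs ih =>
    simp only [circ, map_add]
    rw [ih, ← ih (contr x f)]; rfl

theorem circ_congr_map (φ : M' → M) (f : List M → N) {g g' : List M → M}
    (h : ∀ xs : List M', g (xs.map φ) = g' (xs.map φ)) (xs : List M') :
    circ f g (xs.map φ) = circ f g' (xs.map φ) := by
  induction xs generalizing f g g' with
  | nil => simpa [circ] using congrArg (fun z => f [z]) (h [])
  | cons x xs ih =>
    simp only [List.map_cons, circ]
    rw [ih f (g := contr (φ x) g) (g' := contr (φ x) g') fun ys => h (x :: ys),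
      ih (contr (φ x) f) (g := parity g) (g' := parity g') fun ys => by simp [parity, h]]

variable {K : Type*} [Field K] [Module K M] [Module K N]

theorem circ_eq_zero_of {f : List M → M} (hf : IsAlt K f) {g : List M → M}
    (h : ∀ A B, f (g A :: B) = 0) : circ f g = 0 := by
  funext xs
  rw [circ_eq_splitSum hf]
  simp [h, splitSum_zero]

theorem map_smul_of_isAlt {f : List M → N} (hf : IsAlt K f) (c : K) (xs : List M) :
    f (xs.map fun x => c • x) = c ^ xs.length • f xs := by
  induction xs generalizing f with
  | nil => simp
  | cons x xs ih =>
    have h1 := (hf.lin [] (xs.map fun x => c • x)).map_smul c x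
    have h2 := ih (hf.contr x)
    simp only [List.nil_append] at h1
    rw [List.map_cons, h1]
    change c • RelRB.contr x f _ = _
    rw [h2, smul_smul, List.length_cons, pow_succ']
    rfl

end ListMaps

/-! ### Multilinear maps on products -/

theorem multilinearMap_ext_prod {K A B N : Type*} [Field K] [AddCommGroup A] [AddCommGroup B]
    [AddCommGroup N] [Module K A] [Module K B] [Module K N] {n : ℕ}
    {f g : MultilinearMap K (fun _ : Fin n => A × B) N}
    (h : ∀ (S : Finset (Fin n)) (x : Fin n → A × B), (∀ i ∈ S, (x i).2 = 0) →
      (∀ i ∉ S, (x i).1 = 0) → f x = g x) : f = g := by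
  ext x
  have e : x = (fun i => ((x i).1, (0 : B))) + fun i => ((0 : A), (x i).2) := by
    funext i; simp
  rw [e, f.map_add_univ, g.map_add_univ]
  refine Finset.sum_congr rfl fun S _ => h S _ (fun i hi => ?_) fun i hi => ?_
  · simp [hi]
  · simp [hi]

/-! ### Bidegrees -/

section Bidegree

variable {K : Type*} [Field K] {𝔤 : Type w} {V : Type v} [AddCommGroup 𝔤] [Module K 𝔤]
  [AddCommGroup V] [Module K V]

variable (K 𝔤 V) in
/-- The projection of `𝔤 ⊕ V` to `V`. -/
def projV : 𝔤 × V →ₗ[K] 𝔤 × V := LinearMap.inr K 𝔤 V ∘ₗ LinearMap.snd K 𝔤 V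

variable (K 𝔤 V) in
/-- The projection of `𝔤 ⊕ V` to `𝔤`. -/
def projG : 𝔤 × V →ₗ[K] 𝔤 × V := LinearMap.inl K 𝔤 V ∘ₗ LinearMap.fst K 𝔤 V

variable (K 𝔤 V) in
/-- The map on `𝔤 ⊕ V` that is the identity on `𝔤` and twice the identity on `V`. -/
def dilation : 𝔤 × V →ₗ[K] 𝔤 × V := LinearMap.prodMap LinearMap.id ((2 : K) • LinearMap.id)

theorem projV_apply (x : 𝔤 × V) : projV K 𝔤 V x = (0, x.2) := rfl

theorem projG_apply (x : 𝔤 × V) : projG K 𝔤 V x = (x.1, 0) := rfl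

theorem dilation_apply (x : 𝔤 × V) : dilation K 𝔤 V x = (x.1, (2 : K) • x.2) := rfl

theorem projG_add_projV (x : 𝔤 × V) : projG K 𝔤 V x + projV K 𝔤 V x = x := by
  simp [projG_apply, projV_apply]

variable (K 𝔤 V) in
/-- The cochains of weight `w`: the difference between the number of arguments in `V` and of values
in `V` is `w`. -/
def weight (w : ℕ) : Submodule K (CochainSum K (𝔤 × V)) where
  carrier := {f | ∀ xs, hat f (xs.map (dilation K 𝔤 V)) = (2 : K) ^ w • dilation K 𝔤 V (hat f xs)}
  zero_mem' := fun xs => by simp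
  add_mem' := fun {f g} hf hg xs => by simp [hf xs, hg xs]
  smul_mem' := fun c f hf xs => by
    simp only [hat_smul, Pi.smul_apply, hf xs, map_smul]
    exact smul_comm _ _ _

theorem mem_weight {w : ℕ} {f : CochainSum K (𝔤 × V)} : f ∈ weight K 𝔤 V w ↔
    ∀ xs, hat f (xs.map (dilation K 𝔤 V)) = (2 : K) ^ w • dilation K 𝔤 V (hat f xs) := Iff.rfl

theorem hat_projH (f : CochainSum K (𝔤 × V)) (xs : List (𝔤 × V)) :
    hat (projH K 𝔤 V f) xs = projG K 𝔤 V (hat f (xs.map (projV K 𝔤 V))) := by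
  cases xs with
  | nil => simp
  | cons x xs =>
    rw [hat_of_length f (n := xs.length) _ (by simp), hat_of_length _ (n := xs.length) _ (by simp)]
    simp only [projH, DirectSum.lmap_apply]
    change projG K 𝔤 V (f _ _) = _
    congr 2
    funext i
    simp only [List.get_eq_getElem, Fin.val_cast, List.getElem_map]
    rfl

theorem exists_eq_ofFn {X : Type*} {n : ℕ} {l : List X} (h : l.length = n) :
    ∃ x : Fin n → X, l = List.ofFn x := by
  subst h
  exact ⟨l.get, (List.ofFn_get l).symm⟩

variable [CharZero K]

/-- In characteristic 0 the powers of 2 are distinct scalars, so the dilation by 2 separates the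
weights. -/
theorem two_pow_smul_injective {N : Type*} [AddCommGroup N] [Module K N] {m n : ℕ} (h : m ≠ n)
    {x : N} (hx : (2 : K) ^ m • x = (2 : K) ^ n • x) : x = 0 := by
  rw [← sub_eq_zero, ← sub_smul, smul_eq_zero, sub_eq_zero] at hx
  refine hx.resolve_left fun e => h ?_
  have : ((2 ^ m : ℕ) : K) = ((2 ^ n : ℕ) : K) := by simpa using e
  exact Nat.pow_right_injective (le_refl 2) (Nat.cast_injective this)

/-- With r arguments in V and the others in 𝔤, dilating the arguments multiplies the value by 2^r,
while dilating the value multiplies its 𝔤-part by 1 and its V-part by 2. Equality means r = 0 for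
values in 𝔤 and r = 1 for values in V, that is, bidegree n|0. Unlike the definition, this is one
equation that visibly behaves well under ∘̄. -/
theorem mem_LPrime_iff {f : CochainSum K (𝔤 × V)} : f ∈ LPrime K 𝔤 V ↔ f ∈ weight K 𝔤 V 0 := by
  rw [mem_LPrime, mem_weight]
  have hc : ∀ {n : ℕ} (S : Finset (Fin (n + 1))), S.card + Sᶜ.card = n + 1 := fun S => by
    rw [Finset.card_add_card_compl, Fintype.card_fin]
  have hd : ∀ {n : ℕ} (S : Finset (Fin (n + 1))) (x : Fin (n + 1) → 𝔤 × V),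
      (∀ i ∈ S, (x i).2 = 0) → (∀ i ∈ Sᶜ, (x i).1 = 0) →
      f n (fun i => dilation K 𝔤 V (x i)) = (2 : K) ^ Sᶜ.card • f n x := by
    intro n S x h1 h2
    have e : (fun i => dilation K 𝔤 V (x i)) = fun i => (if i ∈ Sᶜ then (2 : K) else 1) • x i := by
      funext i
      rw [dilation_apply]
      split_ifs with h
      · ext <;> simp [h2 i h]
      · ext <;> simp [h1 i (by simpa using h)]
    rw [e]
    have := (f n).toMultilinearMap.map_smul_univ (fun i => if i ∈ Sᶜ then (2 : K) else 1) x
    rw [Finset.prod_ite_mem] at this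
    simpa using this
  constructor
  · intro h xs
    rw [pow_zero, one_smul]
    cases xs with
    | nil => simp
    | cons y ys =>
    obtain ⟨x, hx⟩ := exists_eq_ofFn (l := y :: ys) (n := ys.length + 1) rfl
    rw [hx, List.map_ofFn, hat_ofFn, hat_ofFn]
    have key : (f ys.length).toMultilinearMap.compLinearMap (fun _ => dilation K 𝔤 V) =
        (dilation K 𝔤 V).compMultilinearMap (f ys.length).toMultilinearMap := by
      refine multilinearMap_ext_prod fun S x h1 h2 => ?_
      have h2' : ∀ i ∈ Sᶜ, (x i).1 = 0 := fun i hi => h2 i (by simpa using hi)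
      obtain ⟨a, b, c⟩ := h ys.length S x h1 h2'
      have hS := hc S
      have := hd S x h1 h2'
      change f ys.length (fun i => dilation K 𝔤 V (x i)) = dilation K 𝔤 V (f ys.length x)
      rw [this, dilation_apply]
      by_cases h0 : Sᶜ.card = 0
      · have := a ⟨by omega, by omega⟩
        rw [h0]
        ext <;> simp [this]
      by_cases h1 : Sᶜ.card = 1
      · have := b ⟨by omega, by omega⟩
        rw [h1]
        ext <;> simp [this]
      · rw [c (by omega) (by omega)]
        ext <;> simp
    exact DFunLike.congr_fun key x
  · intro h n S x h1 h2
    have hx := h (List.ofFn x)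
    rw [List.map_ofFn, hat_ofFn, hat_ofFn, pow_zero, one_smul] at hx
    have hx' := (hd S x h1 h2).symm.trans hx
    rw [dilation_apply] at hx'
    have hx1 : (2 : K) ^ Sᶜ.card • (f n x).1 = (2 : K) ^ 0 • (f n x).1 := by
      simpa using congrArg Prod.fst hx'
    have hx2 : (2 : K) ^ Sᶜ.card • (f n x).2 = (2 : K) ^ 1 • (f n x).2 := by
      simpa using congrArg Prod.snd hx'
    have hS := hc S
    refine ⟨fun h => ?_, fun h => ?_, fun h h' => ?_⟩
    · exact two_pow_smul_injective (by omega) hx2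
    · exact two_pow_smul_injective (by omega) hx1
    · refine Prod.ext (two_pow_smul_injective (by omega) hx1)
        (two_pow_smul_injective (by omega) hx2)

theorem mem_hSub_iff {f : CochainSum K (𝔤 × V)} : f ∈ hSub K 𝔤 V ↔ projH K 𝔤 V f = f := by
  rw [mem_hSub]
  have hp : ∀ n (x : Fin (n + 1) → 𝔤 × V), projH K 𝔤 V f n x =
      projG K 𝔤 V (f n fun i => projV K 𝔤 V (x i)) := fun n x => by
    rw [← hat_ofFn, hat_projH, List.map_ofFn, hat_ofFn]
    rfl
  constructor
  · intro h
    refine DFinsupp.ext fun n => ?_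
    have key : (projH K 𝔤 V f n).toMultilinearMap = (f n).toMultilinearMap := by
      refine multilinearMap_ext_prod fun S x h1 h2 => ?_
      obtain ⟨a, -, c⟩ := h n S x h1 fun i hi => h2 i (by simpa using hi)
      have hS : S.card + Sᶜ.card = n + 1 := by rw [Finset.card_add_card_compl, Fintype.card_fin]
      change projH K 𝔤 V f n x = f n x
      rw [hp]
      rcases S.eq_empty_or_nonempty with rfl | ⟨i, hi⟩
      · have e : (fun i => projV K 𝔤 V (x i)) = x := by
          funext i
          rw [projV_apply, ← h2 i (by simp)]
        rw [e, projG_apply, ← a ⟨by simp, by simp⟩]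
      · have hpos : 0 < S.card := Finset.card_pos.2 ⟨i, hi⟩
        rw [c (by omega) (by omega), (f n).map_coord_zero i (by simp [projV_apply, h1 i hi]),
          map_zero]
    exact AlternatingMap.coe_multilinearMap_injective key
  · intro h n S x h1 h2
    have hx := hp n x
    rw [h, projG_apply] at hx
    have hS : S.card + Sᶜ.card = n + 1 := by rw [Finset.card_add_card_compl, Fintype.card_fin]
    refine ⟨fun h => by rw [hx], fun h => by omega, fun h h' => ?_⟩
    obtain ⟨i, hi⟩ : S.Nonempty := by
      rw [← Finset.card_pos]; omega
    rw [hx, (f n).map_coord_zero i (by simp [projV_apply, h1 i hi])]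
    rfl

theorem projH_mem (f : CochainSum K (𝔤 × V)) : projH K 𝔤 V f ∈ hSub K 𝔤 V := by
  rw [mem_hSub_iff]
  apply hat_injective
  funext xs
  rw [hat_projH, hat_projH, hat_projH, List.map_map]
  rfl

theorem hat_of_mem_hSub {θ : CochainSum K (𝔤 × V)} (hθ : θ ∈ hSub K 𝔤 V) (xs : List (𝔤 × V)) :
    hat θ xs = projG K 𝔤 V (hat θ (xs.map (projV K 𝔤 V))) := by
  rw [← hat_projH, mem_hSub_iff.1 hθ]

theorem snd_hat_of_mem_hSub {θ : CochainSum K (𝔤 × V)} (hθ : θ ∈ hSub K 𝔤 V)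
    (xs : List (𝔤 × V)) : (hat θ xs).2 = 0 := by
  rw [hat_of_mem_hSub hθ]; rfl

theorem hat_cons_of_mem_hSub {θ : CochainSum K (𝔤 × V)} (hθ : θ ∈ hSub K 𝔤 V) {y : 𝔤 × V}
    (hy : y.2 = 0) (xs : List (𝔤 × V)) : hat θ (y :: xs) = 0 := by
  rw [hat_of_mem_hSub hθ, List.map_cons, projV_apply, hy]
  rw [show hat θ ((0, 0) :: xs.map (projV K 𝔤 V)) = 0 from
    ((isAlt_hat θ).lin [] (xs.map (projV K 𝔤 V))).map_zero, map_zero]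

theorem circL_eq_zero {θ f : CochainSum K (𝔤 × V)} (hθ : θ ∈ hSub K 𝔤 V)
    (hf : ∀ xs, (hat f xs).2 = 0) : circL K (𝔤 × V) θ f = 0 := by
  apply hat_injective
  rw [hat_circL, hat_zero]
  exact circ_eq_zero_of (isAlt_hat θ) fun A B => hat_cons_of_mem_hSub hθ (hf A) B

theorem projH_apply_mem {d : ℤ} {a : CochainSum K (𝔤 × V)} (ha : a ∈ homog K (𝔤 × V) d) :
    projH K 𝔤 V a ∈ homog K (𝔤 × V) d := fun n hn => by
  simp only [projH, DirectSum.lmap_apply, ha n hn, map_zero]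

theorem projH_lof (n : ℕ) (f : Cochain K (𝔤 × V) n) :
    projH K 𝔤 V (DirectSum.lof K ℕ (Cochain K (𝔤 × V)) n f) =
      DirectSum.lof K ℕ _ n (projH K 𝔤 V (DirectSum.lof K ℕ _ n f) n) :=
  eq_lof_of_mem_homog (projH_apply_mem (lof_mem_homog f))

theorem projH_component (a : CochainSum K (𝔤 × V)) (n : ℕ) :
    projH K 𝔤 V (DirectSum.lof K ℕ (Cochain K (𝔤 × V)) n (a n)) =
      DirectSum.lof K ℕ _ n (projH K 𝔤 V a n) := by
  rw [projH_lof]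
  congr 1
  simp only [projH, DirectSum.lmap_apply, DirectSum.lof_apply]

theorem component_mem_hSub {a : CochainSum K (𝔤 × V)} (ha : a ∈ hSub K 𝔤 V) (n : ℕ) :
    DirectSum.lof K ℕ (Cochain K (𝔤 × V)) n (a n) ∈ hSub K 𝔤 V := by
  rw [mem_hSub_iff, projH_component, mem_hSub_iff.1 ha]

theorem component_mem_LPrime {a : CochainSum K (𝔤 × V)} (ha : a ∈ LPrime K 𝔤 V) (n : ℕ) :
    DirectSum.lof K ℕ (Cochain K (𝔤 × V)) n (a n) ∈ LPrime K 𝔤 V := by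
  rw [mem_LPrime] at ha ⊢
  intro m
  by_cases h : m = n
  · subst h
    rw [DirectSum.lof_apply]
    exact ha m
  · rw [DirectSum.lof_eq_of, DirectSum.of_eq_of_ne _ _ _ h]
    exact Submodule.zero_mem _

theorem graded_induction {M : Type*} [AddCommGroup M] [Module K M]
    {S : Submodule K (CochainSum K M)}
    (hS : ∀ a ∈ S, ∀ n, DirectSum.lof K ℕ (Cochain K M) n (a n) ∈ S) {p : CochainSum K M → Prop}
    (h0 : p 0) (hadd : ∀ a b, p a → p b → p (a + b))
    (h : ∀ (n : ℕ), ∀ a ∈ S, a ∈ homog K M n → p a) {a : CochainSum K M} (ha : a ∈ S) : p a := by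
  classical
  rw [← DirectSum.sum_support_of a]
  refine Finset.sum_induction _ p hadd h0 fun n _ => ?_
  rw [← DirectSum.lof_eq_of K]
  exact h n _ (hS a ha n) (lof_mem_homog _)

/-- On arguments from V, split the value of `b`. Its 𝔤-part is what `projH b` sees. If its V-part is
inserted, all arguments of `a` lie in V, so only `projH a` matters; and `projH a` kills the 𝔤-part,
so nothing is counted twice. -/
theorem projH_circL (a b : CochainSum K (𝔤 × V)) :
    projH K 𝔤 V (circL K (𝔤 × V) a b) = projH K 𝔤 V (circL K (𝔤 × V) a (projH K 𝔤 V b)) +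
      projH K 𝔤 V (circL K (𝔤 × V) (projH K 𝔤 V a) b) := by
  apply hat_injective
  funext xs
  rw [hat_add, Pi.add_apply, hat_projH, hat_projH, hat_projH, hat_circL, hat_circL, hat_circL]
  have hb : hat b = (fun ys => projG K 𝔤 V (hat b ys)) + fun ys => projV K 𝔤 V (hat b ys) := by
    funext ys; simp [projG_add_projV]
  have hG : ∀ f : CochainSum K (𝔤 × V), circ (hat f) (hat b) =
      circ (hat f) (fun ys => projG K 𝔤 V (hat b ys)) +
        circ (hat f) fun ys => projV K 𝔤 V (hat b ys) := fun f => by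
    conv_lhs => rw [hb]
    exact circ_add_right (isAlt_hat f).endLin _ _
  rw [hG a, hG (projH K 𝔤 V a), Pi.add_apply, Pi.add_apply, map_add, map_add]
  have e1 : circ (hat (projH K 𝔤 V a)) (fun ys => projG K 𝔤 V (hat b ys)) = 0 :=
    circ_eq_zero_of (isAlt_hat _) fun A B => hat_cons_of_mem_hSub (projH_mem a) rfl B
  have e2 : ∀ f : CochainSum K (𝔤 × V), circ (hat f) (fun ys => projV K 𝔤 V (hat b ys))
      (xs.map (projV K 𝔤 V)) = circ (fun ys => hat f (ys.map (projV K 𝔤 V)))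
        (fun ys => hat b (ys.map (projV K 𝔤 V))) xs := fun f =>
    circ_map (projV K 𝔤 V).toAddMonoidHom (hat f) (fun ys => rfl) xs
  rw [e1, Pi.zero_apply, map_zero, zero_add, e2, e2]
  congr 1
  · congr 1
    refine circ_congr_map _ _ (fun ys => ?_) _
    rw [hat_projH, List.map_map]
    rfl
  · rw [← LinearMap.toAddMonoidHom_coe, ← circ_comp, ← circ_comp]
    congr 1
    funext ys
    simp only [LinearMap.toAddMonoidHom_coe]
    rw [hat_projH, List.map_map]
    rfl

/-- The hypothesis of Voronov's construction as a single identity; in particular the kernel of P is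
closed under the bracket. -/
theorem projH_nrBracket (a b : CochainSum K (𝔤 × V)) :
    projH K 𝔤 V (nrBracket K (𝔤 × V) a b) = projH K 𝔤 V (nrBracket K (𝔤 × V) (projH K 𝔤 V a) b) +
      projH K 𝔤 V (nrBracket K (𝔤 × V) a (projH K 𝔤 V b)) := by
  induction a using homog_induction with
  | hadd a a' h h' =>
    simp only [map_add, LinearMap.add_apply, h, h']; abel
  | h d a ha =>
    induction b using homog_induction with
    | hadd b b' h h' =>
      simp only [map_add, h, h']; abel
    | h e b hb =>
      rw [nrBracket_eq ha hb, nrBracket_eq (projH_apply_mem ha) hb,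
        nrBracket_eq ha (projH_apply_mem hb)]
      simp only [map_sub, map_units_smul]
      rw [projH_circL a b, projH_circL b a, smul_add]
      abel

theorem nrBracket_hSub : ∀ a ∈ hSub K 𝔤 V, ∀ b ∈ hSub K 𝔤 V, nrBracket K (𝔤 × V) a b = 0 := by
  intro a ha b hb
  refine graded_induction (p := fun a => nrBracket K (𝔤 × V) a b = 0)
    (fun _ h => component_mem_hSub h) (by simp)
    (fun a a' h h' => by simp [h, h']) (fun n a ha hna => ?_) ha
  refine graded_induction (p := fun b => nrBracket K (𝔤 × V) a b = 0)
    (fun _ h => component_mem_hSub h) (by simp)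
    (fun a a' h h' => by simp [h, h']) (fun m b hb hmb => ?_) hb
  rw [nrBracket_eq hna hmb, circL_eq_zero ha (snd_hat_of_mem_hSub hb),
    circL_eq_zero hb (snd_hat_of_mem_hSub ha)]
  simp

theorem circL_mem_weight {w w' : ℕ} {a b : CochainSum K (𝔤 × V)} (ha : a ∈ weight K 𝔤 V w)
    (hb : b ∈ weight K 𝔤 V w') : circL K (𝔤 × V) a b ∈ weight K 𝔤 V (w + w') := by
  intro xs
  rw [hat_circL]
  have e1 := circ_map (dilation K 𝔤 V).toAddMonoidHom (hat a) (g := hat b)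
    (g' := (2 : K) ^ w' • hat b) (fun ys => by
      rw [LinearMap.toAddMonoidHom_coe, hb, Pi.smul_apply, map_smul]) xs
  simp only [LinearMap.toAddMonoidHom_coe] at e1
  have e2 : (fun ys => hat a (ys.map (dilation K 𝔤 V))) =
      (2 : K) ^ w • fun ys => (dilation K 𝔤 V).toAddMonoidHom (hat a ys) := by
    funext ys
    exact ha ys
  rw [e1, e2, circ_smul_left, circ_smul_right, Pi.smul_apply, Pi.smul_apply, circ_comp, smul_smul,
    pow_add]
  · rfl
  · intro B
    exact ⟨fun x y => by simp [((isAlt_hat a).endLin B).map_add],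
      fun c x => by simp [((isAlt_hat a).endLin B).map_smul]⟩

theorem component_mem_weight {w : ℕ} {a : CochainSum K (𝔤 × V)} (ha : a ∈ weight K 𝔤 V w) (n : ℕ) :
    DirectSum.lof K ℕ (Cochain K (𝔤 × V)) n (a n) ∈ weight K 𝔤 V w := by
  intro xs
  by_cases h : xs.length = n + 1
  · have e : ∀ ys : List (𝔤 × V), ys.length = n + 1 →
        hat (DirectSum.lof K ℕ (Cochain K (𝔤 × V)) n (a n)) ys = hat a ys := by
      intro ys hy
      rw [hat_of_length _ ys hy, hat_of_length _ ys hy, DirectSum.lof_apply]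
    rw [e _ (by simpa using h), e _ h, ha]
  · rw [hat_lof_of_ne _ h, hat_lof_of_ne _ (by simpa using h)]
    simp

theorem nrBracket_mem_weight {w w' : ℕ} {a b : CochainSum K (𝔤 × V)} (ha : a ∈ weight K 𝔤 V w)
    (hb : b ∈ weight K 𝔤 V w') : nrBracket K (𝔤 × V) a b ∈ weight K 𝔤 V (w + w') := by
  refine graded_induction (p := fun a => nrBracket K (𝔤 × V) a b ∈ _)
    (fun _ h => component_mem_weight h) (by simp)
    (fun a a' h h' => by simpa using Submodule.add_mem _ h h') (fun n a ha hna => ?_) ha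
  refine graded_induction (p := fun b => nrBracket K (𝔤 × V) a b ∈ _)
    (fun _ h => component_mem_weight h) (by simp)
    (fun a a' h h' => by simpa using Submodule.add_mem _ h h') (fun m b hb hmb => ?_) hb
  rw [nrBracket_eq hna hmb, Units.smul_def]
  refine Submodule.sub_mem _ (circL_mem_weight ha hb) (zsmul_mem ?_ _)
  rw [add_comm]
  exact circL_mem_weight hb ha

theorem nrBracket_mem_LPrime {a b : CochainSum K (𝔤 × V)} (ha : a ∈ LPrime K 𝔤 V)
    (hb : b ∈ LPrime K 𝔤 V) : nrBracket K (𝔤 × V) a b ∈ LPrime K 𝔤 V := by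
  rw [mem_LPrime_iff] at *
  exact nrBracket_mem_weight ha hb

theorem hSub_mem_weight {n : ℕ} {θ : CochainSum K (𝔤 × V)} (hθ : θ ∈ hSub K 𝔤 V)
    (hn : θ ∈ homog K (𝔤 × V) n) : θ ∈ weight K 𝔤 V (n + 1) := by
  intro xs
  by_cases h : xs.length = n + 1
  · have e : (xs.map (dilation K 𝔤 V)).map (projV K 𝔤 V) =
        (xs.map (projV K 𝔤 V)).map fun x => (2 : K) • x := by
      simp only [List.map_map]
      congr 1
      funext x
      ext <;> simp [projV_apply, dilation_apply]
    rw [hat_of_mem_hSub hθ, e, map_smul_of_isAlt (isAlt_hat θ), List.length_map, h, map_smul,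
      ← hat_of_mem_hSub hθ]
    congr 1
    rw [dilation_apply]
    ext <;> simp [snd_hat_of_mem_hSub hθ]
  · rw [hat_of_mem_homog hn (by rw [List.length_map]; exact_mod_cast h),
      hat_of_mem_homog hn (by exact_mod_cast h)]
    simp

/-- On `n + 1` arguments from V the dilation is multiplication by 2, and it fixes the 𝔤-component of
the value. So that component is multiplied both by 2^(n+1) and by 2^w. -/
theorem projH_apply_eq_zero {w n : ℕ} {f : CochainSum K (𝔤 × V)} (hf : f ∈ weight K 𝔤 V w)
    (h : n + 1 ≠ w) : projH K 𝔤 V f n = 0 := by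
  ext1 x
  rw [← hat_ofFn, hat_projH]
  have h1 := hf ((List.ofFn x).map (projV K 𝔤 V))
  have e : ((List.ofFn x).map (projV K 𝔤 V)).map (dilation K 𝔤 V) =
      ((List.ofFn x).map (projV K 𝔤 V)).map fun x => (2 : K) • x := by
    simp only [List.map_map]
    congr 1
    funext x
    ext <;> simp [projV_apply, dilation_apply]
  rw [e, map_smul_of_isAlt (isAlt_hat f), List.length_map, List.length_ofFn] at h1
  have h2 := congrArg Prod.fst h1
  rw [projG_apply, two_pow_smul_injective h h2]
  rfl

theorem projH_eq_zero_of_mem_homog {w : ℕ} {d : ℤ} {f : CochainSum K (𝔤 × V)}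
    (hf : f ∈ weight K 𝔤 V w) (hd : f ∈ homog K (𝔤 × V) d) (h : d + 1 ≠ w) :
    projH K 𝔤 V f = 0 := by
  refine DFinsupp.ext fun n => ?_
  by_cases hn : (n : ℤ) = d
  · exact projH_apply_eq_zero hf (by omega)
  · exact projH_apply_mem hd n hn

theorem projH_LPrime {f : CochainSum K (𝔤 × V)} (hf : f ∈ LPrime K 𝔤 V) : projH K 𝔤 V f = 0 :=
  DFinsupp.ext fun n => projH_apply_eq_zero (mem_LPrime_iff.1 hf) (Nat.succ_ne_zero n)

theorem par_mem_LPrime {a : CochainSum K (𝔤 × V)} (ha : a ∈ LPrime K 𝔤 V) :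
    par K (𝔤 × V) a ∈ LPrime K 𝔤 V := by
  rw [mem_LPrime] at *
  intro n
  rw [par_apply]
  exact Submodule.smul_mem _ _ (ha n)

theorem projH_par (a : CochainSum K (𝔤 × V)) :
    projH K 𝔤 V (par K (𝔤 × V) a) = par K (𝔤 × V) (projH K 𝔤 V a) := by
  refine DFinsupp.ext fun n => ?_
  rw [par_apply]
  simp only [projH, DirectSum.lmap_apply, par_apply, map_smul]

end Bidegree


/-! ### Multilinear maps from functions on lists -/

section MultilinearOfList

variable {K E N : Type*} [Field K] [AddCommGroup E] [AddCommGroup N] [Module K E] [Module K N]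

theorem ofFn_update {n : ℕ} [DecidableEq (Fin n)] (x : Fin n → E) (i : Fin n) (z : E) :
    List.ofFn (Function.update x i z) =
      (List.ofFn x).take i ++ z :: (List.ofFn x).drop (i + 1) := by
  apply List.ext_getElem
  · simp; omega
  · intro j h1 h2
    simp only [List.getElem_ofFn, Function.update_apply, List.getElem_append, List.getElem_cons,
      List.length_take, List.length_ofFn, List.getElem_take, List.getElem_drop]
    have hi := i.2
    rw [List.length_ofFn] at h1
    have hji : (⟨j, h1⟩ : Fin n) = i ↔ j = i := by rw [Fin.ext_iff]
    simp only [hji, min_eq_left hi.le]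
    split_ifs
    all_goals first | rfl | omega | (congr 1; ext; simp; omega)

/-- A function on lists that is linear in every entry, as a multilinear map. -/
def multilinearOfList (F : List E → N) (hF : ∀ A B, IsLinearMap K fun z => F (A ++ z :: B))
    (k : ℕ) : MultilinearMap K (fun _ : Fin k => E) N where
  toFun x := F (List.ofFn x)
  map_update_add' x i a b := by
    simp only [ofFn_update]
    exact (hF _ _).map_add a b
  map_update_smul' x i c a := by
    simp only [ofFn_update]
    exact (hF _ _).map_smul c a

end MultilinearOfList

/-! ### Splittings of a mapped list -/

section SplitSumMap

variable {X Y N : Type*} [AddCommGroup N]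

theorem totalDeg_map (ψ : ℤ × X → ℤ × Y) (h : ∀ x, (ψ x).1 = x.1) (xs : List (ℤ × X)) :
    totalDeg (xs.map ψ) = totalDeg xs := by
  induction xs with
  | nil => rfl
  | cons x xs ih => simp [h, ih]

theorem splitSum_map_list (ψ : ℤ × X → ℤ × Y) (h : ∀ x, (ψ x).1 = x.1)
    (F : List (ℤ × Y) → List (ℤ × Y) → N) (xs : List (ℤ × X)) :
    splitSum (fun A B => F (A.map ψ) (B.map ψ)) xs = splitSum F (xs.map ψ) := by
  induction xs generalizing F with
  | nil => rfl
  | cons x xs ih =>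
    simp only [List.map_cons, splitSum, h]
    rw [← ih, ← ih]
    simp only [totalDeg_map ψ h]

end SplitSumMap

/-! ### Linearity of the derived brackets -/

section DerivedLinear

variable {K : Type*} [Field K] {M : Type*} [AddCommGroup M] [Module K M] [CharZero K]

theorem rop_isLinearMap (a : CochainSum K M) (A B) (d : ℤ) :
    IsLinearMap K fun z : CochainSum K M × CochainSum K M => rop (A ++ (d, z) :: B) a := by
  induction A generalizing a with
  | nil =>
    constructor
    · intro x y
      simp [rop_cons]
    · intro c x
      simp [rop_cons]
  | cons x A ih => exact ih _

theorem derivedSum_isLinearMap (A B) (d : ℤ) :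
    IsLinearMap K fun z : CochainSum K M × CochainSum K M => derivedSum (A ++ (d, z) :: B) := by
  induction A with
  | nil =>
    constructor
    · intro x y
      simp only [List.nil_append, derivedSum_cons, lop_apply, Prod.fst_add, Prod.snd_add, map_add,
        LinearMap.add_apply]
      abel
    · intro c x
      simp only [List.nil_append, derivedSum_cons, lop_apply, Prod.smul_fst, Prod.smul_snd,
        map_smul, LinearMap.smul_apply, smul_add, smul_neg]
  | cons x A ih =>
    constructor
    · intro y z
      simp only [List.cons_append, derivedSum_cons, ih.map_add,
        (rop_isLinearMap _ A B d).map_add, map_add]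
      abel
    · intro c y
      simp only [List.cons_append, derivedSum_cons, ih.map_smul,
        (rop_isLinearMap _ A B d).map_smul, map_smul, smul_add]

theorem bracketPair_isLinearMap (A B) (d : ℤ) :
    IsLinearMap K fun z : CochainSum K M × CochainSum K M => bracketPair (A ++ (d, z) :: B) := by
  match A, B with
  | [], [] => exact ⟨by simp [bracketPair, bracketSingle], by simp [bracketPair, bracketSingle]⟩
  | [], [_] => exact ⟨by simp [bracketPair, bracketSingle], by simp [bracketPair, bracketSingle]⟩
  | [], _ :: _ :: _ =>
    exact ⟨by simp [bracketPair, bracketSingle], by simp [bracketPair, bracketSingle]⟩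
  | [_], [] => exact ⟨by simp [bracketPair, bracketSingle], by simp [bracketPair, bracketSingle]⟩
  | [_], _ :: _ => exact ⟨by simp [bracketPair, bracketSingle], by simp [bracketPair, bracketSingle]⟩
  | _ :: [_], _ => exact ⟨by simp [bracketPair, bracketSingle], by simp [bracketPair, bracketSingle]⟩
  | _ :: _ :: _ :: _, _ =>
    exact ⟨by simp [bracketPair, bracketSingle], by simp [bracketPair, bracketSingle]⟩

variable {X : Type*} {f g : X → ℤ × (CochainSum K M × CochainSum K M)}

/-- The recorded degrees enter only through the signs of `splitSum`; the values of `rop`,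
`derivedSum` and `bracketPair` do not read them. So these define operations on elements that need
not be homogeneous. -/
theorem rop_map_congr (h : ∀ x, (f x).2 = (g x).2) (xs : List X) (a : CochainSum K M) :
    rop (xs.map f) a = rop (xs.map g) a := by
  induction xs generalizing a with
  | nil => rfl
  | cons x xs ih => simp only [List.map_cons, rop_cons, ih, h]

theorem derivedSum_map_congr (h : ∀ x, (f x).2 = (g x).2) (xs : List X) :
    derivedSum (xs.map f) = derivedSum (xs.map g) := by
  induction xs with
  | nil => rfl
  | cons x xs ih => simp only [List.map_cons, derivedSum_cons, rop_map_congr h, ih, h]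

theorem bracketPair_map_congr (h : ∀ x, (f x).2 = (g x).2) (xs : List X) :
    bracketPair (xs.map f) = bracketPair (xs.map g) := by
  match xs with
  | [] => rfl
  | [_] => rfl
  | [x, y] => simp [bracketPair, bracketSingle, h]
  | _ :: _ :: _ :: _ => rfl

theorem rop_eq_zero {xs : List (ℤ × (CochainSum K M × CochainSum K M))}
    {x : ℤ × (CochainSum K M × CochainSum K M)} (hx : x ∈ xs) (h : x.2.2 = 0)
    (a : CochainSum K M) : rop xs a = 0 := by
  induction xs generalizing a with
  | nil => simp at hx
  | cons y xs ih =>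
    rw [rop_cons]
    rcases List.mem_cons.1 hx with rfl | hx
    · rw [h, map_zero, map_zero]
    · exact ih hx _

theorem derivedSum_eq_zero_of_fst {xs : List (ℤ × (CochainSum K M × CochainSum K M))}
    (h : ∀ x ∈ xs, x.2.1 = 0) : derivedSum xs = 0 := by
  induction xs with
  | nil => rfl
  | cons x xs ih =>
    rw [derivedSum_cons, ih fun y hy => h y (by simp [hy]), h x (by simp), map_zero, map_zero,
      add_zero]

/-- Each summand takes `Q` from one entry and θ from all the others, so two entries with θ = 0 kill
every summand. -/
theorem derivedSum_eq_zero_of_not_pairwise {xs : List (ℤ × (CochainSum K M × CochainSum K M))}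
    (h : ¬ xs.Pairwise fun x y => ¬ (x.2.2 = 0 ∧ y.2.2 = 0)) : derivedSum xs = 0 := by
  induction xs with
  | nil => rfl
  | cons x xs ih =>
    rw [List.pairwise_cons] at h
    rw [derivedSum_cons]
    by_cases h2 : xs.Pairwise fun x y => ¬ (x.2.2 = 0 ∧ y.2.2 = 0)
    · have : ∃ y ∈ xs, x.2.2 = 0 ∧ y.2.2 = 0 := by
        by_contra hc
        exact h ⟨fun y hy h' => hc ⟨y, hy, h'⟩, h2⟩
      obtain ⟨y, hy, hx0, hy0⟩ := this
      rw [hx0, rop_eq_zero hy hy0]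
      simp [lop]
    · have : ∃ y ∈ xs, y.2.2 = 0 := by
        by_contra hc
        push Not at hc
        exact h2 (List.pairwise_of_forall_mem_list fun a ha b _ h' => hc a ha h'.1)
      obtain ⟨y, hy, hy0⟩ := this
      rw [ih h2, rop_eq_zero hy hy0, map_zero, add_zero]

/-- The L'-component of the generalized Jacobi identity. Only lists of length 3 allow a nested
bracket, and for these it is the Jacobi identity with desuspended signs. -/
theorem splitSum_bracketPair {h : Submodule K (CochainSum K M)}
    {xs : List (ℤ × (CochainSum K M × CochainSum K M))} (hx : ∀ x ∈ xs, IsGood h x) :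
    splitSum (fun A B => bracketSingle (bracketPair A) B) xs = 0 := by
  by_cases hl : xs.length = 3
  · obtain ⟨x, y, z, rfl⟩ := List.length_eq_three.1 hl
    have h1 := (hx x (by simp)).1
    have h2 := (hx y (by simp)).1
    have h3 := (hx z (by simp)).1
    simp only [splitSum, bracketPair, bracketSingle, totalDeg_cons, totalDeg_nil, smul_zero, add_zero, zero_add, mul_zero, Int.negOnePow_zero, one_smul,
      par_nrBracket (par_mem h1) h2, par_nrBracket (par_mem h1) h3, par_nrBracket (par_mem h2) h3,
      par_par, nrBracket_units_smul_left]
    rw [nrBracket_jacobi h1 h2 h3, nrBracket_comm (nrBracket_mem h2 h3) h1]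
    by_cases e1 : Even x.1 <;> by_cases e2 : Even y.1 <;> by_cases e3 : Even z.1 <;>
      simp only [negOnePow_eq_ite, Int.even_mul, Int.even_add, Int.not_even_one, e1, e2, e3,
        if_true, if_false, one_smul, Units.neg_smul, or_true, or_self, iff_true, iff_false,
        not_true_eq_false, or_false, smul_add, neg_neg,
        smul_neg] <;> abel
  · refine (splitSum_congr fun A B _ _ _ hl' => ?_).trans (splitSum_zero xs)
    match A, B with
    | [], [] => rfl
    | [], [_] => simp [bracketPair, bracketSingle]
    | [_], [] => rfl
    | [_], [_] => simp [bracketPair, bracketSingle]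
    | [_, _], [_] => simp at hl'; omega
    | _ :: _ :: _ :: _, [_] => simp [bracketPair, bracketSingle]
    | [_, _], [] => rfl
    | _ :: _ :: _ :: _, [] => rfl
    | _, _ :: _ :: _ => rfl

end DerivedLinear

/-! ### The controlling `L∞`-algebra -/

section Ctrl

variable {K : Type*} [Field K] {𝔤 : Type w} {V : Type v} [AddCommGroup 𝔤] [Module K 𝔤]
  [AddCommGroup V] [Module K V]

/-- The pair of cochains underlying an element of `s⁻¹L' ⊕ 𝔥`, with a degree. -/
def rawOf (x : ℤ × Ctrl K 𝔤 V) : ℤ × (CochainSum K (𝔤 × V) × CochainSum K (𝔤 × V)) :=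
  (x.1, (x.2.1 : CochainSum K (𝔤 × V)), (x.2.2 : CochainSum K (𝔤 × V)))

/-- The pair of cochains underlying an element of `s⁻¹L' ⊕ 𝔥`, with the degree `0`. -/
def raw (x : Ctrl K 𝔤 V) : ℤ × (CochainSum K (𝔤 × V) × CochainSum K (𝔤 × V)) := rawOf (0, x)

variable (K 𝔤 V) in
/-- The projection of `s⁻¹L' ⊕ 𝔥` to `L'`, with values in `L`. -/
def ctrlFst : Ctrl K 𝔤 V →ₗ[K] CochainSum K (𝔤 × V) where
  toFun x := x.1
  map_add' _ _ := rfl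
  map_smul' _ _ := rfl

variable (K 𝔤 V) in
/-- The projection of `s⁻¹L' ⊕ 𝔥` to `𝔥`, with values in `L`. -/
def ctrlSnd : Ctrl K 𝔤 V →ₗ[K] CochainSum K (𝔤 × V) where
  toFun x := x.2
  map_add' _ _ := rfl
  map_smul' _ _ := rfl

theorem mem_ctrlGrading {i : ℤ} {x : Ctrl K 𝔤 V} : x ∈ ctrlGrading K 𝔤 V i ↔
    (x.1 : CochainSum K (𝔤 × V)) ∈ homog K (𝔤 × V) (i + 1) ∧
      (x.2 : CochainSum K (𝔤 × V)) ∈ homog K (𝔤 × V) i :=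
  forall_and

theorem isGood_rawOf {x : ℤ × Ctrl K 𝔤 V} (h : x.2 ∈ ctrlGrading K 𝔤 V x.1) :
    IsGood (hSub K 𝔤 V) (rawOf x) :=
  ⟨(mem_ctrlGrading.1 h).1, (mem_ctrlGrading.1 h).2, x.2.2.2⟩

variable [CharZero K]

theorem bracketPair_mem_LPrime (xs : List (Ctrl K 𝔤 V)) :
    bracketPair (xs.map raw) ∈ LPrime K 𝔤 V := by
  match xs with
  | [] => exact Submodule.zero_mem _
  | [_] => exact Submodule.zero_mem _
  | [x, y] => exact nrBracket_mem_LPrime (par_mem_LPrime x.1.2) y.1.2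
  | _ :: _ :: _ :: _ => exact Submodule.zero_mem _

/-- The higher derived brackets as a function on lists. -/
def derivedList (xs : List (Ctrl K 𝔤 V)) : Ctrl K 𝔤 V :=
  (⟨bracketPair (xs.map raw), bracketPair_mem_LPrime xs⟩,
    ⟨projH K 𝔤 V (derivedSum (xs.map raw)), projH_mem _⟩)

theorem ctrl_ext {x y : Ctrl K 𝔤 V} (h1 : (x.1 : CochainSum K (𝔤 × V)) = y.1)
    (h2 : (x.2 : CochainSum K (𝔤 × V)) = y.2) : x = y :=
  Prod.ext (Subtype.ext h1) (Subtype.ext h2)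

theorem derivedList_isLinearMap (A B : List (Ctrl K 𝔤 V)) :
    IsLinearMap K fun z => derivedList (A ++ z :: B) := by
  have h1 := bracketPair_isLinearMap (K := K) (M := 𝔤 × V) (A.map raw) (B.map raw) 0
  have h2 := derivedSum_isLinearMap (K := K) (M := 𝔤 × V) (A.map raw) (B.map raw) 0
  constructor
  · intro x y
    refine ctrl_ext ?_ ?_
    · simp only [derivedList, List.map_append, List.map_cons]
      exact h1.map_add (raw x).2 (raw y).2
    · simp only [derivedList, List.map_append, List.map_cons]
      exact (congrArg _ (h2.map_add (raw x).2 (raw y).2)).trans (map_add _ _ _)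
  · intro c x
    refine ctrl_ext ?_ ?_
    · simp only [derivedList, List.map_append, List.map_cons]
      exact h1.map_smul c (raw x).2
    · simp only [derivedList, List.map_append, List.map_cons]
      exact (congrArg _ (h2.map_smul c (raw x).2)).trans (map_smul _ _ _)

variable (K 𝔤 V) in
/-- The higher derived brackets. -/
def derivedBracket (k : ℕ) : MultilinearMap K (fun _ : Fin k => Ctrl K 𝔤 V) (Ctrl K 𝔤 V) :=
  multilinearOfList derivedList derivedList_isLinearMap k

theorem derivedBracket_apply {k : ℕ} (x : Fin k → Ctrl K 𝔤 V) :
    derivedBracket K 𝔤 V k x = derivedList (List.ofFn x) := rfl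

theorem derivedList_map_snd_fst (xs : List (ℤ × Ctrl K 𝔤 V)) :
    ((derivedList (xs.map Prod.snd)).1 : CochainSum K (𝔤 × V)) = bracketPair (xs.map rawOf) := by
  simp only [derivedList, List.map_map]
  exact bracketPair_map_congr (K := K) (f := raw ∘ Prod.snd) (g := rawOf) (fun _ => rfl) xs

theorem derivedList_map_snd_snd (xs : List (ℤ × Ctrl K 𝔤 V)) :
    ((derivedList (xs.map Prod.snd)).2 : CochainSum K (𝔤 × V)) =
      projH K 𝔤 V (derivedSum (xs.map rawOf)) := by
  simp only [derivedList, List.map_map]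
  exact congrArg _ (derivedSum_map_congr (K := K) (f := raw ∘ Prod.snd) (g := rawOf)
    (fun _ => rfl) xs)

theorem units_smul_fst (u : ℤˣ) (x : Ctrl K 𝔤 V) :
    ((u • x).1 : CochainSum K (𝔤 × V)) = u • (x.1 : CochainSum K (𝔤 × V)) :=
  map_units_smul (ctrlFst K 𝔤 V) u x

theorem units_smul_snd (u : ℤˣ) (x : Ctrl K 𝔤 V) :
    ((u • x).2 : CochainSum K (𝔤 × V)) = u • (x.2 : CochainSum K (𝔤 × V)) :=
  map_units_smul (ctrlSnd K 𝔤 V) u x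

theorem totalDeg_ofFn {X : Type*} {n : ℕ} (d : Fin n → ℤ) (x : Fin n → X) :
    totalDeg (List.ofFn fun i => (d i, x i)) = ∑ i, d i := by
  simp [totalDeg, List.map_ofFn, Function.comp_def, List.sum_ofFn]

theorem derivedBracket_mem {k : ℕ} {d : Fin k → ℤ} {x : Fin k → Ctrl K 𝔤 V}
    (h : ∀ i, x i ∈ ctrlGrading K 𝔤 V (d i)) :
    derivedBracket K 𝔤 V k x ∈ ctrlGrading K 𝔤 V (∑ i, d i + 1) := by
  have e : List.ofFn x = (List.ofFn fun i => (d i, x i)).map Prod.snd := by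
    rw [List.map_ofFn]; rfl
  have hg : ∀ z ∈ (List.ofFn fun i => (d i, x i)).map rawOf, IsGood (hSub K 𝔤 V) z := by
    intro z hz
    rw [List.map_ofFn] at hz
    obtain ⟨i, rfl⟩ := (List.mem_ofFn' _ _).1 hz
    exact isGood_rawOf (h i)
  have ht : totalDeg ((List.ofFn fun i => (d i, x i)).map rawOf) = ∑ i, d i := by
    rw [totalDeg_map rawOf (fun _ => rfl), totalDeg_ofFn]
  rw [mem_ctrlGrading, derivedBracket_apply, e, derivedList_map_snd_fst, derivedList_map_snd_snd]
  constructor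
  · have := bracketPair_mem hg
    rw [ht] at this
    rwa [add_assoc]
  · have := derivedSum_mem hg
    rw [ht] at this
    exact projH_apply_mem this

theorem derivedBracket_symm {n : ℕ} {d : Fin n → ℤ} {x : Fin n → Ctrl K 𝔤 V}
    (h : ∀ i, x i ∈ ctrlGrading K 𝔤 V (d i)) (σ : Equiv.Perm (Fin n)) :
    derivedBracket K 𝔤 V n (fun i => x (σ i)) = koszulSign σ d • derivedBracket K 𝔤 V n x := by
  have := graded_perm (p := fun z : ℤ × Ctrl K 𝔤 V => z.2 ∈ ctrlGrading K 𝔤 V z.1)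
    (f := fun l => derivedList (l.map Prod.snd)) (fun A y z B hz => ?_) (fun i => (d i, x i)) h σ
  · simp only [List.map_ofFn] at this
    exact this
  · have hg : ∀ w ∈ A.map rawOf ++ rawOf y :: rawOf z :: B.map rawOf,
        IsGood (hSub K 𝔤 V) w := by
      intro w hw
      have : w ∈ (A ++ y :: z :: B).map rawOf := by simpa using hw
      obtain ⟨v, hv, rfl⟩ := List.mem_map.1 this
      exact isGood_rawOf (hz v hv)
    refine ctrl_ext ?_ ?_
    · rw [units_smul_fst, derivedList_map_snd_fst, derivedList_map_snd_fst]
      simp only [List.map_append, List.map_cons]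
      exact bracketPair_swap _ _ _ _ hg
    · rw [units_smul_snd, derivedList_map_snd_snd, derivedList_map_snd_snd]
      simp only [List.map_append, List.map_cons]
      rw [derivedSum_swap nrBracket_hSub _ _ _ _ hg, map_units_smul]
      rfl

/-- The 𝔥-component of the generalized Jacobi identity. Apply P to `splitSum_derivedSum` and expand
by `projH_nrBracket`: the two resulting sums agree by graded antisymmetry after exchanging the
sublists, and the common factor 2 cancels in characteristic 0. -/
theorem splitSum_projH {xs : List (ℤ × (CochainSum K (𝔤 × V) × CochainSum K (𝔤 × V)))}
    (hx : ∀ x ∈ xs, IsGood (hSub K 𝔤 V) x) :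
    splitSum (fun A B => projH K 𝔤 V (lop (projH K 𝔤 V (derivedSum A)) (derivedSum B) +
      rop B (bracketPair A))) xs = 0 := by
  simp only [map_add, splitSum_add, lop_apply, map_neg, splitSum_neg]
  rw [neg_add_eq_zero]
  have key : splitSum (fun A B => projH K 𝔤 V (nrBracket K (𝔤 × V)
        (par K (𝔤 × V) (projH K 𝔤 V (derivedSum A))) (derivedSum B))) xs +
      splitSum (fun A B => projH K 𝔤 V (nrBracket K (𝔤 × V)
        (par K (𝔤 × V) (projH K 𝔤 V (derivedSum A))) (derivedSum B))) xs =
      (2 : ℤ) • splitSum (fun A B => projH K 𝔤 V (rop B (bracketPair A))) xs := by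
    conv_lhs =>
      enter [2]
      rw [splitSum_swap]
    rw [splitSum_linearMap (projH K 𝔤 V) (fun A B => rop B (bracketPair A)), ← map_zsmul,
      ← splitSum_derivedSum nrBracket_hSub hx, ← splitSum_linearMap, ← splitSum_add]
    refine splitSum_congr fun A B hA hB _ _ => ?_
    have hA' := derivedSum_mem fun y hy => hx y (hA hy)
    have hB' := derivedSum_mem fun y hy => hx y (hB hy)
    rw [projH_nrBracket (par K (𝔤 × V) (derivedSum A)), projH_par]
    congr 1
    rw [par_of_mem (projH_apply_mem hB'), par_of_mem hA', nrBracket_units_smul_left,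
      nrBracket_units_smul_left, nrBracket_comm (projH_apply_mem hB') hA', map_units_smul,
      map_units_smul, map_neg, map_units_smul, smul_neg, smul_smul, smul_neg, smul_smul,
      ← Units.neg_smul, ← Int.negOnePow_add, ← Int.negOnePow_add, ← Int.negOnePow_succ]
    congr 1
    rw [Int.negOnePow_eq_iff]
    exact ⟨totalDeg A * totalDeg B + totalDeg B + 1, by ring⟩
  rw [← two_zsmul] at key
  rw [← Int.cast_smul_eq_zsmul K, ← Int.cast_smul_eq_zsmul K] at key
  exact smul_right_injective _ (by norm_num : ((2 : ℤ) : K) ≠ 0) key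

theorem derivedList_nil : derivedList ([] : List (Ctrl K 𝔤 V)) = 0 :=
  ctrl_ext rfl (map_zero (projH K 𝔤 V))

theorem derivedList_jacobi {xs : List (ℤ × Ctrl K 𝔤 V)}
    (hx : ∀ x ∈ xs, x.2 ∈ ctrlGrading K 𝔤 V x.1) :
    splitSum (fun A B => derivedList (derivedList (A.map Prod.snd) :: B.map Prod.snd)) xs = 0 := by
  have hg : ∀ z ∈ xs.map rawOf, IsGood (hSub K 𝔤 V) z := by
    intro z hz
    obtain ⟨v, hv, rfl⟩ := List.mem_map.1 hz
    exact isGood_rawOf (hx v hv)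
  -- The inner value gets the arbitrary degree 0, as the operations do not read degrees.
  have e : ∀ A B : List (ℤ × Ctrl K 𝔤 V), derivedList (A.map Prod.snd) :: B.map Prod.snd =
      (((0 : ℤ), derivedList (A.map Prod.snd)) :: B).map Prod.snd := fun _ _ => rfl
  refine ctrl_ext ?_ ?_
  · refine (splitSum_linearMap (N := Ctrl K 𝔤 V) (N' := CochainSum K (𝔤 × V))
      (ctrlFst K 𝔤 V) _ xs).symm.trans ?_
    have h0 := splitSum_bracketPair hg
    refine Eq.trans ?_ h0
    rw [← splitSum_map_list rawOf fun _ => rfl]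
    refine splitSum_congr fun A B _ _ _ _ => ?_
    rw [e]
    have h1 := derivedList_map_snd_fst (((0 : ℤ), derivedList (A.map Prod.snd)) :: B)
    refine h1.trans ?_
    rw [List.map_cons, bracketPair_cons]
    congr 1
    exact derivedList_map_snd_fst A
  · refine (splitSum_linearMap (N := Ctrl K 𝔤 V) (N' := CochainSum K (𝔤 × V))
      (ctrlSnd K 𝔤 V) _ xs).symm.trans ?_
    refine Eq.trans ?_ (splitSum_projH hg)
    rw [← splitSum_map_list rawOf fun _ => rfl]
    refine splitSum_congr fun A B _ _ _ _ => ?_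
    rw [e]
    have h1 := derivedList_map_snd_snd (((0 : ℤ), derivedList (A.map Prod.snd)) :: B)
    refine h1.trans ?_
    rw [List.map_cons, derivedSum_cons]
    congr 1
    rw [← derivedList_map_snd_fst A, ← derivedList_map_snd_snd A]
    rfl

theorem derivedBracket_jacobi {n : ℕ} {d : Fin n → ℤ} {x : Fin n → Ctrl K 𝔤 V}
    (h : ∀ i, x i ∈ ctrlGrading K 𝔤 V (d i)) :
    ∑ i ∈ (Finset.Icc 1 n).attach, ∑ σ ∈ shuffles i n, koszulSign σ d •
      derivedBracket K 𝔤 V (n - i + 1) (Fin.cons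
        (derivedBracket K 𝔤 V i fun a : Fin i =>
          x (σ (Fin.castLE (Finset.mem_Icc.1 i.2).2 a)))
        (fun b : Fin (n - i) => x (σ ⟨i + b, by omega⟩))) = 0 := by
  let G : List (ℤ × Ctrl K 𝔤 V) → List (ℤ × Ctrl K 𝔤 V) → Ctrl K 𝔤 V :=
    fun A B => derivedList (derivedList (A.map Prod.snd) :: B.map Prod.snd)
  let y : Fin n → ℤ × Ctrl K 𝔤 V := fun a => (d a, x a)
  have e1 : ∀ i : {i // i ∈ Finset.Icc 1 n}, ∀ σ : Equiv.Perm (Fin n),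
      derivedBracket K 𝔤 V (n - i + 1) (Fin.cons
        (derivedBracket K 𝔤 V i fun a : Fin i =>
          x (σ (Fin.castLE (Finset.mem_Icc.1 i.2).2 a)))
        (fun b : Fin (n - i) => x (σ ⟨i + b, by omega⟩))) =
      G ((List.ofFn fun a => y (σ a)).take i) ((List.ofFn fun a => y (σ a)).drop i) := by
    rintro ⟨i, hi⟩ σ
    have hi' := (Finset.mem_Icc.1 hi).2
    rw [derivedBracket_apply, derivedBracket_apply, List.ofFn_cons]
    simp only [G]
    congr 2
    · congr 1
      apply List.ext_getElem
      · simp; omega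
      · intro j h1 h2
        simp only [List.getElem_ofFn, List.getElem_map, List.getElem_take]
        rfl
    · apply List.ext_getElem
      · simp
      · intro j h1 h2
        simp only [List.getElem_ofFn, List.getElem_map, List.getElem_drop]
        rfl
  simp only [e1]
  rw [Finset.sum_attach (Finset.Icc 1 n) fun i => ∑ σ ∈ shuffles i n, koszulSign σ d •
    G ((List.ofFn fun a => y (σ a)).take i) ((List.ofFn fun a => y (σ a)).drop i)]
  have hJ := derivedList_jacobi (xs := List.ofFn y) fun z hz => by
    obtain ⟨i, rfl⟩ := (List.mem_ofFn' _ _).1 hz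
    exact h i
  rw [← sum_shuffles_eq_splitSum] at hJ
  rw [← hJ]
  -- The full sum over splittings also has the term with empty first sublist; it vanishes because
  -- the operation without arguments is 0.
  refine Finset.sum_subset (fun i hi => ?_) fun i hi hi' => ?_
  · simp only [Finset.mem_Icc, Finset.mem_range] at *; omega
  · have : i = 0 := by
      simp only [Finset.mem_Icc, Finset.mem_range] at *; omega
    subst this
    refine Finset.sum_eq_zero fun σ _ => ?_
    rw [List.take_zero, List.drop_zero]
    simp only [G, List.map_nil, derivedList_nil]
    rw [show ∀ B : List (Ctrl K 𝔤 V), derivedList (0 :: B) = 0 from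
      fun B => (derivedList_isLinearMap [] B).map_zero, smul_zero]

theorem isInternal_of_mem_iSup {E : Type*} [AddCommGroup E] [Module K E] (A : ℤ → Submodule K E)
    (h1 : ∀ i, ∀ x ∈ A i, x ∈ (⨆ j, ⨆ (_ : j ≠ i), A j) → x = 0) (h2 : ∀ x, x ∈ ⨆ i, A i) :
    DirectSum.IsInternal A := by
  refine (DirectSum.isInternal_submodule_iff_iSupIndep_and_iSup_eq_top A).2
    ⟨fun i => ?_, eq_top_iff.2 fun x _ => h2 x⟩
  rw [Submodule.disjoint_def]
  exact h1 i

theorem eq_zero_of_mem_ctrlGrading {i : ℤ} {x : Ctrl K 𝔤 V} (hx : x ∈ ctrlGrading K 𝔤 V i)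
    (hx' : x ∈ ⨆ j, ⨆ (_ : j ≠ i), ctrlGrading K 𝔤 V j) : x = 0 := by
  let N : Submodule K (Ctrl K 𝔤 V) :=
    { carrier := {x | ∀ n : ℕ, ((n : ℤ) = i + 1 → (x.1 : CochainSum K (𝔤 × V)) n = 0) ∧
        ((n : ℤ) = i → (x.2 : CochainSum K (𝔤 × V)) n = 0)}
      zero_mem' := fun n => by simp
      add_mem' := fun {x y} hx hy n => by
        refine ⟨fun h => ?_, fun h => ?_⟩
        · simp [(hx n).1 h, (hy n).1 h]
        · simp [(hx n).2 h, (hy n).2 h]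
      smul_mem' := fun c x hx n => by
        refine ⟨fun h => ?_, fun h => ?_⟩
        · change c • (x.1 : CochainSum K (𝔤 × V)) n = 0
          rw [(hx n).1 h, smul_zero]
        · change c • (x.2 : CochainSum K (𝔤 × V)) n = 0
          rw [(hx n).2 h, smul_zero] }
  have hN : (⨆ j, ⨆ (_ : j ≠ i), ctrlGrading K 𝔤 V j) ≤ N := by
    refine iSup_le fun j => iSup_le fun hj z hz n => ?_
    exact ⟨fun h => (hz n).1 (by omega), fun h => (hz n).2 (by omega)⟩
  have h := hN hx'
  refine ctrl_ext (DFinsupp.ext fun n => ?_) (DFinsupp.ext fun n => ?_)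
  · by_cases hn : (n : ℤ) = i + 1
    · exact (h n).1 hn
    · exact (hx n).1 hn
  · by_cases hn : (n : ℤ) = i
    · exact (h n).2 hn
    · exact (hx n).2 hn

theorem ctrl_induction {S : Submodule K (Ctrl K 𝔤 V)}
    (h1 : ∀ (n : ℕ) (Q : LPrime K 𝔤 V), (Q : CochainSum K (𝔤 × V)) ∈ homog K (𝔤 × V) n →
      ((Q, 0) : Ctrl K 𝔤 V) ∈ S)
    (h2 : ∀ (n : ℕ) (θ : hSub K 𝔤 V), (θ : CochainSum K (𝔤 × V)) ∈ homog K (𝔤 × V) n →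
      ((0, θ) : Ctrl K 𝔤 V) ∈ S) (x : Ctrl K 𝔤 V) : x ∈ S := by
  obtain ⟨⟨a, ha⟩, ⟨b, hb⟩⟩ := x
  have e1 : ∃ h : a ∈ LPrime K 𝔤 V, ((⟨a, h⟩, 0) : Ctrl K 𝔤 V) ∈ S := by
    refine graded_induction
      (p := fun a => ∃ h : a ∈ LPrime K 𝔤 V, ((⟨a, h⟩, 0) : Ctrl K 𝔤 V) ∈ S)
      (fun _ h => component_mem_LPrime h) ⟨Submodule.zero_mem _, Submodule.zero_mem _⟩ ?_ (fun n a ha hn => ⟨ha, h1 n ⟨a, ha⟩ hn⟩) ha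
    rintro a b ⟨ha, ha'⟩ ⟨hb, hb'⟩
    refine ⟨Submodule.add_mem _ ha hb, ?_⟩
    convert Submodule.add_mem _ ha' hb' using 1
    exact ctrl_ext rfl (add_zero _).symm
  have e2 : ∃ h : b ∈ hSub K 𝔤 V, ((0, ⟨b, h⟩) : Ctrl K 𝔤 V) ∈ S := by
    refine graded_induction
      (p := fun b => ∃ h : b ∈ hSub K 𝔤 V, ((0, ⟨b, h⟩) : Ctrl K 𝔤 V) ∈ S)
      (fun _ h => component_mem_hSub h) ⟨Submodule.zero_mem _, Submodule.zero_mem _⟩ ?_ (fun n a ha hn => ⟨ha, h2 n ⟨a, ha⟩ hn⟩) hb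
    rintro a b ⟨ha, ha'⟩ ⟨hb, hb'⟩
    refine ⟨Submodule.add_mem _ ha hb, ?_⟩
    convert Submodule.add_mem _ ha' hb' using 1
    exact ctrl_ext (add_zero _).symm rfl
  obtain ⟨_, e1⟩ := e1
  obtain ⟨_, e2⟩ := e2
  convert Submodule.add_mem _ e1 e2 using 1
  exact ctrl_ext (add_zero _).symm (zero_add _).symm

theorem fst_mem_ctrlGrading {n : ℕ} {Q : LPrime K 𝔤 V}
    (hQ : (Q : CochainSum K (𝔤 × V)) ∈ homog K (𝔤 × V) n) :
    ((Q, 0) : Ctrl K 𝔤 V) ∈ ctrlGrading K 𝔤 V ((n : ℤ) - 1) := by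
  rw [mem_ctrlGrading]
  exact ⟨by simpa using hQ, Submodule.zero_mem _⟩

theorem snd_mem_ctrlGrading {n : ℕ} {θ : hSub K 𝔤 V}
    (hθ : (θ : CochainSum K (𝔤 × V)) ∈ homog K (𝔤 × V) n) :
    ((0, θ) : Ctrl K 𝔤 V) ∈ ctrlGrading K 𝔤 V n := by
  rw [mem_ctrlGrading]
  exact ⟨Submodule.zero_mem _, hθ⟩

theorem ctrlGrading_isInternal : DirectSum.IsInternal (ctrlGrading K 𝔤 V) := by
  have := isInternal_of_mem_iSup (E := Ctrl K 𝔤 V) (ctrlGrading K 𝔤 V)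
    (fun i x => eq_zero_of_mem_ctrlGrading) (ctrl_induction
      (fun n Q hQ => Submodule.mem_iSup_of_mem _ (fst_mem_ctrlGrading hQ))
      fun n θ hθ => Submodule.mem_iSup_of_mem _ (snd_mem_ctrlGrading hθ))
  exact this

variable (K 𝔤 V) in
/-- The controlling `L∞`-algebra `s⁻¹L' ⊕ 𝔥`. -/
def ctrlLInfinity : LInfinityAlgebra (E := Ctrl K 𝔤 V) (ctrlGrading K 𝔤 V) where
  l := derivedBracket K 𝔤 V
  l_zero := by
    ext1 x
    rw [derivedBracket_apply, List.ofFn_zero, derivedList_nil]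
    rfl
  isInternal := ctrlGrading_isInternal
  degree_one _ _ _ h := derivedBracket_mem h
  graded_symm _ _ _ h σ := derivedBracket_symm h σ
  jacobi _ _ _ _ h := derivedBracket_jacobi h

theorem rop_ofFn {m : ℕ} (a : CochainSum K (𝔤 × V)) (θ : Fin m → hSub K 𝔤 V) :
    rop ((List.ofFn fun i => ((0, θ i) : Ctrl K 𝔤 V)).map raw) a =
      iterBracket a fun i => (θ i : CochainSum K (𝔤 × V)) := by
  induction m generalizing a with
  | zero => simp [iterBracket, rop]
  | succ m ih =>
    rw [List.ofFn_succ, List.map_cons, rop_cons, ih, iterBracket, iterBracket, Fin.foldl_succ]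
    rfl

theorem derivedBracket_isHigherDerivedBrackets :
    IsHigherDerivedBrackets (derivedBracket K 𝔤 V) where
  l_two_fst p Q Q' hQ := by
    have e : par K (𝔤 × V) (Q : CochainSum K (𝔤 × V)) = (-1 : K) ^ p • (Q : CochainSum K (𝔤 × V)) := by
      refine DFinsupp.ext fun n => ?_
      rw [par_apply]
      by_cases h : n = p
      · subst h; rfl
      · rw [hQ n h, smul_zero]
        exact (congrArg _ (hQ n h)).trans (smul_zero _) |>.symm
    change nrBracket K (𝔤 × V) (par K (𝔤 × V) Q) Q' = _
    rw [e, map_smul]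
    rfl
  l_two_snd Q Q' := by
    refine Subtype.ext ?_
    change projH K 𝔤 V (derivedSum [raw (Q, 0), raw (Q', 0)]) = 0
    rw [derivedSum_eq_zero_of_not_pairwise, map_zero]
    simp [raw, rawOf]
  l_mixed_fst m hm Q θ := by
    refine Subtype.ext ?_
    rw [derivedBracket_apply, List.ofFn_cons]
    obtain ⟨m, rfl⟩ := Nat.exists_eq_add_of_le' hm
    change bracketSingle (Q : CochainSum K (𝔤 × V)) _ = 0
    cases m with
    | zero => simp [bracketSingle, raw, rawOf]
    | succ m => simp [bracketSingle]
  l_mixed_snd m hm Q θ := by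
    rw [derivedBracket_apply, List.ofFn_cons]
    change projH K 𝔤 V (derivedSum (raw (Q, 0) :: _)) = _
    rw [derivedSum_cons, rop_ofFn]
    simp [raw, rawOf, lop]
  l_other k S x h1 h2 h3 h4 := by
    rw [derivedBracket_apply]
    refine ctrl_ext ?_ ?_
    · change bracketPair ((List.ofFn x).map raw) = 0
      by_cases hk : k = 2
      · subst hk
        have : ∃ i, i ∉ S := by
          by_contra hc
          push Not at hc
          exact h3 ⟨rfl, by rw [Finset.eq_univ_of_forall hc]; rfl⟩
        obtain ⟨i, hi⟩ := this
        have := h2 i hi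
        fin_cases i <;> simp at this <;> simp [bracketPair, bracketSingle, raw, rawOf, this]
      · match k with
        | 0 => simp [bracketPair]
        | 1 => simp [bracketPair, bracketSingle]
        | 2 => exact absurd rfl hk
        | k + 3 => simp [bracketPair, bracketSingle]
    · change projH K 𝔤 V (derivedSum ((List.ofFn x).map raw)) = 0
      rcases Nat.lt_trichotomy S.card 1 with hS | hS | hS
      · have : S = ∅ := by rw [← Finset.card_eq_zero]; omega
        subst this
        rw [derivedSum_eq_zero_of_fst, map_zero]
        intro z hz
        rw [List.map_ofFn] at hz
        obtain ⟨i, rfl⟩ := (List.mem_ofFn' _ _).1 hz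
        have := h2 i (by simp)
        simp [raw, rawOf, this]
      · have hk : k < 2 := by
          by_contra hc
          exact h4 ⟨by omega, hS⟩
        match k with
        | 0 => simp [derivedSum]
        | 1 =>
          simp only [List.ofFn_succ, List.ofFn_zero, List.map_cons, List.map_nil, derivedSum_cons]
          simp only [derivedSum, map_zero, zero_add]
          -- The unary operation would be s⁻¹Q ↦ PQ; it vanishes because L' has no component in 𝔥.
          exact projH_LPrime (x 0).1.2
      · rw [derivedSum_eq_zero_of_not_pairwise, map_zero]
        obtain ⟨i, hi, j, hj, hij⟩ := Finset.one_lt_card.1 hS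
        rw [List.map_ofFn, List.pairwise_ofFn]
        intro hc
        rcases lt_or_gt_of_ne hij with h | h
        · exact hc h ⟨by simp [raw, rawOf, h1 i hi], by simp [raw, rawOf, h1 j hj]⟩
        · exact hc h ⟨by simp [raw, rawOf, h1 j hj], by simp [raw, rawOf, h1 i hi]⟩

end Ctrl


/-! ### Uniqueness of the structure -/

section Uniqueness

theorem multilinearMap_ext_of_span {K E N : Type*} [Field K] [AddCommGroup E] [AddCommGroup N]
    [Module K E] [Module K N] {s : Set E} (hs : Submodule.span K s = ⊤) {k : ℕ}
    {f g : MultilinearMap K (fun _ : Fin k => E) N}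
    (h : ∀ x : Fin k → E, (∀ i, x i ∈ s) → f x = g x) : f = g := by
  have key : ∀ (T : Finset (Fin k)) (x : Fin k → E), (∀ i ∉ T, x i ∈ s) → f x = g x := by
    intro T
    induction T using Finset.induction_on with
    | empty => exact fun x hx => h x fun i => hx i (by simp)
    | insert i T hi ih =>
      intro x hx
      have hle : Submodule.span K s ≤ LinearMap.eqLocus (f.toLinearMap x i) (g.toLinearMap x i) := by
        rw [Submodule.span_le]
        intro z hz
        change f (Function.update x i z) = g (Function.update x i z)
        refine ih _ fun j hj => ?_
        by_cases hji : j = i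
        · subst hji
          rwa [Function.update_self]
        · rw [Function.update_of_ne hji]
          exact hx j (by simp [hji, hj])
      have h1 : x i ∈ LinearMap.eqLocus (f.toLinearMap x i) (g.toLinearMap x i) :=
        hle (hs ▸ Submodule.mem_top)
      have h2 : f (Function.update x i (x i)) = g (Function.update x i (x i)) := h1
      rwa [Function.update_eq_self] at h2
  ext x
  exact key Finset.univ x fun i hi => absurd (Finset.mem_univ i) hi

variable {K : Type*} [Field K] {𝔤 : Type w} {V : Type v} [AddCommGroup 𝔤] [Module K 𝔤]
  [AddCommGroup V] [Module K V] [CharZero K]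

variable (K 𝔤 V) in
/-- The homogeneous elements of `s⁻¹L'` and of `𝔥`. -/
def pureSet : Set (Ctrl K 𝔤 V) :=
  {x | ∃ n : ℕ, (∃ Q : LPrime K 𝔤 V, (Q : CochainSum K (𝔤 × V)) ∈ homog K (𝔤 × V) n ∧ x = (Q, 0)) ∨
    ∃ θ : hSub K 𝔤 V, (θ : CochainSum K (𝔤 × V)) ∈ homog K (𝔤 × V) n ∧ x = (0, θ)}

theorem span_pureSet : Submodule.span K (pureSet K 𝔤 V) = ⊤ :=
  eq_top_iff.2 fun x _ => ctrl_induction (S := Submodule.span K (pureSet K 𝔤 V))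
    (fun n Q hQ => Submodule.subset_span ⟨n, Or.inl ⟨Q, hQ, rfl⟩⟩)
    (fun n θ hθ => Submodule.subset_span ⟨n, Or.inr ⟨θ, hθ, rfl⟩⟩) x

/-- Homogeneous elements of s⁻¹L' and of 𝔥 span, and on such arguments each operation is prescribed,
zero, or prescribed after a permutation, whose sign is forced by graded symmetry. -/
theorem IsHigherDerivedBrackets.ext {A B : LInfinityAlgebra (E := Ctrl K 𝔤 V) (ctrlGrading K 𝔤 V)}
    (hA : IsHigherDerivedBrackets A.l) (hB : IsHigherDerivedBrackets B.l) : A = B := by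
  refine LInfinityAlgebra.ext (funext fun k => ?_)
  refine multilinearMap_ext_of_span (E := Ctrl K 𝔤 V) (N := Ctrl K 𝔤 V) span_pureSet fun x hx => ?_
  choose n hn using hx
  classical
  let S : Finset (Fin k) := Finset.univ.filter fun i => (x i).2 = 0
  have h1 : ∀ i ∈ S, (x i).2 = 0 := fun i hi => (Finset.mem_filter.1 hi).2
  have h2 : ∀ i ∉ S, (x i).1 = 0 := fun i hi => by
    rcases hn i with ⟨Q, -, hQ⟩ | ⟨θ, -, hθ⟩
    · exact absurd (by simp [S, hQ]) hi
    · rw [hθ]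
  have hd : ∃ d : Fin k → ℤ, ∀ i, x i ∈ ctrlGrading K 𝔤 V (d i) := by
    have : ∀ i, ∃ d : ℤ, x i ∈ ctrlGrading K 𝔤 V d := fun i => by
      rcases hn i with ⟨Q, hQ, h⟩ | ⟨θ, hθ, h⟩
      · exact ⟨_, h ▸ fst_mem_ctrlGrading hQ⟩
      · exact ⟨_, h ▸ snd_mem_ctrlGrading hθ⟩
    choose d hd using this
    exact ⟨d, hd⟩
  obtain ⟨d, hd⟩ := hd
  by_cases c1 : k = 2 ∧ S.card = 2
  · obtain ⟨rfl, hc⟩ := c1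
    have hS : S = Finset.univ := Finset.eq_univ_of_card _ (by simpa using hc)
    have e : x = ![((x 0).1, 0), ((x 1).1, 0)] := by
      funext i
      have := h1 i (by simp [hS])
      fin_cases i
      · exact Prod.ext rfl this
      · exact Prod.ext rfl this
    have hQ : ∃ p : ℕ, IsHomogeneousOfDegree p ((x 0).1 : CochainSum K (𝔤 × V)) := by
      rcases hn 0 with ⟨Q, hQ, h⟩ | ⟨θ, hθ, h⟩
      · refine ⟨n 0, fun m hm => ?_⟩
        rw [h]
        exact hQ m (by exact_mod_cast hm)
      · exact ⟨0, fun m hm => by rw [h]; rfl⟩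
    obtain ⟨p, hp⟩ := hQ
    rw [e]
    refine ctrl_ext ?_ ?_
    · rw [hA.l_two_fst p _ _ hp, hB.l_two_fst p _ _ hp]
    · rw [hA.l_two_snd, hB.l_two_snd]
  by_cases c2 : 2 ≤ k ∧ S.card = 1
  · obtain ⟨hk, hc⟩ := c2
    obtain ⟨m, rfl⟩ := Nat.exists_eq_add_of_le' (show 1 ≤ k by omega)
    obtain ⟨j, hj⟩ := Finset.card_eq_one.1 hc
    -- Moves the only argument from s⁻¹L' to the front, where the prescribed formula applies.
    let σ : Equiv.Perm (Fin (m + 1)) := Equiv.swap 0 j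
    have e : (fun i => x (σ i)) =
        Fin.cons ((x j).1, 0) fun i : Fin m => (0, (x (σ i.succ)).2) := by
      funext i
      cases i using Fin.cases with
      | zero =>
        simp only [σ, Equiv.swap_apply_left, Fin.cons_zero]
        exact Prod.ext rfl (h1 j (by simp [hj]))
      | succ i =>
        rw [Fin.cons_succ]
        refine Prod.ext (h2 _ ?_) rfl
        rw [hj, Finset.mem_singleton]
        intro h
        have : σ i.succ = σ 0 := by rw [h]; simp [σ]
        exact Fin.succ_ne_zero i (σ.injective this)
    have h3 : A.l (m + 1) (fun i => x (σ i)) = B.l (m + 1) fun i => x (σ i) := by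
      rw [e]
      refine Prod.ext ?_ (Subtype.ext ?_)
      · rw [hA.l_mixed_fst m (by omega), hB.l_mixed_fst m (by omega)]
      · rw [hA.l_mixed_snd m (by omega), hB.l_mixed_snd m (by omega)]
    rw [A.graded_symm _ d x hd, B.graded_symm _ d x hd] at h3
    rcases Int.units_eq_one_or (koszulSign σ d) with h | h <;> rw [h] at h3
    · simpa using h3
    · rw [Units.neg_smul, Units.neg_smul, one_smul, one_smul] at h3
      exact neg_injective h3
  rw [hA.l_other k S x h1 h2 c1 c2, hB.l_other k S x h1 h2 c1 c2]

theorem IsHigherDerivedBrackets.eq_ctrlLInfinity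
    {A : LInfinityAlgebra (E := Ctrl K 𝔤 V) (ctrlGrading K 𝔤 V)}
    (hA : IsHigherDerivedBrackets A.l) : A = ctrlLInfinity K 𝔤 V :=
  hA.ext derivedBracket_isHigherDerivedBrackets

end Uniqueness


/-! ### The iterated bracket spaces -/

section DerivedSpace

variable {K : Type*} [Field K] [CharZero K]

/-- The operator `a ↦ [⋯[a, θ_1], ⋯, θ_m]`. -/
def foldBr {M : Type*} [AddCommGroup M] [Module K M] :
    List (CochainSum K M) → CochainSum K M →ₗ[K] CochainSum K M
  | [] => LinearMap.id
  | θ :: θs => foldBr θs ∘ₗ (nrBracket K M).flip θ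

section

variable {M : Type*} [AddCommGroup M] [Module K M]

theorem foldBr_nil (a : CochainSum K M) : foldBr [] a = a := rfl

theorem foldBr_cons (θ : CochainSum K M) (θs) (a : CochainSum K M) :
    foldBr (θ :: θs) a = foldBr θs (nrBracket K M a θ) := rfl

theorem foldBr_append_singleton (θs) (θ a : CochainSum K M) :
    foldBr (θs ++ [θ]) a = nrBracket K M (foldBr θs a) θ := by
  induction θs generalizing a with
  | nil => rfl
  | cons θ' θs ih => exact ih _

end

variable {𝔤 : Type w} {V : Type v} [AddCommGroup 𝔤] [Module K 𝔤] [AddCommGroup V] [Module K V]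

variable (K 𝔤 V) in
/-- The iterated bracket spaces `[⋯[L', 𝔥], ⋯, 𝔥]` with `m` brackets. -/
def derivedSpace : ℕ → Submodule K (CochainSum K (𝔤 × V))
  | 0 => LPrime K 𝔤 V
  | m + 1 => Submodule.map₂ (nrBracket K (𝔤 × V)) (derivedSpace m) (hSub K 𝔤 V)

/-- As 𝔥 is abelian, its contribution disappears after the first bracket and only that of L'
remains. -/
theorem iterSpace_succ (m : ℕ) : iterSpace K 𝔤 V (m + 1) = derivedSpace K 𝔤 V (m + 1) := by
  induction m with
  | zero =>
    rw [iterSpace, iterSpace, Submodule.map₂_sup_left, derivedSpace, derivedSpace]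
    refine sup_eq_left.2 (le_trans ?_ bot_le)
    refine Submodule.map₂_le.2 fun a ha b hb => ?_
    rw [nrBracket_hSub a ha b hb]
    exact Submodule.zero_mem _
  | succ m ih =>
    rw [iterSpace, ih]
    rfl

theorem derivedSpace_eq_span {A B : Set (CochainSum K (𝔤 × V))}
    (hA : Submodule.span K A = LPrime K 𝔤 V) (hB : Submodule.span K B = hSub K 𝔤 V) (m : ℕ) :
    derivedSpace K 𝔤 V m = Submodule.span K {x | ∃ Q ∈ A, ∃ θs : List (CochainSum K (𝔤 × V)),
      θs.length = m ∧ (∀ θ ∈ θs, θ ∈ B) ∧ foldBr θs Q = x} := by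
  induction m with
  | zero =>
    rw [derivedSpace, ← hA]
    congr 1
    ext x
    constructor
    · exact fun hx => ⟨x, hx, [], rfl, by simp, rfl⟩
    · rintro ⟨Q, hQ, θs, hl, -, rfl⟩
      rw [List.length_eq_zero_iff] at hl
      subst hl
      exact hQ
  | succ m ih =>
    rw [derivedSpace, ih, ← hB, Submodule.map₂_span_span]
    congr 1
    ext x
    constructor
    · rintro ⟨_, ⟨Q, hQ, θs, hl, hθ, rfl⟩, θ, hθ', rfl⟩
      refine ⟨Q, hQ, θs ++ [θ], by simp [hl], ?_, foldBr_append_singleton _ _ _⟩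
      intro z hz
      rcases List.mem_append.1 hz with hz | hz
      · exact hθ z hz
      · rw [List.mem_singleton.1 hz]; exact hθ'
    · rintro ⟨Q, hQ, θs, hl, hθ, rfl⟩
      rcases List.eq_nil_or_concat θs with rfl | ⟨τ, θ, rfl⟩
      · simp at hl
      · simp only [List.concat_eq_append] at *
        refine ⟨_, ⟨Q, hQ, τ, by simpa using hl, fun z hz => hθ z (by simp [hz]), rfl⟩, θ,
          hθ θ (by simp), (foldBr_append_singleton _ _ _).symm⟩

variable (K 𝔤 V) in
/-- The homogeneous elements of `L'`. -/
def homogLPrime : Set (CochainSum K (𝔤 × V)) :=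
  {Q | Q ∈ LPrime K 𝔤 V ∧ ∃ n : ℕ, Q ∈ homog K (𝔤 × V) n}

variable (K 𝔤 V) in
/-- The homogeneous elements of `𝔥`. -/
def homogH : Set (CochainSum K (𝔤 × V)) :=
  {θ | θ ∈ hSub K 𝔤 V ∧ ∃ n : ℕ, θ ∈ homog K (𝔤 × V) n}

theorem span_homogLPrime : Submodule.span K (homogLPrime K 𝔤 V) = LPrime K 𝔤 V := by
  refine le_antisymm (Submodule.span_le.2 fun _ h => h.1) fun a ha => ?_
  exact graded_induction (p := fun a => a ∈ Submodule.span K (homogLPrime K 𝔤 V))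
    (fun _ h => component_mem_LPrime h) (Submodule.zero_mem _)
    (fun _ _ => Submodule.add_mem _) (fun n a ha hn => Submodule.subset_span ⟨ha, n, hn⟩) ha

theorem span_homogH : Submodule.span K (homogH K 𝔤 V) = hSub K 𝔤 V := by
  refine le_antisymm (Submodule.span_le.2 fun _ h => h.1) fun a ha => ?_
  exact graded_induction (p := fun a => a ∈ Submodule.span K (homogH K 𝔤 V))
    (fun _ h => component_mem_hSub h) (Submodule.zero_mem _)
    (fun _ _ => Submodule.add_mem _) (fun n a ha hn => Submodule.subset_span ⟨ha, n, hn⟩) ha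

/-- `t` is the total degree of the θ's: each θ of degree n raises the degree by n and the weight by
n + 1. Weight minus degree therefore grows by the number of brackets, whatever the degrees are. -/
theorem foldBr_mem {θs : List (CochainSum K (𝔤 × V))} (hθ : ∀ θ ∈ θs, θ ∈ homogH K 𝔤 V) :
    ∃ t : ℕ, ∀ {d : ℤ} {w : ℕ} {a : CochainSum K (𝔤 × V)}, a ∈ homog K (𝔤 × V) d →
      a ∈ weight K 𝔤 V w → foldBr θs a ∈ homog K (𝔤 × V) (d + t) ∧
        foldBr θs a ∈ weight K 𝔤 V (w + t + θs.length) := by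
  induction θs with
  | nil => exact ⟨0, fun hd hw => ⟨by simpa [foldBr_nil] using hd, by simpa [foldBr_nil] using hw⟩⟩
  | cons θ θs ih =>
    obtain ⟨t, ht⟩ := ih fun z hz => hθ z (by simp [hz])
    obtain ⟨h, n, hn⟩ := hθ θ (by simp)
    refine ⟨n + t, fun hd hw => ?_⟩
    obtain ⟨h1, h2⟩ := ht (nrBracket_mem hd hn) (nrBracket_mem_weight hw (hSub_mem_weight h hn))
    rw [foldBr_cons]
    constructor
    · rwa [Nat.cast_add, ← add_assoc]
    · rw [List.length_cons]
      convert h2 using 2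
      ring

theorem projH_foldBr_mem {q : ℕ} {Q : CochainSum K (𝔤 × V)} (hQ : Q ∈ LPrime K 𝔤 V)
    (hq : Q ∈ homog K (𝔤 × V) q) {θs : List (CochainSum K (𝔤 × V))}
    (hθ : ∀ θ ∈ θs, θ ∈ homogH K 𝔤 V) :
    ∃ t : ℕ, projH K 𝔤 V (foldBr θs Q) ∈ homog K (𝔤 × V) ((q + t : ℕ) : ℤ) := by
  obtain ⟨t, ht⟩ := foldBr_mem hθ
  exact ⟨t, projH_apply_mem (by exact_mod_cast (ht hq (mem_LPrime_iff.1 hQ)).1)⟩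

/-- P keeps only weight = degree + 1. Starting from weight 0 and degree `q`, exactly `q + 1`
brackets are needed to reach this. -/
theorem projH_foldBr_eq_zero {q : ℕ} {Q : CochainSum K (𝔤 × V)} (hQ : Q ∈ LPrime K 𝔤 V)
    (hq : Q ∈ homog K (𝔤 × V) q) {θs : List (CochainSum K (𝔤 × V))}
    (hθ : ∀ θ ∈ θs, θ ∈ homogH K 𝔤 V) (h : q + 1 ≠ θs.length) :
    projH K 𝔤 V (foldBr θs Q) = 0 := by
  obtain ⟨t, ht⟩ := foldBr_mem hθ
  obtain ⟨h1, h2⟩ := ht hq (mem_LPrime_iff.1 hQ)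
  exact projH_eq_zero_of_mem_homog h2 h1 (by push_cast; omega)

theorem map_projH_derivedSpace_le {m : ℕ} {N : Submodule K (CochainSum K (𝔤 × V))}
    (h : ∀ Q ∈ homogLPrime K 𝔤 V, ∀ θs : List (CochainSum K (𝔤 × V)), θs.length = m →
      (∀ θ ∈ θs, θ ∈ homogH K 𝔤 V) → projH K 𝔤 V (foldBr θs Q) ∈ N) :
    (derivedSpace K 𝔤 V m).map (projH K 𝔤 V) ≤ N := by
  rw [derivedSpace_eq_span span_homogLPrime span_homogH, Submodule.map_span, Submodule.span_le]
  rintro _ ⟨_, ⟨Q, hQ, θs, hl, hθ, rfl⟩, rfl⟩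
  exact h Q hQ θs hl hθ

theorem foldBr_mem_derivedSpace {Q : CochainSum K (𝔤 × V)} (hQ : Q ∈ LPrime K 𝔤 V)
    {θs : List (CochainSum K (𝔤 × V))} (hθ : ∀ θ ∈ θs, θ ∈ hSub K 𝔤 V) :
    foldBr θs Q ∈ derivedSpace K 𝔤 V θs.length := by
  rw [derivedSpace_eq_span (A := LPrime K 𝔤 V) (B := hSub K 𝔤 V) (by simp) (by simp)]
  exact Submodule.subset_span ⟨Q, hQ, θs, rfl, hθ, rfl⟩

/-- Only `Q` of degree m - 1 contributes after m brackets, and bracketing with 𝔥 does not lower the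
degree. This is the reason for completeness: in a fixed degree the filtration is eventually zero. -/
theorem apply_eq_zero_of_mem_derivedSpace {m n : ℕ} (h : n + 1 < m) {θ : CochainSum K (𝔤 × V)}
    (hθ : θ ∈ (derivedSpace K 𝔤 V m).map (projH K 𝔤 V)) : θ n = 0 := by
  have hle : (derivedSpace K 𝔤 V m).map (projH K 𝔤 V) ≤
      LinearMap.ker (DirectSum.component K ℕ (Cochain K (𝔤 × V)) n) := by
    refine map_projH_derivedSpace_le fun Q hQ θs hl hθ => ?_
    obtain ⟨hQ, q, hq⟩ := hQ
    rw [LinearMap.mem_ker]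
    by_cases hql : q + 1 = θs.length
    · obtain ⟨t, ht⟩ := projH_foldBr_mem hQ hq hθ
      exact ht n (by push_cast; omega)
    · rw [projH_foldBr_eq_zero hQ hq hθ hql, map_zero]
  exact hle hθ

theorem nrBracket_mem_derivedSpace {m : ℕ} {θ a : CochainSum K (𝔤 × V)} (hθ : θ ∈ hSub K 𝔤 V)
    (ha : a ∈ derivedSpace K 𝔤 V m) : nrBracket K (𝔤 × V) θ a ∈ derivedSpace K 𝔤 V (m + 1) := by
  refine graded_induction (p := fun θ => nrBracket K (𝔤 × V) θ a ∈ derivedSpace K 𝔤 V (m + 1))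
    (fun _ h => component_mem_hSub h) (by simp)
    (fun a a' h h' => by simpa using Submodule.add_mem _ h h') (fun t θ hθ ht => ?_) hθ
  have hle : derivedSpace K 𝔤 V m ≤
      (derivedSpace K 𝔤 V (m + 1)).comap (nrBracket K (𝔤 × V) θ) := by
    nth_rw 1 [derivedSpace_eq_span span_homogLPrime span_homogH]
    rw [Submodule.span_le]
    rintro _ ⟨Q, ⟨hQ, q, hq⟩, θs, hl, hθs, rfl⟩
    obtain ⟨s, hs⟩ := foldBr_mem hθs
    obtain ⟨h1, -⟩ := hs hq (mem_LPrime_iff.1 hQ)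
    rw [SetLike.mem_coe, Submodule.mem_comap, nrBracket_comm ht h1, Units.smul_def]
    refine Submodule.neg_mem _ (zsmul_mem ?_ _)
    rw [derivedSpace]
    refine Submodule.apply_mem_map₂ _ ?_ hθ
    rw [← hl]
    exact foldBr_mem_derivedSpace hQ fun z hz => (hθs z hz).1
  exact hle ha

theorem rop_mem_derivedSpace (xs : List (Ctrl K 𝔤 V)) {m : ℕ} {a : CochainSum K (𝔤 × V)}
    (ha : a ∈ derivedSpace K 𝔤 V m) :
    rop (xs.map raw) a ∈ derivedSpace K 𝔤 V (m + xs.length) := by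
  induction xs generalizing a m with
  | nil => exact ha
  | cons x xs ih =>
    rw [List.map_cons, rop_cons, List.length_cons, add_comm xs.length, ← add_assoc]
    exact ih (Submodule.apply_mem_map₂ _ ha x.2.2)

theorem par_mem_hSub {a : CochainSum K (𝔤 × V)} (ha : a ∈ hSub K 𝔤 V) :
    par K (𝔤 × V) a ∈ hSub K 𝔤 V := by
  rw [mem_hSub_iff] at *
  rw [projH_par, ha]

theorem derivedSum_mem_derivedSpace (x : Ctrl K 𝔤 V) (xs : List (Ctrl K 𝔤 V)) :
    derivedSum ((x :: xs).map raw) ∈ derivedSpace K 𝔤 V xs.length := by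
  induction xs generalizing x with
  | nil =>
    simp only [List.map_cons, List.map_nil, derivedSum_cons, derivedSum, map_zero, zero_add]
    exact x.1.2
  | cons y ys ih =>
    rw [List.map_cons, derivedSum_cons]
    refine Submodule.add_mem _ (Submodule.neg_mem _ ?_) ?_
    · exact nrBracket_mem_derivedSpace (par_mem_hSub x.2.2) (ih y)
    · have := rop_mem_derivedSpace (y :: ys) (m := 0) x.1.2
      rwa [zero_add] at this

/-! ### The filtration -/

theorem mem_ctrlFiltration {k : ℕ} (hk : 2 ≤ k) {x : Ctrl K 𝔤 V} :
    x ∈ ctrlFiltration K 𝔤 V k ↔ x.1 = 0 ∧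
      (x.2 : CochainSum K (𝔤 × V)) ∈ (derivedSpace K 𝔤 V (k - 1)).map (projH K 𝔤 V) := by
  obtain ⟨k, rfl⟩ := Nat.exists_eq_add_of_le' hk
  change x ∈ Submodule.prod _ _ ↔ _
  rw [Submodule.mem_prod, Submodule.mem_bot, Submodule.mem_comap, iterSpace_succ]
  rfl

theorem eq_zero_of_mem_ctrlFiltration {k : ℕ} {i : ℤ} (hk : 2 ≤ k) (h : i + 2 < k)
    {x : Ctrl K 𝔤 V} (hx : x ∈ ctrlFiltration K 𝔤 V k) (hi : x ∈ ctrlGrading K 𝔤 V i) : x = 0 := by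
  rw [mem_ctrlFiltration hk] at hx
  refine ctrl_ext (congrArg Subtype.val hx.1) (DFinsupp.ext fun n => ?_)
  by_cases hn : (n : ℤ) = i
  · exact apply_eq_zero_of_mem_derivedSpace (by omega) hx.2
  · exact (hi n).2 hn

theorem ctrlFiltration_graded {k : ℕ} (hk : 1 ≤ k) :
    ctrlFiltration K 𝔤 V k = ⨆ i, ctrlFiltration K 𝔤 V k ⊓ ctrlGrading K 𝔤 V i := by
  refine le_antisymm (fun x hx => ?_) (iSup_le fun i => inf_le_left)
  rcases hk.lt_or_eq with hk | rfl
  · have hk' : 2 ≤ k := hk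
    have hle : (derivedSpace K 𝔤 V (k - 1)).map (projH K 𝔤 V) ≤
        (Submodule.comap (LinearMap.inr K (LPrime K 𝔤 V) (hSub K 𝔤 V))
          (⨆ i, ctrlFiltration K 𝔤 V k ⊓ ctrlGrading K 𝔤 V i)).map (hSub K 𝔤 V).subtype := by
      refine map_projH_derivedSpace_le fun Q hQ θs hl hθ => ?_
      obtain ⟨hQ, q, hq⟩ := hQ
      obtain ⟨t, ht⟩ := projH_foldBr_mem hQ hq hθ
      refine ⟨⟨_, projH_mem (foldBr θs Q)⟩, ?_, rfl⟩
      rw [SetLike.mem_coe, Submodule.mem_comap]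
      refine Submodule.mem_iSup_of_mem ((q + t : ℕ) : ℤ) (Submodule.mem_inf.2 ⟨?_, ?_⟩)
      · rw [mem_ctrlFiltration hk']
        refine ⟨rfl, Submodule.mem_map_of_mem ?_⟩
        rw [← hl]
        exact foldBr_mem_derivedSpace hQ fun z hz => (hθ z hz).1
      · exact snd_mem_ctrlGrading (θ := ⟨_, projH_mem (foldBr θs Q)⟩) ht
    obtain ⟨h1, h2⟩ := (mem_ctrlFiltration hk').1 hx
    obtain ⟨θ, hθ, hθ'⟩ := hle h2
    have e : x = LinearMap.inr K (LPrime K 𝔤 V) (hSub K 𝔤 V) θ :=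
      Prod.ext h1 (Subtype.ext hθ'.symm)
    rw [e]
    exact hθ
  · have : ∀ i, ctrlFiltration K 𝔤 V 1 ⊓ ctrlGrading K 𝔤 V i = ctrlGrading K 𝔤 V i :=
      fun i => top_inf_eq _
    simp only [this]
    exact ctrl_induction (S := ⨆ i, ctrlGrading K 𝔤 V i)
      (fun n Q hQ => Submodule.mem_iSup_of_mem _ (fst_mem_ctrlGrading hQ))
      (fun n θ hθ => Submodule.mem_iSup_of_mem _ (snd_mem_ctrlGrading hθ)) x

theorem derivedBracket_mem_ctrlFiltration {k : ℕ} (hk : 3 ≤ k) (x : Fin k → Ctrl K 𝔤 V) :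
    derivedBracket K 𝔤 V k x ∈ ctrlFiltration K 𝔤 V k := by
  rw [mem_ctrlFiltration (by omega), derivedBracket_apply]
  obtain ⟨k, rfl⟩ := Nat.exists_eq_add_of_le' hk
  rw [List.ofFn_succ]
  refine ⟨Subtype.ext ?_, Submodule.mem_map_of_mem ?_⟩
  · rw [List.ofFn_succ, List.ofFn_succ]
    rfl
  · convert derivedSum_mem_derivedSpace _ _ using 1
    simp

theorem exists_limit_of_eventually_zero {E : Type*} [AddCommGroup E] [Module K E]
    {F : ℕ → Submodule K E} {A : Submodule K E} (hdesc : ∀ k, 1 ≤ k → F (k + 1) ≤ F k) {N : ℕ}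
    (hN : 1 ≤ N) (h0 : ∀ x ∈ F N, x ∈ A → x = 0) (a : ℕ → E) (ha : ∀ k, a k ∈ A)
    (h : ∀ k, 1 ≤ k → a (k + 1) - a k ∈ F k) : ∃ b ∈ A, ∀ k, 1 ≤ k → b - a k ∈ F k := by
  have hanti : ∀ k j, 1 ≤ k → F (k + j) ≤ F k := by
    intro k j hk
    induction j with
    | zero => exact le_refl _
    | succ j ih => exact (hdesc (k + j) (by omega)).trans ih
  have hsub : ∀ k j, 1 ≤ k → a (k + j) - a k ∈ F k := by
    intro k j hk
    induction j with
    | zero => simp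
    | succ j ih =>
      have := Submodule.add_mem _ (hanti k j hk (h (k + j) (by omega))) ih
      rwa [sub_add_sub_cancel] at this
  -- Since `F N` meets `A` only in 0, the sequence is constant from `N` on, and this constant is the
  -- limit.
  refine ⟨a N, ha N, fun k hk => ?_⟩
  rcases le_total k N with hkN | hkN
  · obtain ⟨j, rfl⟩ := Nat.exists_eq_add_of_le hkN
    exact hsub k j hk
  · obtain ⟨j, rfl⟩ := Nat.exists_eq_add_of_le hkN
    rw [← neg_sub, h0 _ (hsub N j hN) (Submodule.sub_mem _ (ha _) (ha _)), neg_zero]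
    exact Submodule.zero_mem _

theorem isWeaklyFiltered_of_eventually_zero {E : Type*} [AddCommGroup E] [Module K E]
    {𝒜 : ℤ → Submodule K E} (A : LInfinityAlgebra 𝒜) (F : ℕ → Submodule K E) {n : ℕ} (hn : 1 ≤ n)
    (first : F 1 = ⊤) (hdesc : ∀ k, 1 ≤ k → F (k + 1) ≤ F k)
    (graded : ∀ k, 1 ≤ k → F k = ⨆ i, F k ⊓ 𝒜 i)
    (l_mem : ∀ k, n ≤ k → ∀ x : Fin k → E, A.l k x ∈ F k)
    (N : ℤ → ℕ) (hN : ∀ i, 1 ≤ N i) (h0 : ∀ i, ∀ x ∈ F (N i), x ∈ 𝒜 i → x = 0) :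
    IsWeaklyFiltered A F n where
  one_le := hn
  first := first
  descending := hdesc
  graded := graded
  l_mem := l_mem
  complete_injective i a ha h := h0 i a (h _ (hN i)) ha
  complete_surjective i a ha h := exists_limit_of_eventually_zero hdesc (hN i) (h0 i) a ha h

theorem ctrlFiltration_isWeaklyFiltered
    (hdesc : ∀ k, 1 ≤ k → ctrlFiltration K 𝔤 V (k + 1) ≤ ctrlFiltration K 𝔤 V k) :
    IsWeaklyFiltered (ctrlLInfinity K 𝔤 V) (ctrlFiltration K 𝔤 V) 3 := by
  -- Any index that is at least 2 and exceeds `i + 2` would do, since F_k lives in degrees ≥ k - 2.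
  have h0 : ∀ i : ℤ, ∀ x ∈ ctrlFiltration K 𝔤 V ((i + 3).toNat + 2), x ∈ ctrlGrading K 𝔤 V i →
      x = 0 := fun i x hx hi => eq_zero_of_mem_ctrlFiltration (by omega) (by omega) hx hi
  have hg : ∀ k, 1 ≤ k → ctrlFiltration K 𝔤 V k =
      ⨆ i, ctrlFiltration K 𝔤 V k ⊓ ctrlGrading K 𝔤 V i := fun k hk => ctrlFiltration_graded hk
  have hl : ∀ k, 3 ≤ k → ∀ x : Fin k → Ctrl K 𝔤 V,
      (ctrlLInfinity K 𝔤 V).l k x ∈ ctrlFiltration K 𝔤 V k :=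
    fun k hk x => derivedBracket_mem_ctrlFiltration hk x
  have := isWeaklyFiltered_of_eventually_zero (E := Ctrl K 𝔤 V) (𝒜 := ctrlGrading K 𝔤 V)
    (ctrlLInfinity K 𝔤 V) (ctrlFiltration K 𝔤 V) (n := 3) (by norm_num) rfl hdesc hg hl
    (fun i => (i + 3).toNat + 2) (fun i => by omega) h0
  exact this

end DerivedSpace


/-! ### Averaging over pairs of inserted elements -/

section Averaging

variable {K : Type*} [Field K] [CharZero K] {𝔤 : Type w} {V : Type v} [AddCommGroup 𝔤] [Module K 𝔤]
  [AddCommGroup V] [Module K V]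

/-! Specializations to `𝔤 ⊕ V`: restating them fixes the instances on `C^*(𝔤 ⊕ V, 𝔤 ⊕ V)`. -/

theorem nrBracket_prod_eq {d e : ℤ} {a b : CochainSum K (𝔤 × V)} (ha : a ∈ homog K (𝔤 × V) d)
    (hb : b ∈ homog K (𝔤 × V) e) :
    nrBracket K (𝔤 × V) a b =
      circL K (𝔤 × V) a b - (d * e).negOnePow • circL K (𝔤 × V) b a := nrBracket_eq ha hb

theorem nrBracket_prod_mem {d e : ℤ} {a b : CochainSum K (𝔤 × V)} (ha : a ∈ homog K (𝔤 × V) d)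
    (hb : b ∈ homog K (𝔤 × V) e) : nrBracket K (𝔤 × V) a b ∈ homog K (𝔤 × V) (d + e) :=
  nrBracket_mem ha hb

theorem circL_prod_mem {d e : ℤ} {a b : CochainSum K (𝔤 × V)} (ha : a ∈ homog K (𝔤 × V) d)
    (hb : b ∈ homog K (𝔤 × V) e) : circL K (𝔤 × V) a b ∈ homog K (𝔤 × V) (d + e) :=
  circL_mem ha hb

theorem circL_prod_preLie (a : CochainSum K (𝔤 × V)) {e f : ℤ} {b c : CochainSum K (𝔤 × V)}
    (hb : b ∈ homog K (𝔤 × V) e) (hc : c ∈ homog K (𝔤 × V) f) :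
    circL K (𝔤 × V) (circL K (𝔤 × V) a b) c - circL K (𝔤 × V) a (circL K (𝔤 × V) b c) =
      (e * f).negOnePow • (circL K (𝔤 × V) (circL K (𝔤 × V) a c) b -
        circL K (𝔤 × V) a (circL K (𝔤 × V) c b)) := circL_preLie a hb hc

theorem foldBr_prod_cons (θ : CochainSum K (𝔤 × V)) (θs) (a : CochainSum K (𝔤 × V)) :
    foldBr (θ :: θs) a = foldBr θs (nrBracket K (𝔤 × V) a θ) := rfl

theorem hat_prod_circL (a b : CochainSum K (𝔤 × V)) :
    hat (circL K (𝔤 × V) a b) = circ (hat a) (hat b) := hat_circL a b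

theorem projH_eq_zero_of_fst {f : CochainSum K (𝔤 × V)} (hf : ∀ xs, (hat f xs).1 = 0) :
    projH K 𝔤 V f = 0 := by
  apply hat_injective
  funext xs
  rw [hat_projH, projG_apply, hf, hat_zero]
  rfl

theorem fst_hat_circL {f : CochainSum K (𝔤 × V)} (hf : ∀ xs, (hat f xs).1 = 0)
    (θ : CochainSum K (𝔤 × V)) (xs : List (𝔤 × V)) : (hat (circL K (𝔤 × V) f θ) xs).1 = 0 := by
  rw [hat_prod_circL, ← AddMonoidHom.coe_fst, ← circ_comp]
  simp only [AddMonoidHom.coe_fst, hf]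
  exact congrFun (circ_zero_left _) xs

theorem snd_hat_circL {f : CochainSum K (𝔤 × V)} (hf : ∀ xs, (hat f xs).2 = 0)
    (θ : CochainSum K (𝔤 × V)) (xs : List (𝔤 × V)) : (hat (circL K (𝔤 × V) f θ) xs).2 = 0 := by
  rw [hat_prod_circL, ← AddMonoidHom.coe_snd, ← circ_comp]
  simp only [AddMonoidHom.coe_snd, hf]
  exact congrFun (circ_zero_left _) xs

theorem nrBracket_eq_circL {d : ℤ} {f θ : CochainSum K (𝔤 × V)} (hf : ∀ xs, (hat f xs).2 = 0)
    (hd : f ∈ homog K (𝔤 × V) d) (hθ : θ ∈ homogH K 𝔤 V) :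
    nrBracket K (𝔤 × V) f θ = circL K (𝔤 × V) f θ := by
  obtain ⟨h, n, hn⟩ := hθ
  rw [nrBracket_prod_eq hd hn, circL_eq_zero h hf, smul_zero, sub_zero]

theorem circL_units_smul_left (u : ℤˣ) (a b : CochainSum K (𝔤 × V)) :
    circL K (𝔤 × V) (u • a) b = u • circL K (𝔤 × V) a b :=
  map_units_smul ((circL K (𝔤 × V)).flip b) u a

/-- `[⋯[f, θ_1], ⋯, θ_n]`, projected to `𝔥` and summed over all ways of replacing `s` of the
brackets by `∘̄`. -/
def markedFold : List (CochainSum K (𝔤 × V)) → ℕ →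
    (CochainSum K (𝔤 × V) →ₗ[K] CochainSum K (𝔤 × V))
  | θs, 0 => projH K 𝔤 V ∘ₗ foldBr θs
  | [], _ + 1 => 0
  | θ :: θs, s + 1 => markedFold θs (s + 1) ∘ₗ (nrBracket K (𝔤 × V)).flip θ +
      markedFold θs s ∘ₗ (circL K (𝔤 × V)).flip θ

theorem markedFold_zero (θs) (f : CochainSum K (𝔤 × V)) :
    markedFold θs 0 f = projH K 𝔤 V (foldBr θs f) := by
  cases θs <;> rfl

theorem markedFold_nil (s : ℕ) (f : CochainSum K (𝔤 × V)) : markedFold [] (s + 1) f = 0 := rfl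

theorem markedFold_cons (θ) (θs) (s : ℕ) (f : CochainSum K (𝔤 × V)) :
    markedFold (θ :: θs) (s + 1) f = markedFold θs (s + 1) (nrBracket K (𝔤 × V) f θ) +
      markedFold θs s (circL K (𝔤 × V) f θ) := rfl

/-- For 𝔤-valued `f` the term θ ∘̄ f vanishes, and this persists along the fold. So replacing a
bracket by ∘̄ changes nothing, and the number of choices is the binomial coefficient. -/
theorem markedFold_of_snd_eq_zero {θs : List (CochainSum K (𝔤 × V))}
    (hθ : ∀ θ ∈ θs, θ ∈ homogH K 𝔤 V) {d : ℤ} {f : CochainSum K (𝔤 × V)}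
    (hd : f ∈ homog K (𝔤 × V) d) (hf : ∀ xs, (hat f xs).2 = 0) (s : ℕ) :
    markedFold θs s f = θs.length.choose s • projH K 𝔤 V (foldBr θs f) := by
  induction θs generalizing d f s with
  | nil =>
    cases s with
    | zero => simp [markedFold_zero]
    | succ s => simp [markedFold_nil]
  | cons θ θs ih =>
    cases s with
    | zero => simp [markedFold_zero]
    | succ s =>
      obtain ⟨h, n, hn⟩ := hθ θ (by simp)
      have hg := circL_prod_mem hd hn
      have hg' := snd_hat_circL hf θ
      rw [markedFold_cons, foldBr_prod_cons, nrBracket_eq_circL hf hd (hθ θ (by simp)),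
        ih (fun z hz => hθ z (by simp [hz])) hg hg', ih (fun z hz => hθ z (by simp [hz])) hg hg',
        List.length_cons, Nat.choose_succ_succ, add_smul, add_comm]

/-- For V-valued `f` exactly one bracket must contribute through θ ∘̄ f: without it the value stays
in V and P kills it, and after it the value lies in 𝔤. That bracket cannot be replaced, which leaves
one fewer to choose from. -/
theorem markedFold_of_fst_eq_zero {θs : List (CochainSum K (𝔤 × V))}
    (hθ : ∀ θ ∈ θs, θ ∈ homogH K 𝔤 V) {d : ℤ} {f : CochainSum K (𝔤 × V)}
    (hd : f ∈ homog K (𝔤 × V) d) (hf : ∀ xs, (hat f xs).1 = 0) (s : ℕ) :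
    markedFold θs s f = (θs.length - 1).choose s • projH K 𝔤 V (foldBr θs f) := by
  induction θs generalizing d f s with
  | nil =>
    cases s with
    | zero => simp [markedFold_zero]
    | succ s => simp [markedFold_nil]
  | cons θ θs ih =>
    cases s with
    | zero => simp [markedFold_zero]
    | succ s =>
      obtain ⟨h, n, hn⟩ := hθ θ (by simp)
      have hg := circL_prod_mem hd hn
      have hg' := fst_hat_circL hf θ
      have hθs : ∀ z ∈ θs, z ∈ homogH K 𝔤 V := fun z hz => hθ z (by simp [hz])
      have hk := circL_prod_mem hn hd
      have hk' := snd_hat_circL (snd_hat_of_mem_hSub h) f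
      rw [markedFold_cons, foldBr_prod_cons, nrBracket_prod_eq hd hn, map_sub, map_sub, map_sub,
        map_units_smul, map_units_smul, map_units_smul, ih hθs hg hg', ih hθs hg hg',
        markedFold_of_snd_eq_zero hθs hk hk']
      -- Truncated subtraction breaks Pascal's rule when no bracket is left. There f ∘̄ θ has values
      -- in V and is killed by P.
      rcases θs with _ | ⟨θ', θs⟩
      · simp [foldBr_nil, projH_eq_zero_of_fst hg']
      · simp only [List.length_cons, Nat.add_sub_cancel, Nat.choose_succ_succ, Nat.succ_eq_add_one]
        generalize projH K 𝔤 V (foldBr (θ' :: θs) (circL K (𝔤 × V) f θ)) = a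
        generalize projH K 𝔤 V (foldBr (θ' :: θs) (circL K (𝔤 × V) θ f)) = b
        rw [smul_comm (d * n).negOnePow]
        simp only [smul_sub, add_smul]
        abel

/-- Compositions of elements of 𝔥 with each other vanish, so the pre-Lie identities say that an
insertion by ∘̄ commutes up to sign with a bracket. The chosen insertions can therefore be done
first. -/
theorem circL_nrBracket {d t t' : ℤ} {f θ θ' : CochainSum K (𝔤 × V)}
    (hd : f ∈ homog K (𝔤 × V) d) (hθ : θ ∈ hSub K 𝔤 V) (ht : θ ∈ homog K (𝔤 × V) t)
    (hθ' : θ' ∈ hSub K 𝔤 V) (ht' : θ' ∈ homog K (𝔤 × V) t') :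
    circL K (𝔤 × V) (nrBracket K (𝔤 × V) f θ) θ' =
      (t * t').negOnePow • nrBracket K (𝔤 × V) (circL K (𝔤 × V) f θ') θ := by
  have h1 := circL_prod_preLie f ht ht'
  have h2 := circL_prod_preLie θ hd ht'
  have e1 := circL_eq_zero hθ (snd_hat_of_mem_hSub hθ')
  have e2 := circL_eq_zero hθ' (snd_hat_of_mem_hSub hθ)
  have e3 := circL_eq_zero hθ (snd_hat_circL (snd_hat_of_mem_hSub hθ') f)
  rw [e1, e2, map_zero, sub_zero, sub_zero] at h1
  rw [e1, e3, map_zero, LinearMap.zero_apply, sub_zero, smul_zero, sub_eq_zero] at h2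
  rw [nrBracket_prod_eq hd ht, nrBracket_prod_eq (circL_prod_mem hd ht') ht, map_sub, LinearMap.sub_apply,
    circL_units_smul_left, h1, h2, smul_sub, smul_smul, ← Int.negOnePow_add]
  congr 2
  rw [Int.negOnePow_eq_iff]
  exact ⟨-(t * t'), by ring⟩

/-- For all choices of `s` of the `θ_i`, inserting these into `f` by `∘̄` and bracketing with the
others gives an element of `N` after projection to `𝔥`. -/
def InsertionsMem (N : Submodule K (CochainSum K (𝔤 × V))) :
    ℕ → CochainSum K (𝔤 × V) → List (CochainSum K (𝔤 × V)) → Prop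
  | 0, f, θs => projH K 𝔤 V (foldBr θs f) ∈ N
  | s + 1, f, θs => ∀ θ rest, (θ :: rest).Perm θs → InsertionsMem N s (circL K (𝔤 × V) f θ) rest

variable {N : Submodule K (CochainSum K (𝔤 × V))}

theorem units_smul_mem_submodule (u : ℤˣ) {x : CochainSum K (𝔤 × V)} (hx : x ∈ N) : u • x ∈ N := by
  rcases Int.units_eq_one_or u with rfl | rfl
  · simpa using hx
  · simpa using N.neg_mem hx

theorem InsertionsMem.units_smul {s : ℕ} {f : CochainSum K (𝔤 × V)} {θs} (u : ℤˣ)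
    (h : InsertionsMem N s f θs) : InsertionsMem N s (u • f) θs := by
  induction s generalizing f θs with
  | zero =>
    rw [InsertionsMem, map_units_smul, map_units_smul]
    exact units_smul_mem_submodule u h
  | succ s ih =>
    intro θ rest hp
    rw [circL_units_smul_left]
    exact ih (h θ rest hp)

theorem InsertionsMem.nrBracket {s : ℕ} {d : ℤ} {f θ : CochainSum K (𝔤 × V)}
    {θs : List (CochainSum K (𝔤 × V))} (hd : f ∈ homog K (𝔤 × V) d) (hθ : θ ∈ homogH K 𝔤 V)
    (hθs : ∀ θ ∈ θs, θ ∈ homogH K 𝔤 V) (h : InsertionsMem N s f (θ :: θs)) :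
    InsertionsMem N s (nrBracket K (𝔤 × V) f θ) θs := by
  induction s generalizing d f θs with
  | zero => exact h
  | succ s ih =>
    intro θ' rest hp
    obtain ⟨h1, t, ht⟩ := hθ
    obtain ⟨h1', t', ht'⟩ := hθs θ' (hp.subset (by simp))
    rw [circL_nrBracket hd h1 ht h1' ht']
    refine (ih (circL_prod_mem hd ht') (fun z hz => hθs z (hp.subset (by simp [hz])))
      (h θ' (θ :: rest) ?_)).units_smul _
    exact (List.Perm.swap _ _ _).trans (hp.cons θ)

theorem markedFold_mem {s : ℕ} {d : ℤ} {f : CochainSum K (𝔤 × V)}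
    {θs : List (CochainSum K (𝔤 × V))} (hd : f ∈ homog K (𝔤 × V) d)
    (hθs : ∀ θ ∈ θs, θ ∈ homogH K 𝔤 V) (h : InsertionsMem N s f θs) :
    markedFold θs s f ∈ N := by
  induction θs generalizing d f s with
  | nil =>
    cases s with
    | zero => rwa [markedFold_zero]
    | succ s => exact N.zero_mem
  | cons θ θs ih =>
    cases s with
    | zero => rwa [markedFold_zero]
    | succ s =>
      have hθ := hθs θ (by simp)
      have hθs' : ∀ z ∈ θs, z ∈ homogH K 𝔤 V := fun z hz => hθs z (by simp [hz])
      obtain ⟨h1, t, ht⟩ := hθ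
      rw [markedFold_cons]
      exact N.add_mem (ih (nrBracket_prod_mem hd ht) hθs' (h.nrBracket hd (hθs θ (by simp)) hθs'))
        (ih (circL_prod_mem hd ht) hθs' (h θ θs (List.Perm.refl _)))

/-- Sum over all ways of replacing two brackets by ∘̄. Each term lies in `N` once its two insertions
are moved to the front, and the sum is a binomial multiple of the full bracket. Three brackets
suffice for a nonzero factor even when `f` has values in V. -/
theorem projH_foldBr_mem_of_pairs {d : ℤ} {f : CochainSum K (𝔤 × V)}
    {θs : List (CochainSum K (𝔤 × V))} (hd : f ∈ homog K (𝔤 × V) d)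
    (hf : (∀ xs, (hat f xs).1 = 0) ∨ (∀ xs, (hat f xs).2 = 0))
    (hθs : ∀ θ ∈ θs, θ ∈ homogH K 𝔤 V) (hl : 3 ≤ θs.length)
    (h : ∀ θ θ' rest, (θ :: θ' :: rest).Perm θs →
      projH K 𝔤 V (foldBr rest (circL K (𝔤 × V) (circL K (𝔤 × V) f θ) θ')) ∈ N) :
    projH K 𝔤 V (foldBr θs f) ∈ N := by
  have h2 : markedFold θs 2 f ∈ N :=
    markedFold_mem hd hθs fun θ rest hp θ' rest' hp' => h θ θ' rest' ((hp'.cons θ).trans hp)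
  have key : ∀ c : ℕ, c ≠ 0 → c • projH K 𝔤 V (foldBr θs f) ∈ N →
      projH K 𝔤 V (foldBr θs f) ∈ N := by
    intro c hc hN
    rw [← Nat.cast_smul_eq_nsmul K] at hN
    exact (N.smul_mem_iff (Nat.cast_ne_zero.2 hc)).1 hN
  rcases hf with hf | hf
  · rw [markedFold_of_fst_eq_zero hθs hd hf] at h2
    exact key _ (Nat.choose_pos (by omega)).ne' h2
  · rw [markedFold_of_snd_eq_zero hθs hd hf] at h2
    exact key _ (Nat.choose_pos (by omega)).ne' h2

end Averaging


/-! ### Replacing an argument by a pair of arguments -/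

section PairInsertion

variable {K : Type*} [Field K] {M N W : Type*} [AddCommGroup M] [AddCommGroup N] [AddCommGroup W]
  [Module K M] [Module K N] [Module K W] (ι : W →ₗ[K] M)

/-- Insertion of a formal sum of pairs as the first two arguments. -/
noncomputable def contrPairs (z : W × W →₀ K) (f : List M → N) : List M → N := fun ys =>
  Finsupp.linearCombination K (fun w : W × W => f (ι w.1 :: ι w.2 :: ys)) z

theorem contrPairs_single (w : W × W) (c : K) (f : List M → N) :
    contrPairs ι (Finsupp.single w c) f = c • contr (ι w.2) (contr (ι w.1) f) := by
  funext ys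
  simp [contrPairs, contr]

theorem contrPairs_zero_left (f : List M → N) : contrPairs ι (0 : W × W →₀ K) f = 0 := by
  funext ys
  simp [contrPairs]

theorem contrPairs_add_left (z z' : W × W →₀ K) (f : List M → N) :
    contrPairs ι (z + z') f = contrPairs ι z f + contrPairs ι z' f := by
  funext ys
  simp [contrPairs]

theorem contrPairs_smul_left (c : K) (z : W × W →₀ K) (f : List M → N) :
    contrPairs ι (c • z) f = c • contrPairs ι z f := by
  funext ys
  simp [contrPairs]

theorem contrPairs_add_right (z : W × W →₀ K) (f g : List M → N) :
    contrPairs ι z (f + g) = contrPairs ι z f + contrPairs ι z g := by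
  funext ys
  simp [contrPairs, Finsupp.linearCombination_apply, Finsupp.sum_add]

theorem contrPairs_zsmul_right (z : W × W →₀ K) (n : ℤ) (f : List M → N) :
    contrPairs ι z (n • f) = n • contrPairs ι z f := by
  funext ys
  simp [contrPairs, Finsupp.linearCombination_apply, Finsupp.smul_sum, smul_comm n]

theorem contr_contrPairs (z : W × W →₀ K) {f : List M → N} (hf : IsAlt K f) (x : M) :
    contr x (contrPairs ι z f) = contrPairs ι z (contr x f) := by
  funext ys
  simp only [contrPairs, contr]
  congr 2
  funext w
  have h1 := hf.swap [] x (ι w.1) (ι w.2 :: ys)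
  have h2 := hf.swap [ι w.1] x (ι w.2) ys
  simp only [List.nil_append, List.cons_append] at h1 h2
  rw [h1, h2, neg_neg]

theorem parity_contrPairs (z : W × W →₀ K) (f : List M → N) :
    parity (contrPairs ι z f) = contrPairs ι z (parity f) := by
  funext ys
  simp [contrPairs, parity, Finsupp.linearCombination_apply, Finsupp.smul_sum,
    smul_comm _ ((-1 : ℤ) ^ _), pow_succ]

theorem IsAlt.contrPairs {f : List M → N} (hf : IsAlt K f) (z : W × W →₀ K) :
    IsAlt K (contrPairs ι z f) where
  lin A B := by
    constructor
    · intro x y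
      simp only [RelRB.contrPairs, Finsupp.linearCombination_apply, ← Finsupp.sum_add, ← smul_add]
      congr 1
      funext w c
      exact congrArg (c • ·) ((hf.lin (ι w.1 :: ι w.2 :: A) B).map_add x y)
    · intro r x
      simp only [RelRB.contrPairs, Finsupp.linearCombination_apply, Finsupp.smul_sum]
      congr 1
      funext w c
      rw [smul_comm r]
      exact congrArg (c • ·) ((hf.lin (ι w.1 :: ι w.2 :: A) B).map_smul r x)
  swap A x y B := by
    simp only [RelRB.contrPairs, Finsupp.linearCombination_apply, ← Finsupp.sum_neg, ← smul_neg]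
    congr 1
    funext w c
    exact congrArg (c • ·) (hf.swap (ι w.1 :: ι w.2 :: A) x y B)

theorem contr_circ_of_contr_eq_zero {f : List M → N} (hf : IsAlt K f) {g : List M → M} {x : M}
    (h : contr x g = 0) : contr x (circ f g) = circ (contr x f) (parity g) := by
  rw [contr_circ, h, circ_zero_right hf.endLin, zero_add]

/-- The inserted elements cannot go into `g`, and as they come in pairs the signs of passing `g`
cancel. -/
theorem circ_contrPairs_left {f : List M → N} (hf : IsAlt K f) {g : List M → M}
    (hg : ∀ w, contr (ι w) g = 0) (z : W × W →₀ K) :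
    circ (contrPairs ι z f) g = contrPairs ι z (circ f g) := by
  induction z using Finsupp.induction_linear with
  | zero => rw [contrPairs_zero_left, contrPairs_zero_left, circ_zero_left]
  | add z z' h h' => rw [contrPairs_add_left, contrPairs_add_left, circ_add_left, h, h']
  | single w c =>
    rw [contrPairs_single, contrPairs_single, circ_smul_left,
      contr_circ_of_contr_eq_zero hf (hg _), contr_circ_of_contr_eq_zero (hf.contr _),
      parity_parity]
    rw [← neg_eq_zero, ← parity_contr, hg, parity_zero]

theorem circ_contrPairs_right {f : List M → N} (hf : IsAlt K f) {g : List M → M}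
    (hf' : ∀ w, contr (ι w) f = 0) (z : W × W →₀ K) :
    circ f (contrPairs ι z g) = contrPairs ι z (circ f g) := by
  induction z using Finsupp.induction_linear with
  | zero => simp [contrPairs_zero_left, circ_zero_right hf.endLin]
  | add z z' h h' => rw [contrPairs_add_left, contrPairs_add_left, circ_add_right hf.endLin, h, h']
  | single w c =>
    rw [contrPairs_single, contrPairs_single, circ_smul_right hf.endLin, contr_circ, hf',
      circ_zero_left, add_zero, contr_circ, hf', circ_zero_left, add_zero]

variable (p : M →ₗ[K] (W × W →₀ K))

/-- The signed sum of all ways of replacing one argument `x` by the pairs `p x`. -/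
noncomputable def splitArg : (List M → N) → List M → N
  | _, [] => 0
  | f, x :: xs => contrPairs ι (p x) f xs - splitArg (contr x f) xs

theorem contr_splitArg (x : M) (f : List M → N) :
    contr x (splitArg ι p f) = contrPairs ι (p x) f - splitArg ι p (contr x f) := rfl

theorem splitArg_zsmul (n : ℤ) (f : List M → N) : splitArg ι p (n • f) = n • splitArg ι p f := by
  funext xs
  induction xs generalizing f with
  | nil => simp [splitArg]
  | cons x xs ih => simp [splitArg, contrPairs_zsmul_right, ih, smul_sub]

theorem splitArg_add (f g : List M → N) :
    splitArg ι p (f + g) = splitArg ι p f + splitArg ι p g := by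
  funext xs
  induction xs generalizing f g with
  | nil => simp [splitArg]
  | cons x xs ih => simp [splitArg, contrPairs_add_right, ih]; abel

theorem splitArg_neg (f : List M → N) : splitArg ι p (-f) = -splitArg ι p f := by
  simpa using splitArg_zsmul ι p (-1) f

theorem splitArg_sub (f g : List M → N) :
    splitArg ι p (f - g) = splitArg ι p f - splitArg ι p g := by
  rw [sub_eq_add_neg, splitArg_add, splitArg_neg, ← sub_eq_add_neg]

theorem parity_splitArg (f : List M → N) :
    parity (splitArg ι p f) = -splitArg ι p (parity f) := by
  funext xs
  induction xs generalizing f with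
  | nil => simp [splitArg, parity]
  | cons x xs ih =>
    have h1 : parity (splitArg ι p f) (x :: xs) =
      -parity (contr x (splitArg ι p f)) xs := by rw [parity_contr]; simp [contr]
    rw [h1, contr_splitArg, parity_sub, Pi.sub_apply, ih, parity_contr, splitArg_neg,
      parity_contrPairs]
    simp [splitArg]

theorem IsAlt.splitArg {f : List M → N} (hf : IsAlt K f) : IsAlt K (splitArg ι p f) where
  lin A B := by
    induction A generalizing f with
    | nil =>
      have h : ∀ y, (fun ys => f (y :: ys)) = RelRB.contr y f := fun _ => rfl
      have hadd : ∀ x y, RelRB.contr (x + y) f = RelRB.contr x f + RelRB.contr y f :=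
        fun x y => funext fun ys => (hf.lin [] ys).map_add x y
      have hsmul : ∀ (c : K) x, RelRB.contr (c • x) f = c • RelRB.contr x f :=
        fun c x => funext fun ys => (hf.lin [] ys).map_smul c x
      constructor
      · intro x y
        simp only [List.nil_append, RelRB.splitArg, map_add, contrPairs_add_left, hadd,
          splitArg_add, Pi.add_apply]
        abel
      · intro c x
        have hs : RelRB.splitArg ι p (c • RelRB.contr x f) B =
            c • RelRB.splitArg ι p (RelRB.contr x f) B := by
          generalize RelRB.contr x f = g
          induction B generalizing g with
          | nil => simp [RelRB.splitArg]
          | cons b B ih =>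
            have : RelRB.contr b (c • g) = c • RelRB.contr b g := rfl
            simp only [RelRB.splitArg, this, ih, smul_sub]
            congr 1
            simp [RelRB.contrPairs, Finsupp.linearCombination_apply, Finsupp.smul_sum, smul_comm c]
        simp only [List.nil_append, RelRB.splitArg, map_smul, contrPairs_smul_left, hsmul, hs,
          Pi.smul_apply, smul_sub]
    | cons a A ih =>
      have h1 := (hf.contrPairs ι (p a)).lin A B
      have h2 := ih (hf.contr a)
      constructor
      · intro x y
        simp only [List.cons_append, RelRB.splitArg, h1.map_add, h2.map_add]
        abel
      · intro c x
        simp only [List.cons_append, RelRB.splitArg, h1.map_smul, h2.map_smul, smul_sub]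
  swap A x y B := by
    induction A generalizing f with
    | nil =>
      have h : RelRB.contr y (RelRB.contr x f) = -RelRB.contr x (RelRB.contr y f) :=
        funext fun ys => hf.swap [] x y ys
      simp only [List.nil_append, RelRB.splitArg, h, splitArg_neg, Pi.neg_apply]
      have h1 : ∀ u v, RelRB.contrPairs ι (p u) f (v :: B) =
        RelRB.contrPairs ι (p u) (RelRB.contr v f) B :=
        fun u v => congrFun (contr_contrPairs ι (p u) hf v) B
      rw [h1, h1]
      abel
    | cons a A ih =>
      have h1 := (hf.contrPairs ι (p a)).swap A x y B
      simp only [List.cons_append, RelRB.splitArg, h1, ih (hf.contr a)]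
      abel

/-- The signed sum of all ways of inserting arguments into `g` and the value of `g`, split by `p`,
into the first two arguments of `f`. -/
noncomputable def splitValue : (List M → N) → (List M → M) → List M → N
  | f, g, [] => contrPairs ι (p (g [])) f []
  | f, g, x :: xs => splitValue f (contr x g) xs - splitValue (contr x f) (parity g) xs

theorem splitValue_add (f : List M → N) (g h : List M → M) :
    splitValue ι p f (g + h) = splitValue ι p f g + splitValue ι p f h := by
  funext xs
  induction xs generalizing f g h with
  | nil => simp [splitValue, contrPairs_add_left]
  | cons x xs ih => simp [splitValue, ih]; abel

theorem splitValue_neg (f : List M → N) (g : List M → M) :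
    splitValue ι p f (-g) = -splitValue ι p f g := by
  have h0 : splitValue ι p f (0 : List M → M) = 0 := by
    simpa using splitValue_add ι p f 0 0
  rw [eq_neg_iff_add_eq_zero, ← splitValue_add, neg_add_cancel, h0]

theorem splitValue_eq_zero {f : List M → N} {g : List M → M} (hg : ∀ xs, p (g xs) = 0) :
    splitValue ι p f g = 0 := by
  funext xs
  induction xs generalizing f g with
  | nil => simp [splitValue, hg, contrPairs_zero_left]
  | cons x xs ih =>
    have h1 : ∀ xs, p (contr x g xs) = 0 := fun xs => hg (x :: xs)
    have h2 : ∀ xs, p (parity g xs) = 0 := fun xs => by simp [parity, map_zsmul, hg]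
    rw [splitValue, ih h1, ih h2]
    simp

theorem IsAlt.parity {g : List M → N} (hg : IsAlt K g) : IsAlt K (parity g) where
  lin A B := ⟨fun x y => by simp [RelRB.parity, (hg.lin A B).map_add],
    fun c x => by simp [RelRB.parity, (hg.lin A B).map_smul, smul_comm c]⟩
  swap A x y B := by
    rw [RelRB.parity, RelRB.parity, hg.swap, smul_neg]
    simp

theorem contr_contr_eq_zero {g : List M → N} (hg : IsAlt K g) {w : M} (h : contr w g = 0) (x : M) :
    contr w (contr x g) = 0 := by
  have : contr w (contr x g) = -contr x (contr w g) := funext fun ys => hg.swap [] x w ys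
  rw [this, h, contr_zero, neg_zero]

theorem contr_parity_eq_zero {g : List M → N} {w : M} (h : contr w g = 0) :
    contr w (parity g) = 0 := by
  rw [← neg_eq_zero, ← parity_contr, h, parity_zero]

/-- The argument to be split is either an outer argument or the value of `g`; these give the two
summands. The `parity` in the first reflects that splitting raises the number of arguments by one.
-/
theorem circ_splitArg_left {f : List M → N} (hf : IsAlt K f) {g : List M → M}
    (hg : IsAlt K g) (h : ∀ w, contr (ι w) g = 0) :
    circ (splitArg ι p f) g = splitArg ι p (circ f (parity g)) + splitValue ι p f g := by
  funext xs
  induction xs generalizing f g with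
  | nil => simp [circ, splitArg, splitValue]
  | cons x xs ih =>
    have h1 := fun w => contr_contr_eq_zero hg (h w) x
    have h2 := fun w => contr_parity_eq_zero (h w)
    rw [circ, ih hf (hg.contr x) h1, contr_splitArg, circ_sub_left,
      circ_contrPairs_left ι hf h2, Pi.sub_apply, ih (hf.contr x) hg.parity h2, parity_parity,
      Pi.add_apply, Pi.add_apply, Pi.add_apply, splitArg, splitValue, contr_circ, parity_parity,
      splitArg_add, Pi.add_apply, parity_contr, circ_neg_right hf.endLin, splitArg_neg, Pi.neg_apply]
    abel

/-- As `f` vanishes on the image of `ι`, an argument split in the composite contributes only when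
both halves go into `g`. -/
theorem circ_splitArg_right {f : List M → N} (hf : IsAlt K f) {g : List M → M}
    (hf' : ∀ w, contr (ι w) f = 0) :
    circ f (splitArg ι p g) = splitArg ι p (circ f g) := by
  funext xs
  induction xs generalizing f g with
  | nil => simp [circ, splitArg, hf.endLin.map_zero]
  | cons x xs ih =>
    have h2 := fun w => contr_contr_eq_zero hf (hf' w) x
    rw [circ, contr_splitArg, parity_splitArg, circ_sub_right hf.endLin,
      circ_neg_right (hf.contr x).endLin, Pi.sub_apply, Pi.neg_apply, ih hf hf', ih (hf.contr x) h2,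
      circ_contrPairs_right ι hf hf', splitArg, contr_circ, splitArg_add, Pi.add_apply]
    abel

theorem splitArg_map {φ : M →ₗ[K] M} {ψ : N →ₗ[K] N} (hφ : ∀ w, φ (ι w) = ι w)
    (hp : ∀ x, p (φ x) = p x) {f f' : List M → N}
    (h : ∀ xs, f' (xs.map φ) = ψ (f xs)) (xs : List M) :
    splitArg ι p f' (xs.map φ) = ψ (splitArg ι p f xs) := by
  induction xs generalizing f f' with
  | nil => simp [splitArg]
  | cons x xs ih =>
    rw [List.map_cons, splitArg, splitArg, map_sub, ih (f := contr x f) fun ys => h (x :: ys), hp]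
    congr 1
    simp only [contrPairs, Finsupp.linearCombination_apply, map_finsuppSum, map_smul]
    congr 1
    funext w c
    have := h (ι w.1 :: ι w.2 :: xs)
    simp only [List.map_cons, hφ] at this
    rw [this]

theorem splitArg_eq_zero (f : List M → N) {xs : List M} (h : ∀ x ∈ xs, p x = 0) :
    splitArg ι p f xs = 0 := by
  induction xs generalizing f with
  | nil => rfl
  | cons x xs ih =>
    rw [splitArg, h x (by simp), contrPairs_zero_left, ih _ fun z hz => h z (by simp [hz])]
    simp

/-- `θ` is homogeneous and alternating, vanishes on arguments from the image of `ι`, and takes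
values in `S`. -/
structure IsHorizontal (S : Submodule K M) (θ : List M → M) : Prop where
  alt : IsAlt K θ
  contr_eq_zero : ∀ w, contr (ι w) θ = 0
  mem : ∀ xs, θ xs ∈ S
  homogeneous : ∃ q : ℕ, parity θ = (-1 : ℤ) ^ q • θ

variable {ι p}

theorem IsHorizontal.contr {S : Submodule K M} {θ : List M → M} (h : IsHorizontal ι S θ) (x : M) :
    IsHorizontal ι S (contr x θ) where
  alt := h.alt.contr x
  contr_eq_zero w := contr_contr_eq_zero h.alt (h.contr_eq_zero w) x
  mem xs := h.mem (x :: xs)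
  homogeneous := by
    obtain ⟨q, hq⟩ := h.homogeneous
    exact ⟨_, parity_contr_of hq x⟩

theorem IsHorizontal.parity {S : Submodule K M} {θ : List M → M} (h : IsHorizontal ι S θ) :
    IsHorizontal ι S (parity θ) where
  alt := h.alt.parity
  contr_eq_zero w := contr_parity_eq_zero (h.contr_eq_zero w)
  mem xs := by
    rcases Int.units_eq_one_or ((-1 : ℤˣ) ^ (xs.length + 1)) with hs | hs <;>
      · have hs' := congrArg (Units.val) hs
        simp only [Units.val_pow_eq_pow_val, Units.val_neg, Units.val_one] at hs'
        rw [RelRB.parity, hs']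
        simpa using h.mem xs
  homogeneous := by
    obtain ⟨q, hq⟩ := h.homogeneous
    exact ⟨q, by rw [hq, parity_zsmul, hq]⟩

theorem IsHorizontal.circ_eq_zero {S₁ S₂ : Submodule K M} {θ₁ θ₂ : List M → M}
    (h₁ : IsHorizontal ι S₁ θ₁) (h₂ : IsHorizontal ι S₂ θ₂) (hS : S₂ ≤ LinearMap.range ι) :
    circ θ₁ θ₂ = 0 := by
  refine circ_eq_zero_of h₁.alt fun A B => ?_
  obtain ⟨w, hw⟩ := hS (h₂.mem A)
  rw [← hw]
  exact congrFun (h₁.contr_eq_zero w) B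

/-- If `p` decodes the values of `R` up to the factor κ, then splitting the value of `R` applied to
θ₁, θ₂ inserts κ times θ₁ and θ₂ themselves. The induction distributes one outer argument at a time.
-/
theorem splitValue_circ_circ {S₁ S₂ : Submodule K M}
    (hS₂ : S₂ ≤ LinearMap.range ι) {R : List M → M} (hR : IsAlt K R)
    (hR2 : ∀ l, l.length ≠ 2 → R l = 0) {κ : ℤ}
    (hκ : ∀ u ∈ S₁, ∀ v ∈ S₂, ∀ f : List M → M, IsAlt K f →
      contrPairs ι (p (R [u, v])) f [] = κ • f [u, v])
    {f : List M → M} (hf : IsAlt K f) {θ₁ θ₂ : List M → M} (h₁ : IsHorizontal ι S₁ θ₁)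
    (h₂ : IsHorizontal ι S₂ θ₂) :
    splitValue ι p f (circ (circ R θ₁) θ₂) = κ • circ (circ f θ₁) θ₂ := by
  have hRp : parity R = -R := by
    funext l
    by_cases hl : l.length = 2
    · simp [parity, hl]
    · simp [parity, hR2 l hl]
  funext xs
  induction xs generalizing f θ₁ θ₂ with
  | nil =>
    have e1 : ∀ {f : List M → M}, IsAlt K f →
        circ (circ f θ₁) θ₂ [] = f [θ₁ [], θ₂ []] := by
      intro f hf
      obtain ⟨w, hw⟩ := hS₂ (h₂.mem [])
      have h0 : θ₁ [θ₂ []] = 0 := by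
        rw [← hw]; exact congrFun (h₁.contr_eq_zero w) []
      have h3 := hf.swap [] (θ₂ []) (θ₁ []) []
      have h4 := (hf.lin [θ₂ []] []).map_neg (θ₁ [])
      have h5 : f [0] = 0 := (hf.lin [] []).map_zero
      simp only [List.nil_append, List.singleton_append] at h3 h4
      simp [circ, contr, parity, h0, h3, h4, h5]
    rw [splitValue, e1 hR, hκ _ (h₁.mem _) _ (h₂.mem _) f hf, Pi.smul_apply, e1 hf]
  | cons x xs ih =>
    have hc : ∀ (f : List M → M),
        contr x (circ (circ f θ₁) θ₂) = circ (circ f θ₁) (contr x θ₂) +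
          (circ (circ f (contr x θ₁)) (parity θ₂) +
            circ (circ (contr x f) (parity θ₁)) (parity θ₂)) := by
      intro f
      rw [contr_circ, contr_circ, circ_add_left]
    -- With one slot of `R` used by `x`, only one remains, so composition is associative and the
    -- term contains θ₁ ∘̄ θ₂ = 0.
    have h0 : circ (circ (contr x R) (parity θ₁)) (parity θ₂) = 0 := by
      obtain ⟨q, hq⟩ := h₁.parity.homogeneous
      obtain ⟨r, hr⟩ := h₂.parity.homogeneous
      rw [circ_assoc_of_le_one (hR.contr x) _ h₁.parity.alt.endLin h₂.parity.alt.endLin hq hr,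
        h₁.parity.circ_eq_zero h₂.parity hS₂, circ_zero_right (hR.contr x).endLin]
      intro a b l
      exact hR2 _ (by simp)
    have hp : parity (circ (circ R θ₁) θ₂) = -circ (circ R (parity θ₁)) (parity θ₂) := by
      rw [parity_circ _ (EndLin.circ hR h₁.alt.endLin), parity_circ _ hR.endLin, hRp,
        circ_neg_left, circ_neg_left]
    have hx : (κ • circ (circ f θ₁) θ₂) (x :: xs) = (κ • contr x (circ (circ f θ₁) θ₂)) xs := rfl
    rw [splitValue, hc, h0, add_zero, splitValue_add, Pi.add_apply, ih hf h₁ (h₂.contr x),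
      ih hf (h₁.contr x) h₂.parity, hp, splitValue_neg, Pi.neg_apply,
      ih (hf.contr x) h₁.parity h₂.parity, hx, hc]
    simp only [smul_add, Pi.add_apply]
    abel

end PairInsertion


/-! ### Cochains from functions on lists -/

section OfList

variable {K : Type*} [Field K] {M : Type*} [AddCommGroup M] [Module K M]

theorem IsAlt.eq_zero_of_mem_twice [CharZero K] {F : List M → M} (hF : IsAlt K F) (x : M)
    (A B C : List M) : F (A ++ x :: (B ++ x :: C)) = 0 := by
  induction B generalizing A with
  | nil =>
    have h := hF.swap A x x C
    have h2 : (2 : K) • F (A ++ x :: x :: C) = 0 := by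
      rw [two_smul]
      exact eq_neg_iff_add_eq_zero.1 h
    exact (smul_eq_zero.1 h2).resolve_left two_ne_zero
  | cons b B ih =>
    have := ih (A ++ [b])
    rw [List.cons_append, hF.swap]
    simpa using this

theorem ofFn_eq_append {n : ℕ} (v : Fin n → M) (i j : Fin n) (hij : i < j) :
    ∃ A B C : List M, List.ofFn v = A ++ v i :: (B ++ v j :: C) := by
  obtain ⟨A, A', hA, hA'⟩ : ∃ A A', List.ofFn v = A ++ v i :: A' ∧ A.length = i := by
    refine ⟨(List.ofFn v).take i, (List.ofFn v).drop (i + 1), ?_, by simp⟩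
    conv_lhs => rw [← List.take_append_drop i (List.ofFn v)]
    rw [List.drop_eq_getElem_cons (by simp)]
    simp
  have hj : ((List.ofFn v)[(j : ℕ)]'(by simp)) = v j := by simp
  simp only [hA] at hj
  rw [List.getElem_append_right (by omega), List.getElem_cons] at hj
  have hlt : (i : ℕ) < j := hij
  rw [dif_neg (by omega)] at hj
  have hlen := congrArg List.length hA
  simp only [List.length_ofFn, List.length_append, List.length_cons] at hlen
  refine ⟨A, A'.take (j - A.length - 1), A'.drop (j - A.length - 1 + 1), ?_⟩
  rw [hA, ← hj, ← List.drop_eq_getElem_cons, List.take_append_drop]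

theorem exists_hat_eq [CharZero K] {F : List M → M} (hF : IsAlt K F) (n : ℕ)
    (h : ∀ l : List M, l.length ≠ n + 1 → F l = 0) :
    ∃ Q ∈ homog K M n, hat Q = F := by
  let P : Cochain K M n := { multilinearOfList F hF.lin (n + 1) with
    map_eq_zero_of_eq' := fun v i j hv hij => by
      change F (List.ofFn v) = 0
      rcases lt_or_gt_of_ne hij with hlt | hlt
      · obtain ⟨A, B, C, hABC⟩ := ofFn_eq_append v i j hlt
        rw [hABC, ← hv]
        exact hF.eq_zero_of_mem_twice _ _ _ _
      · obtain ⟨A, B, C, hABC⟩ := ofFn_eq_append v j i hlt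
        rw [hABC, ← hv]
        exact hF.eq_zero_of_mem_twice _ _ _ _ }
  refine ⟨DirectSum.lof K ℕ (Cochain K M) n P, lof_mem_homog P, funext fun l => ?_⟩
  by_cases hl : l.length = n + 1
  · obtain ⟨x, rfl⟩ := exists_eq_ofFn hl
    rw [hat_ofFn, DirectSum.lof_apply]
    rfl
  · rw [hat_lof_of_ne _ hl, h l hl]

/-- Composition of the values with a linear map. -/
noncomputable def valueMap (φ : M →ₗ[K] M) : CochainSum K M →ₗ[K] CochainSum K M :=
  DirectSum.lmap fun _ => LinearMap.compAlternatingMapₗ K φ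

theorem hat_valueMap (φ : M →ₗ[K] M) (Q : CochainSum K M) (xs : List M) :
    hat (valueMap φ Q) xs = φ (hat Q xs) := by
  cases xs with
  | nil => simp
  | cons x xs =>
    rw [hat_of_length Q (n := xs.length) _ (by simp), hat_of_length _ (n := xs.length) _ (by simp)]
    simp only [valueMap, DirectSum.lmap_apply]
    rfl

theorem valueMap_mem (φ : M →ₗ[K] M) {d : ℤ} {Q : CochainSum K M} (hQ : Q ∈ homog K M d) :
    valueMap φ Q ∈ homog K M d := fun n hn => by
  simp only [valueMap, DirectSum.lmap_apply, hQ n hn, map_zero]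

theorem circ_of_le_one {f g : List M → M} (hf : IsAlt K f)
    (h : ∀ x y l, f (x :: y :: l) = 0) (xs : List M) : circ f g xs = f [g xs] := by
  induction xs generalizing g with
  | nil => rfl
  | cons x xs ih =>
    rw [circ, ih, circ_eq_zero_of (hf.contr x) fun A B => h _ _ _]
    simp [contr]

end OfList

/-! ### Decompositions of a vector space into blocks that absorb tensor products -/

section Blocks

universe u

variable (K : Type*) [Field K] (W : Type u) [AddCommGroup W] [Module K W]
  (M : Type*) [AddCommGroup M] [Module K M]

open Module Cardinal in
-- In finite dimension the blocks are single basis vectors and J is a point. Otherwise the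
-- cardinality κ of a basis satisfies mκ = κ = κ², which gives m blocks of size κ.
theorem exists_basis_blocks (m : ℕ) (hm : 1 ≤ m) (h : Module.Finite K W → m ≤ finrank K W) :
    ∃ (I : Type u) (_ : Basis I K W) (J : Type u) (N : ℕ) (_ : I ≃ Fin N × J) (_ : J × J ≃ J),
      m ≤ N := by
  let b := Basis.ofVectorSpace K W
  rcases finite_or_infinite (Basis.ofVectorSpaceIndex K W) with hI | hI
  · have : Module.Finite K W := Module.Finite.of_basis b
    refine ⟨_, b, PUnit, _, (Finite.equivFin _).trans (Equiv.prodPUnit _).symm,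
      Equiv.prodPUnit _, ?_⟩
    rw [← finrank_eq_nat_card_basis b]
    exact h this
  · have h0 := aleph0_le_mk (Basis.ofVectorSpaceIndex K W)
    have h1 : #(Fin m × Basis.ofVectorSpaceIndex K W) = #(Basis.ofVectorSpaceIndex K W) := by
      rw [mk_prod]
      simp only [mk_fin, lift_natCast, lift_uzero]
      exact mul_eq_right h0 ((natCast_le_aleph0 (n := m)).trans h0) (by exact_mod_cast by omega)
    have h2 : #(Basis.ofVectorSpaceIndex K W × Basis.ofVectorSpaceIndex K W) =
        #(Basis.ofVectorSpaceIndex K W) := by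
      rw [mk_prod]
      simp only [lift_id]
      exact mul_eq_self h0
    obtain ⟨e⟩ := Cardinal.eq.1 h1.symm
    obtain ⟨j⟩ := Cardinal.eq.1 h2
    exact ⟨_, b, _, m, e, j, le_refl m⟩

open Classical in
-- `enc` sends a pair of basis vectors from the blocks c₁ and c₂ to the basis vector of block d
-- given by J × J ≃ J, and `p` inverts this on block d and is 0 on the others. Formal sums of pairs,
-- tested against bilinear maps, play the role of the tensor product.
theorem exists_blocks (m : ℕ) (hm : 1 ≤ m) (h : Module.Finite K W → m ≤ Module.finrank K W) :
    ∃ (N : ℕ) (π : Fin N → W →ₗ[K] W), m ≤ N ∧ (∑ c, π c = LinearMap.id) ∧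
      (∀ c c' w, π c (π c' w) = if c = c' then π c w else 0) ∧
      ∀ c₁ c₂ d, ∃ (enc : W →ₗ[K] W →ₗ[K] W) (p : W →ₗ[K] (W × W →₀ K)),
        (∀ u v, π d (enc u v) = enc u v) ∧ (∀ c, c ≠ d → ∀ w, p (π c w) = 0) ∧
        ∀ (B : W →ₗ[K] W →ₗ[K] M) (u v : W),
          Finsupp.linearCombination K (fun w : W × W => B w.1 w.2) (p (enc u v)) =
            B (π c₁ u) (π c₂ v) := by
  obtain ⟨I, b, J, N, e, j, hN⟩ := exists_basis_blocks K W m hm h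
  let π : Fin N → W →ₗ[K] W := fun c => b.constr K fun β => if (e β).1 = c then b β else 0
  have hπ : ∀ c β, π c (b β) = if (e β).1 = c then b β else 0 := fun c β => b.constr_basis K _ β
  refine ⟨N, π, hN, ?_, ?_, ?_⟩
  · refine b.ext fun β => ?_
    simp [LinearMap.sum_apply, hπ]
  · intro c c' w
    have : π c ∘ₗ π c' = if c = c' then π c else 0 := by
      refine b.ext fun β => ?_
      rw [LinearMap.comp_apply, hπ]
      by_cases h1 : (e β).1 = c' <;> by_cases h2 : c = c' <;> simp [hπ, h1, h2]
      exact fun h3 => absurd h3.symm h2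
    have := LinearMap.congr_fun this w
    rw [LinearMap.comp_apply] at this
    rw [this]
    split_ifs <;> rfl
  · intro c₁ c₂ d
    let enc : W →ₗ[K] W →ₗ[K] W := b.constr K fun β₁ => b.constr K fun β₂ =>
      if (e β₁).1 = c₁ ∧ (e β₂).1 = c₂ then b (e.symm (d, j ((e β₁).2, (e β₂).2))) else 0
    let p : W →ₗ[K] (W × W →₀ K) := b.constr K fun β => if (e β).1 = d then
      Finsupp.single (b (e.symm (c₁, (j.symm (e β).2).1)), b (e.symm (c₂, (j.symm (e β).2).2))) 1
      else 0
    have hp : ∀ β, p (b β) = if (e β).1 = d then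
      Finsupp.single (b (e.symm (c₁, (j.symm (e β).2).1)), b (e.symm (c₂, (j.symm (e β).2).2))) 1
      else 0 := fun β => b.constr_basis K _ β
    have henc : ∀ β₁ β₂, enc (b β₁) (b β₂) = if (e β₁).1 = c₁ ∧ (e β₂).1 = c₂ then
        b (e.symm (d, j ((e β₁).2, (e β₂).2))) else 0 := fun β₁ β₂ => by
      simp only [enc, Module.Basis.constr_basis]
    refine ⟨enc, p, ?_, ?_, ?_⟩
    · have : enc.compr₂ (π d) = enc := b.ext fun β₁ => b.ext fun β₂ => by
        rw [LinearMap.compr₂_apply, henc]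
        split_ifs
        · rw [hπ, Equiv.apply_symm_apply, if_pos rfl]
        · rw [map_zero]
      exact fun u v => LinearMap.congr_fun₂ this u v
    · intro c hc
      have : p ∘ₗ π c = 0 := b.ext fun β => by
        rw [LinearMap.comp_apply, hπ]
        split_ifs with h
        · rw [hp, if_neg (h ▸ hc), LinearMap.zero_apply]
        · rw [map_zero, LinearMap.zero_apply]
      exact LinearMap.congr_fun this
    · intro B
      have : enc.compr₂ (Finsupp.linearCombination K (fun w : W × W => B w.1 w.2) ∘ₗ p) =
          B.compl₁₂ (π c₁) (π c₂) := b.ext fun β₁ => b.ext fun β₂ => by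
        rw [LinearMap.compr₂_apply, henc, LinearMap.compl₁₂_apply, hπ, hπ]
        split_ifs with h1 h2 h3 h2 h3
        · rw [LinearMap.comp_apply, hp, Equiv.apply_symm_apply, if_pos rfl]
          rw [Equiv.symm_apply_apply, Finsupp.linearCombination_single, one_smul]
          simp [← h2, ← h3]
        all_goals simp_all
      exact fun u v => LinearMap.congr_fun₂ this u v

end Blocks


/-! ### The filtration is descending -/

section Descending

variable {K : Type*} [Field K] [CharZero K] {𝔤 : Type w} {V : Type v} [AddCommGroup 𝔤] [Module K 𝔤]
  [AddCommGroup V] [Module K V]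

local notation "ι" => LinearMap.inl K 𝔤 V

theorem apply_map_projV {f : List (𝔤 × V) → 𝔤 × V} (hf : IsAlt K f)
    (h : ∀ w, contr (ι w) f = 0) (xs : List (𝔤 × V)) : f (xs.map (projV K 𝔤 V)) = f xs := by
  induction xs generalizing f with
  | nil => rfl
  | cons x xs ih =>
    have h1 := ih (hf.contr (projV K 𝔤 V x)) fun w => contr_contr_eq_zero hf (h w) _
    have h2 := (hf.lin [] xs).map_add (projG K 𝔤 V x) (projV K 𝔤 V x)
    have h3 : f (projG K 𝔤 V x :: xs) = 0 := congrFun (h x.1) xs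
    rw [projG_add_projV] at h2
    simp only [List.nil_append] at h2
    rw [h2, h3, zero_add]
    exact h1

theorem isHorizontal_hat {θ : CochainSum K (𝔤 × V)} (hθ : θ ∈ homogH K 𝔤 V)
    {S : Submodule K (𝔤 × V)} (hS : ∀ xs, hat θ xs ∈ S) : IsHorizontal (ι) S (hat θ) where
  alt := isAlt_hat θ
  contr_eq_zero w := funext fun xs => hat_cons_of_mem_hSub hθ.1 rfl xs
  mem := hS
  homogeneous := by
    obtain ⟨-, n, hn⟩ := hθ
    obtain ⟨q, -, hq⟩ := exists_parity_hat hn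
    exact ⟨q, hq⟩

theorem mem_hSub_of_hat {θ : CochainSum K (𝔤 × V)} (h : ∀ w, contr (ι w) (hat θ) = 0)
    (h2 : ∀ xs, (hat θ xs).2 = 0) : θ ∈ hSub K 𝔤 V := by
  rw [mem_hSub_iff]
  apply hat_injective
  funext xs
  rw [hat_projH, apply_map_projV (isAlt_hat θ) h, projG_apply]
  exact Prod.ext rfl (h2 xs).symm

/-- Bracketing a split cochain with θ gives a split cochain again, except for the terms in which the
value of θ is the argument that is split. -/
theorem exists_nrBracket_of_hat_eq_splitArg {p : 𝔤 × V →ₗ[K] (𝔤 × 𝔤 →₀ K)} {d e t : ℤ}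
    {H G θ : CochainSum K (𝔤 × V)} (hH : H ∈ homog K (𝔤 × V) e) (hG : G ∈ homog K (𝔤 × V) d)
    (h : hat H = splitArg (ι) p (hat G)) (hθ : θ ∈ hSub K 𝔤 V) (ht : θ ∈ homog K (𝔤 × V) t) :
    ∃ G' ∈ homog K (𝔤 × V) (d + t), hat (nrBracket K (𝔤 × V) H θ) =
      splitArg (ι) p (hat G') + splitValue (ι) p (hat G) (hat θ) := by
  obtain ⟨q, -, hq⟩ := exists_parity_hat ht
  have hc : ∀ w, contr (ι w) (hat θ) = 0 := fun w => funext fun xs => hat_cons_of_mem_hSub hθ rfl xs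
  have e1 : hat (circL K (𝔤 × V) H θ) = (-1 : ℤ) ^ q • splitArg (ι) p (hat (circL K (𝔤 × V) G θ)) +
      splitValue (ι) p (hat G) (hat θ) := by
    rw [hat_prod_circL, h, circ_splitArg_left _ _ (isAlt_hat G) (isAlt_hat θ) hc, hq,
      circ_zsmul_right (isAlt_hat G).endLin, splitArg_zsmul, hat_prod_circL]
  have e2 : hat (circL K (𝔤 × V) θ H) = splitArg (ι) p (hat (circL K (𝔤 × V) θ G)) := by
    rw [hat_prod_circL, h, circ_splitArg_right _ _ (isAlt_hat θ) hc, hat_prod_circL]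
  refine ⟨(-1 : ℤ) ^ q • circL K (𝔤 × V) G θ -
    (((e * t).negOnePow : ℤˣ) : ℤ) • circL K (𝔤 × V) θ G,
    Submodule.sub_mem _ (zsmul_mem (circL_prod_mem hG ht) _)
      (zsmul_mem (add_comm t d ▸ circL_prod_mem ht hG) _), ?_⟩
  rw [nrBracket_prod_eq hH ht, Units.smul_def, hat_sub, hat_zsmul, e1, e2, hat_sub, hat_zsmul,
    hat_zsmul, splitArg_sub, splitArg_zsmul, splitArg_zsmul]
  abel

/-- If `p` is blind to the values of all θ's, the iterated bracket is still a split cochain. P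
evaluates it on V, where `p` vanishes. -/
theorem projH_foldBr_eq_zero_of_splitArg {p : 𝔤 × V →ₗ[K] (𝔤 × 𝔤 →₀ K)}
    (hp : ∀ x, p (projV K 𝔤 V x) = 0) {d e : ℤ} {H G : CochainSum K (𝔤 × V)}
    (hH : H ∈ homog K (𝔤 × V) e) (hG : G ∈ homog K (𝔤 × V) d)
    (h : hat H = splitArg (ι) p (hat G)) {θs : List (CochainSum K (𝔤 × V))}
    (hθs : ∀ θ ∈ θs, θ ∈ homogH K 𝔤 V) (hpθ : ∀ θ ∈ θs, ∀ xs, p (hat θ xs) = 0) :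
    projH K 𝔤 V (foldBr θs H) = 0 := by
  induction θs generalizing d e H G with
  | nil =>
    apply hat_injective
    funext xs
    rw [foldBr_nil, hat_projH, h, splitArg_eq_zero, map_zero, hat_zero, Pi.zero_apply]
    intro x hx
    obtain ⟨y, -, rfl⟩ := List.mem_map.1 hx
    exact hp y
  | cons θ θs ih =>
    obtain ⟨h1, t, ht⟩ := hθs θ (by simp)
    obtain ⟨G', hG', he⟩ := exists_nrBracket_of_hat_eq_splitArg hH hG h h1 ht
    rw [splitValue_eq_zero _ _ (hpθ θ (by simp)), add_zero] at he
    rw [foldBr_prod_cons]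
    exact ih (nrBracket_prod_mem hH ht) hG' he (fun z hz => hθs z (by simp [hz])) fun z hz => hpθ z (by simp [hz])

/-- The alternating map `(x, y) ↦ b(x, y) - b(y, x)` on the `𝔤`-components, as a function on
lists. -/
def pairFn (b : 𝔤 →ₗ[K] 𝔤 →ₗ[K] 𝔤) : List (𝔤 × V) → 𝔤 × V
  | [x, y] => (b x.1 y.1 - b y.1 x.1, 0)
  | _ => 0

theorem pairFn_of_length_ne (b : 𝔤 →ₗ[K] 𝔤 →ₗ[K] 𝔤) {l : List (𝔤 × V)} (h : l.length ≠ 2) :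
    pairFn b l = 0 := by
  rcases l with _ | ⟨x, _ | ⟨y, _ | ⟨z, l⟩⟩⟩
  · rfl
  · rfl
  · simp at h
  · rfl

theorem isAlt_pairFn (b : 𝔤 →ₗ[K] 𝔤 →ₗ[K] 𝔤) :
    IsAlt K (pairFn b : List (𝔤 × V) → 𝔤 × V) where
  lin A B := by
    by_cases h : A.length + B.length = 1
    · rcases A with _ | ⟨a, A⟩
      · rcases B with _ | ⟨c, _ | ⟨c', B⟩⟩
        · simp at h
        · constructor
          · intro x y
            simp [pairFn]
            abel
          · intro c x
            simp [pairFn, smul_sub]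
        · simp at h
      · have hA : A = [] := List.length_eq_zero_iff.1 (by simp at h; omega)
        have hB : B = [] := List.length_eq_zero_iff.1 (by simp at h; omega)
        subst hA hB
        constructor
        · intro x y
          simp [pairFn]
          abel
        · intro c x
          simp [pairFn, smul_sub]
    · have h0 : ∀ z, pairFn b (A ++ z :: B) = (0 : 𝔤 × V) := fun z =>
        pairFn_of_length_ne b (by simp; omega)
      constructor <;> intros <;> simp [h0]
  swap A x y B := by
    by_cases h : A.length + B.length = 0
    · have hA : A = [] := List.length_eq_zero_iff.1 (by omega)
      have hB : B = [] := List.length_eq_zero_iff.1 (by omega)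
      subst hA hB
      simp [pairFn]
    · rw [pairFn_of_length_ne b (by simp; omega), pairFn_of_length_ne b (by simp; omega), neg_zero]

/-- Decoding b(u, v) - b(v, u) gives (u, v) alone if the two blocks differ, hence κ = 1. In the same
block it gives (u, v) - (v, u), and an alternating `f` sees this twice, hence κ = 2. -/
theorem contrPairs_pairFn {π₁ π₂ : 𝔤 →ₗ[K] 𝔤} {κ : ℤ} {p : 𝔤 →ₗ[K] (𝔤 × 𝔤 →₀ K)}
    {b : 𝔤 →ₗ[K] 𝔤 →ₗ[K] 𝔤} (hp : ∀ (B : 𝔤 →ₗ[K] 𝔤 →ₗ[K] 𝔤 × V) (u v : 𝔤),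
      Finsupp.linearCombination K (fun w : 𝔤 × 𝔤 => B w.1 w.2) (p (b u v)) = B (π₁ u) (π₂ v))
    (h1 : ∀ w, π₁ (π₁ w) = π₁ w) (h2 : ∀ w, π₂ (π₂ w) = π₂ w)
    (hκ : (κ = 1 ∧ ∀ w, π₁ (π₂ w) = 0) ∨ (κ = 2 ∧ π₁ = π₂))
    {u v : 𝔤 × V} (hu : u ∈ LinearMap.range (ι ∘ₗ π₁)) (hv : v ∈ LinearMap.range (ι ∘ₗ π₂))
    {f : List (𝔤 × V) → 𝔤 × V} (hf : IsAlt K f) :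
    contrPairs (ι) ((p ∘ₗ LinearMap.fst K 𝔤 V) (pairFn b [u, v])) f [] = κ • f [u, v] := by
  obtain ⟨u, rfl⟩ := hu
  obtain ⟨v, rfl⟩ := hv
  let B : 𝔤 →ₗ[K] 𝔤 →ₗ[K] 𝔤 × V := LinearMap.mk₂ K (fun x y => f [ι x, ι y])
    (fun x y z => by simpa using (hf.lin [] [ι z]).map_add (ι x) (ι y))
    (fun c x z => by simpa using (hf.lin [] [ι z]).map_smul c (ι x))
    (fun z x y => by simpa using (hf.lin [ι z] []).map_add (ι x) (ι y))
    (fun c z x => by simpa using (hf.lin [ι z] []).map_smul c (ι x))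
  have hB : ∀ x y, B x y = f [ι x, ι y] := fun x y => rfl
  have e : ∀ x y, contrPairs (ι) (p (b x y)) f [] = B (π₁ x) (π₂ y) := fun x y => hp B x y
  have e1 : (p ∘ₗ LinearMap.fst K 𝔤 V) (pairFn b [(ι ∘ₗ π₁) u, (ι ∘ₗ π₂) v]) =
      p (b (π₁ u) (π₂ v)) + (-1 : K) • p (b (π₂ v) (π₁ u)) := by
    simp [pairFn, sub_eq_add_neg]
  rw [e1, contrPairs_add_left, contrPairs_smul_left, Pi.add_apply, Pi.smul_apply, e, e, h1, h2]
  simp only [LinearMap.comp_apply]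
  rcases hκ with ⟨rfl, h⟩ | ⟨rfl, rfl⟩
  · rw [h, map_zero, LinearMap.zero_apply, hB]
    simp
  · have hs := hf.swap [] (ι (π₁ v)) (ι (π₁ u)) []
    simp only [List.nil_append] at hs
    rw [h1, h1, hB, hB, hs, two_smul]
    simp

end Descending


/-! ### Contracting two elements of 𝔥 with values in given blocks -/

section Blockwise

variable {K : Type*} [Field K] [CharZero K] {𝔤 : Type w} {V : Type v} [AddCommGroup 𝔤] [Module K 𝔤]
  [AddCommGroup V] [Module K V]

local notation "ι" => LinearMap.inl K 𝔤 V

/-- The homogeneous elements of `𝔥` with values in the image of `π`. -/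
def blockH (π : 𝔤 →ₗ[K] 𝔤) : Set (CochainSum K (𝔤 × V)) :=
  {θ | θ ∈ homogH K 𝔤 V ∧ ∀ xs, hat θ xs ∈ LinearMap.range (ι ∘ₗ π)}

variable (K 𝔤 V) in
/-- The homogeneous elements of `L'` with values in `𝔤` or with values in `V`. -/
def pureLPrime : Set (CochainSum K (𝔤 × V)) :=
  {Q | Q ∈ homogLPrime K 𝔤 V ∧ ((∀ xs, (hat Q xs).1 = 0) ∨ ∀ xs, (hat Q xs).2 = 0)}

theorem valueMap_mem_LPrime {φ : 𝔤 × V →ₗ[K] 𝔤 × V}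
    (h : ∀ x, φ (dilation K 𝔤 V x) = dilation K 𝔤 V (φ x)) {Q : CochainSum K (𝔤 × V)}
    (hQ : Q ∈ LPrime K 𝔤 V) : valueMap φ Q ∈ LPrime K 𝔤 V := by
  rw [mem_LPrime_iff, mem_weight] at *
  intro xs
  rw [hat_valueMap, hat_valueMap, hQ, map_smul, h]

theorem span_pureLPrime : Submodule.span K (pureLPrime K 𝔤 V) = LPrime K 𝔤 V := by
  refine le_antisymm (Submodule.span_le.2 fun _ h => h.1.1) ?_
  rw [← span_homogLPrime, Submodule.span_le]
  rintro Q ⟨hQ, n, hn⟩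
  have e : Q = valueMap (projG K 𝔤 V) Q + valueMap (projV K 𝔤 V) Q := by
    apply hat_injective
    funext xs
    rw [hat_add, Pi.add_apply, hat_valueMap, hat_valueMap, projG_add_projV]
  rw [e]
  refine Submodule.add_mem _ (Submodule.subset_span ⟨⟨?_, n, valueMap_mem _ hn⟩, Or.inr ?_⟩)
    (Submodule.subset_span ⟨⟨?_, n, valueMap_mem _ hn⟩, Or.inl ?_⟩)
  · exact valueMap_mem_LPrime (fun x => by simp [projG_apply, dilation_apply]) hQ
  · intro xs
    rw [hat_valueMap, projG_apply]
  · exact valueMap_mem_LPrime (fun x => by simp [projV_apply, dilation_apply]) hQ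
  · intro xs
    rw [hat_valueMap, projV_apply]

theorem valueMap_mem_hSub (π : 𝔤 →ₗ[K] 𝔤) {θ : CochainSum K (𝔤 × V)} (hθ : θ ∈ hSub K 𝔤 V) :
    valueMap (ι ∘ₗ π ∘ₗ LinearMap.fst K 𝔤 V) θ ∈ hSub K 𝔤 V := by
  refine mem_hSub_of_hat (fun w => funext fun xs => ?_) fun xs => ?_
  · rw [contr_apply, hat_valueMap, hat_cons_of_mem_hSub hθ rfl, map_zero]
    rfl
  · rw [hat_valueMap]
    rfl

theorem span_blockH {n : ℕ} {π : Fin n → 𝔤 →ₗ[K] 𝔤} (h : ∑ c, π c = LinearMap.id) :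
    Submodule.span K {θ : CochainSum K (𝔤 × V) | ∃ c, θ ∈ blockH (π c)} = hSub K 𝔤 V := by
  refine le_antisymm (Submodule.span_le.2 ?_) ?_
  · rintro _ ⟨c, h⟩
    exact h.1.1
  rw [← span_homogH, Submodule.span_le]
  rintro θ ⟨hθ, n, hn⟩
  have e : θ = ∑ c, valueMap (ι ∘ₗ π c ∘ₗ LinearMap.fst K 𝔤 V) θ := by
    apply hat_injective
    funext xs
    have h1 := map_sum (hatLin K (𝔤 × V))
      (fun c => valueMap (ι ∘ₗ π c ∘ₗ LinearMap.fst K 𝔤 V) θ) Finset.univ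
    have h2 := congrFun h1 xs
    rw [Finset.sum_apply] at h2
    refine Eq.trans ?_ h2.symm
    have h3 := LinearMap.congr_fun h (hat θ xs).1
    rw [LinearMap.sum_apply] at h3
    have h4 : ∀ c, hatLin K (𝔤 × V) (valueMap (ι ∘ₗ π c ∘ₗ LinearMap.fst K 𝔤 V) θ) xs =
      ι (π c (hat θ xs).1) := fun c => hat_valueMap _ _ _
    simp only [h4]
    rw [← map_sum, h3]
    exact Prod.ext rfl (snd_hat_of_mem_hSub hθ xs)
  rw [e]
  refine Submodule.sum_mem _ fun c _ => Submodule.subset_span ⟨c, ⟨?_, n, ?_⟩, fun xs => ?_⟩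
  · exact valueMap_mem_hSub _ hθ
  · exact valueMap_mem _ hn
  · rw [hat_valueMap]
    exact ⟨(hat θ xs).1, rfl⟩

/-- The single element is R ∘̄ θ₁ ∘̄ θ₂ with R the antisymmetrised encoding. It vanishes on
arguments from 𝔤, since such an argument could only enter R, and then θ₁ ∘̄ θ₂ = 0 would occur. -/
theorem exists_contraction {π₁ π₂ : 𝔤 →ₗ[K] 𝔤} {κ : ℤ} {p : 𝔤 →ₗ[K] (𝔤 × 𝔤 →₀ K)}
    {b : 𝔤 →ₗ[K] 𝔤 →ₗ[K] 𝔤} (hp : ∀ (B : 𝔤 →ₗ[K] 𝔤 →ₗ[K] 𝔤 × V) (u v : 𝔤),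
      Finsupp.linearCombination K (fun w : 𝔤 × 𝔤 => B w.1 w.2) (p (b u v)) = B (π₁ u) (π₂ v))
    (h1 : ∀ w, π₁ (π₁ w) = π₁ w) (h2 : ∀ w, π₂ (π₂ w) = π₂ w)
    (hκ : (κ = 1 ∧ ∀ w, π₁ (π₂ w) = 0) ∨ (κ = 2 ∧ π₁ = π₂))
    {θ₁ θ₂ : CochainSum K (𝔤 × V)} (hθ₁ : θ₁ ∈ blockH π₁) (hθ₂ : θ₂ ∈ blockH π₂)
    {n₁ n₂ : ℕ} (hn₁ : θ₁ ∈ homog K (𝔤 × V) n₁) (hn₂ : θ₂ ∈ homog K (𝔤 × V) n₂) :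
    ∃ θ ∈ hSub K 𝔤 V, θ ∈ homog K (𝔤 × V) (1 + n₁ + n₂ : ℤ) ∧ ∀ Q : CochainSum K (𝔤 × V),
      splitValue (ι) (p ∘ₗ LinearMap.fst K 𝔤 V) (hat Q) (hat θ) =
        κ • circ (circ (hat Q) (hat θ₁)) (hat θ₂) := by
  obtain ⟨R, hR, hRe⟩ := exists_hat_eq (isAlt_pairFn (V := V) b) 1 fun l hl =>
    pairFn_of_length_ne b hl
  have H₁ := isHorizontal_hat hθ₁.1 hθ₁.2
  have H₂ := isHorizontal_hat hθ₂.1 hθ₂.2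
  have hr : LinearMap.range (ι ∘ₗ π₂) ≤ LinearMap.range (ι) := LinearMap.range_comp_le_range _ _
  have he : hat (circL K (𝔤 × V) (circL K (𝔤 × V) R θ₁) θ₂) =
      circ (circ (pairFn b) (hat θ₁)) (hat θ₂) := by
    rw [hat_prod_circL, hat_prod_circL, hRe]
  refine ⟨circL K (𝔤 × V) (circL K (𝔤 × V) R θ₁) θ₂, mem_hSub_of_hat (fun w => ?_) fun xs => ?_,
    circL_prod_mem (circL_prod_mem hR hn₁) hn₂, fun Q => ?_⟩
  · have hl := H₁.alt
    have hc := contr_circ_of_contr_eq_zero (isAlt_pairFn (V := V) b) (H₁.contr_eq_zero w)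
    rw [he, contr_circ, hc, H₂.contr_eq_zero w,
      circ_zero_right (EndLin.circ (isAlt_pairFn b) hl.endLin), zero_add]
    obtain ⟨q, hq⟩ := H₁.parity.homogeneous
    obtain ⟨r, hr'⟩ := H₂.parity.homogeneous
    have hb := (isAlt_pairFn (V := V) b).contr (ι w)
    rw [circ_assoc_of_le_one hb (fun x y l => pairFn_of_length_ne b (by simp)) H₁.parity.alt.endLin
      H₂.parity.alt.endLin hq hr', H₁.parity.circ_eq_zero H₂.parity hr, circ_zero_right hb.endLin]
  · refine snd_hat_circL (snd_hat_circL (fun ys => ?_) _) _ xs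
    rw [hRe]
    rcases ys with _ | ⟨x, _ | ⟨y, _ | ⟨z, l⟩⟩⟩ <;> rfl
  · rw [he]
    exact splitValue_circ_circ hr (isAlt_pairFn b) (fun l hl => pairFn_of_length_ne b hl)
      (fun u hu v hv f hf => contrPairs_pairFn hp h1 h2 hκ hu hv hf) (isAlt_hat Q) H₁ H₂

/-- Splitting trades two arguments in 𝔤 for one in 𝔤, so the degree drops by one and the weight
stays 0. -/
theorem exists_splitArg_mem_LPrime (p : 𝔤 →ₗ[K] (𝔤 × 𝔤 →₀ K)) {Q : CochainSum K (𝔤 × V)}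
    (hQ : Q ∈ LPrime K 𝔤 V) {n : ℕ} (hn : Q ∈ homog K (𝔤 × V) (n + 1 : ℕ)) :
    ∃ F ∈ LPrime K 𝔤 V, F ∈ homog K (𝔤 × V) n ∧
      hat F = splitArg (ι) (p ∘ₗ LinearMap.fst K 𝔤 V) (hat Q) := by
  obtain ⟨F, hF, he⟩ := exists_hat_eq
    ((isAlt_hat Q).splitArg (ι) (p ∘ₗ LinearMap.fst K 𝔤 V)) n fun l hl => by
      have h0 : ∀ (l : List (𝔤 × V)) (f : List (𝔤 × V) → 𝔤 × V) (m : ℕ),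
          (∀ l, l.length ≠ m → f l = 0) → l.length + 1 ≠ m →
          splitArg (ι) (p ∘ₗ LinearMap.fst K 𝔤 V) f l = 0 := by
        intro l
        induction l with
        | nil => exact fun _ _ _ _ => rfl
        | cons x l ih =>
          intro f m hf hm
          simp only [List.length_cons] at hm
          rw [splitArg, ih (contr x f) (m - 1) (fun ys hys => hf _ (by simp; omega)) (by omega),
            sub_zero, contrPairs]
          simp only [Finsupp.linearCombination_apply]
          refine Finset.sum_eq_zero fun w _ => ?_
          simp only
          rw [hf _ (by simp; omega), smul_zero]
      refine h0 l _ (n + 2) (fun ys hys => hat_of_mem_homog hn (by exact_mod_cast hys)) (by omega)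
  refine ⟨F, ?_, hF, he⟩
  rw [mem_LPrime_iff, mem_weight] at *
  intro xs
  rw [he, pow_zero, one_smul]
  refine splitArg_map _ _ (fun w => ?_) (fun x => rfl) (fun ys => ?_) xs
  · simp [dilation_apply]
  · rw [hQ, pow_zero, one_smul]

/-- With F the split form of `Q` and θ the contraction of θ₁, θ₂, the bracket [F, θ] is κ Q ∘̄ θ₁ ∘̄
θ₂ plus a split cochain. The latter dies under the remaining brackets and P, so one bracket with θ
replaces the two insertions. -/
theorem projH_foldBr_circL_mem {π₁ π₂ : 𝔤 →ₗ[K] 𝔤} {p : 𝔤 →ₗ[K] (𝔤 × 𝔤 →₀ K)}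
    {b : 𝔤 →ₗ[K] 𝔤 →ₗ[K] 𝔤} (hp : ∀ (B : 𝔤 →ₗ[K] 𝔤 →ₗ[K] 𝔤 × V) (u v : 𝔤),
      Finsupp.linearCombination K (fun w : 𝔤 × 𝔤 => B w.1 w.2) (p (b u v)) = B (π₁ u) (π₂ v))
    (h1 : ∀ w, π₁ (π₁ w) = π₁ w) (h2 : ∀ w, π₂ (π₂ w) = π₂ w)
    (h12 : (∀ w, π₁ (π₂ w) = 0) ∨ π₁ = π₂)
    {θ₁ θ₂ : CochainSum K (𝔤 × V)} (hθ₁ : θ₁ ∈ blockH π₁) (hθ₂ : θ₂ ∈ blockH π₂)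
    {Q : CochainSum K (𝔤 × V)} (hQ : Q ∈ LPrime K 𝔤 V) {n : ℕ}
    (hn : Q ∈ homog K (𝔤 × V) (n + 1 : ℕ)) {θs : List (CochainSum K (𝔤 × V))}
    (hθs : ∀ θ ∈ θs, θ ∈ homogH K 𝔤 V) (hpθ : ∀ θ ∈ θs, ∀ xs, p (hat θ xs).1 = 0) :
    projH K 𝔤 V (foldBr θs (circL K (𝔤 × V) (circL K (𝔤 × V) Q θ₁) θ₂)) ∈
      (derivedSpace K 𝔤 V (θs.length + 1)).map (projH K 𝔤 V) := by
  obtain ⟨κ, hκ0, hκ⟩ : ∃ κ : ℤ, κ ≠ 0 ∧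
      ((κ = 1 ∧ ∀ w, π₁ (π₂ w) = 0) ∨ (κ = 2 ∧ π₁ = π₂)) := by
    rcases h12 with h | h
    · exact ⟨1, one_ne_zero, Or.inl ⟨rfl, h⟩⟩
    · exact ⟨2, two_ne_zero, Or.inr ⟨rfl, h⟩⟩
  obtain ⟨-, n₁, hn₁⟩ := hθ₁.1
  obtain ⟨-, n₂, hn₂⟩ := hθ₂.1
  obtain ⟨θ, hθh, ht, e⟩ := exists_contraction hp h1 h2 hκ hθ₁ hθ₂ hn₁ hn₂
  obtain ⟨F, hF, hFn, hFe⟩ := exists_splitArg_mem_LPrime p hQ hn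
  obtain ⟨G, hG, hGe⟩ := exists_nrBracket_of_hat_eq_splitArg hFn hn hFe hθh ht
  have hz := projH_foldBr_eq_zero_of_splitArg (p := p ∘ₗ LinearMap.fst K 𝔤 V) (θs := θs)
    (H := nrBracket K (𝔤 × V) F θ - κ • circL K (𝔤 × V) (circL K (𝔤 × V) Q θ₁) θ₂)
    (fun x => by simp [projV_apply]) (G := G) (e := n + (1 + n₁ + n₂)) ?_ hG ?_ hθs hpθ
  · rw [map_sub, map_sub, sub_eq_zero, map_zsmul, map_zsmul] at hz
    have hmem : projH K 𝔤 V (foldBr (θ :: θs) F) ∈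
        (derivedSpace K 𝔤 V (θs.length + 1)).map (projH K 𝔤 V) := by
      refine Submodule.mem_map_of_mem (foldBr_mem_derivedSpace hF (θs := θ :: θs) ?_)
      intro z hz
      rcases List.mem_cons.1 hz with rfl | hz
      · exact hθh
      · exact (hθs z hz).1
    rw [foldBr_prod_cons, hz, ← Int.cast_smul_eq_zsmul K] at hmem
    exact (Submodule.smul_mem_iff _ (Int.cast_ne_zero.2 hκ0)).1 hmem
  · refine Submodule.sub_mem _ (nrBracket_prod_mem hFn ht) (zsmul_mem ?_ _)
    have := circL_prod_mem (circL_prod_mem hn hn₁) hn₂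
    rwa [show ((n + 1 : ℕ) : ℤ) + n₁ + n₂ = n + (1 + n₁ + n₂) by push_cast; ring] at this
  · rw [hat_sub, hat_zsmul, hGe, e, hat_prod_circL, hat_prod_circL, add_sub_cancel_right]

end Blockwise


/-! ### The inclusions between successive steps of the filtration -/

section DescendingFiltration

variable {K : Type*} [Field K] [CharZero K] {𝔤 : Type w} {V : Type v} [AddCommGroup 𝔤] [Module K 𝔤]
  [AddCommGroup V] [Module K V]

/-- An element of L' of degree `m` is nonzero only with at least `m` arguments in 𝔤, and these are
linearly dependent. -/
theorem eq_zero_of_finrank_lt {m : ℕ} [Module.Finite K 𝔤] (h : Module.finrank K 𝔤 < m)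
    {Q : CochainSum K (𝔤 × V)} (hQ : Q ∈ LPrime K 𝔤 V) (hm : Q ∈ homog K (𝔤 × V) m) : Q = 0 := by
  have h0 : Q m = 0 := by
    apply AlternatingMap.coe_multilinearMap_injective
    refine multilinearMap_ext_prod fun S x h1 h2 => ?_
    change Q m x = 0
    by_cases hS : S.card < m
    · refine ((mem_LPrime K 𝔤 V).1 hQ m S x h1 fun i hi => h2 i (Finset.mem_compl.1 hi)).2.2
        (fun h => ?_) fun h => ?_
      · omega
      · omega
    · refine AlternatingMap.map_linearDependent _ _ fun hli => ?_
      have hli' : LinearIndependent K fun i : S => (x i).1 := by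
        refine LinearIndependent.of_comp (LinearMap.inl K 𝔤 V) ?_
        have e : (LinearMap.inl K 𝔤 V ∘ fun i : S => (x i).1) = fun i : S => x i :=
          funext fun i => Prod.ext rfl (h1 i i.2).symm
        rw [e]
        exact hli.comp _ Subtype.val_injective
      have := hli'.fintype_card_le_finrank
      rw [Fintype.card_coe] at this
      omega
  rw [eq_lof_of_mem_homog hm, h0, map_zero]

/-- The projection I of 𝔤 ⊕ V to 𝔤 belongs to L' and satisfies [I, θ] = θ, so one bracket already
reaches all of 𝔥. -/
theorem hSub_le_map_projH : hSub K 𝔤 V ≤ (derivedSpace K 𝔤 V 1).map (projH K 𝔤 V) := by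
  rw [← span_homogH, Submodule.span_le]
  rintro θ ⟨hθ, n, hn⟩
  let f : Cochain K (𝔤 × V) 0 :=
    AlternatingMap.ofSubsingleton K (𝔤 × V) (𝔤 × V) (0 : Fin 1) (projG K 𝔤 V)
  let I := DirectSum.lof K ℕ (Cochain K (𝔤 × V)) 0 f
  have hI0 : I ∈ homog K (𝔤 × V) (0 : ℕ) := lof_mem_homog f
  have h1 : ∀ x, hat I [x] = projG K 𝔤 V x := fun x => by
    rw [hat_of_length I (n := 0) _ rfl, DirectSum.lof_apply]
    rfl
  have h2 : ∀ l : List (𝔤 × V), l.length ≠ 1 → hat I l = 0 := fun l hl => hat_lof_of_ne _ hl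
  have hI : I ∈ LPrime K 𝔤 V := by
    rw [mem_LPrime_iff, mem_weight]
    intro xs
    rw [pow_zero, one_smul]
    by_cases hl : xs.length = 1
    · obtain ⟨x, rfl⟩ := List.length_eq_one_iff.1 hl
      rw [List.map_cons, List.map_nil, h1, h1]
      simp [projG_apply, dilation_apply]
    · rw [h2 _ hl, h2 _ (by simpa using hl), map_zero]
  have hs : ∀ xs, (hat I xs).2 = 0 := by
    intro xs
    by_cases hl : xs.length = 1
    · obtain ⟨x, rfl⟩ := List.length_eq_one_iff.1 hl
      rw [h1, projG_apply]
    · rw [h2 _ hl]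
      rfl
  have e : nrBracket K (𝔤 × V) I θ = θ := by
    rw [nrBracket_eq_circL hs hI0 ⟨hθ, n, hn⟩]
    apply hat_injective
    funext xs
    rw [hat_prod_circL, circ_of_le_one (isAlt_hat I) (fun x y l => h2 _ (by simp)), h1, projG_apply]
    exact Prod.ext rfl (snd_hat_of_mem_hSub hθ xs).symm
  refine ⟨nrBracket K (𝔤 × V) I θ, Submodule.apply_mem_map₂ _ hI hθ, ?_⟩
  rw [e]
  exact mem_hSub_iff.1 hθ

/-- Two of the `m + 1` elements of 𝔥 are merged into one. The merging needs a block of 𝔤 missed by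
the other `m - 1`; too small a dimension for this forces `Q = 0`, and `m = 1` is covered by
`hSub_le_map_projH`. -/
theorem map_projH_derivedSpace_succ_le {m : ℕ} (hm : 1 ≤ m) :
    (derivedSpace K 𝔤 V (m + 1)).map (projH K 𝔤 V) ≤
      (derivedSpace K 𝔤 V m).map (projH K 𝔤 V) := by
  rcases hm.eq_or_lt with rfl | hm
  · refine le_trans ?_ hSub_le_map_projH
    rintro _ ⟨a, -, rfl⟩
    exact projH_mem a
  by_cases hfin : Module.Finite K 𝔤 → m ≤ Module.finrank K 𝔤
  swap
  · push Not at hfin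
    obtain ⟨hf, hlt⟩ := hfin
    refine map_projH_derivedSpace_le fun Q ⟨hQ, n, hn⟩ θs hl hθ => ?_
    by_cases hnm : n = m
    · subst hnm
      rw [eq_zero_of_finrank_lt hlt hQ hn, map_zero, map_zero]
      exact Submodule.zero_mem _
    · rw [projH_foldBr_eq_zero hQ hn hθ (by omega)]
      exact Submodule.zero_mem _
  obtain ⟨N, π, hN, hsum, hπ, hex⟩ := exists_blocks K 𝔤 (𝔤 × V) m (by omega) hfin
  rw [derivedSpace_eq_span span_pureLPrime (span_blockH hsum), Submodule.map_span_le]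
  rintro _ ⟨Q, ⟨⟨hQ, n, hn⟩, hQ'⟩, θs, hl, hθ, rfl⟩
  have hθ' : ∀ θ ∈ θs, θ ∈ homogH K 𝔤 V := fun θ h => by
    obtain ⟨c, hc⟩ := hθ θ h
    exact hc.1
  by_cases hnm : n = m
  swap
  · rw [projH_foldBr_eq_zero hQ hn hθ' (by omega)]
    exact Submodule.zero_mem _
  subst hnm
  obtain ⟨n, rfl⟩ := Nat.exists_eq_add_of_le' hm.le
  refine projH_foldBr_mem_of_pairs hn hQ' hθ' (by omega) fun θ₁ θ₂ rest hp => ?_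
  obtain ⟨c₁, h₁⟩ := hθ θ₁ (hp.subset (by simp))
  obtain ⟨c₂, h₂⟩ := hθ θ₂ (hp.subset (by simp))
  have hrest : ∀ θ ∈ rest, θ ∈ θs := fun θ h => hp.subset (by simp [h])
  have hlen : rest.length + 1 = n + 1 := by
    have := hp.length_eq
    simp only [List.length_cons] at this
    omega
  have : Nonempty (Fin N) := ⟨c₁⟩
  choose! c hc using hθ
  -- `rest` has `n` elements and there are at least `n + 1` blocks, so a free block for the code
  -- exists.
  obtain ⟨d, hd⟩ : ∃ d, d ∉ rest.map c := by
    by_contra! hall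
    have h3 : (Finset.univ : Finset (Fin N)) ⊆ (rest.map c).toFinset := fun d _ => by
      simpa using hall d
    have h4 := Finset.card_le_card h3
    have h5 := List.toFinset_card_le (rest.map c)
    rw [Finset.card_univ, Fintype.card_fin] at h4
    rw [List.length_map] at h5
    omega
  obtain ⟨b, p, -, hpc, hpe⟩ := hex c₁ c₂ d
  rw [← hlen]
  refine projH_foldBr_circL_mem hpe (fun w => ?_) (fun w => ?_) ?_ h₁ h₂ hQ hn
    (fun θ h => hθ' θ (hrest θ h)) fun θ h xs => ?_
  · rw [hπ, if_pos rfl]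
  · rw [hπ, if_pos rfl]
  · by_cases h12 : c₁ = c₂
    · exact Or.inr (by rw [h12])
    · exact Or.inl fun w => by rw [hπ, if_neg h12]
  · obtain ⟨w, hw⟩ := (hc θ (hrest θ h)).2 xs
    rw [← hw]
    refine hpc (c θ) (fun hcd => hd ?_) w
    rw [← hcd]
    exact List.mem_map_of_mem h

theorem ctrlFiltration_succ_le {k : ℕ} (hk : 1 ≤ k) :
    ctrlFiltration K 𝔤 V (k + 1) ≤ ctrlFiltration K 𝔤 V k := by
  rcases hk.eq_or_lt with rfl | hk
  · exact le_top
  · intro x hx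
    rw [mem_ctrlFiltration (by omega)] at hx ⊢
    refine ⟨hx.1, ?_⟩
    have := hx.2
    obtain ⟨k, rfl⟩ := Nat.exists_eq_add_of_le' hk
    exact map_projH_derivedSpace_succ_le (by omega) this

end DescendingFiltration


/-! ### Maurer–Cartan elements -/

section MaurerCartan

variable {K : Type*} [Field K] [CharZero K] {𝔤 : Type w} {V : Type v} [AddCommGroup 𝔤] [Module K 𝔤]
  [AddCommGroup V] [Module K V]

theorem rop_replicate {M : Type*} [AddCommGroup M] [Module K M]
    (x : ℤ × (CochainSum K M × CochainSum K M)) (k : ℕ) (a : CochainSum K M) :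
    rop (List.replicate k x) a = foldBr (List.replicate k x.2.2) a := by
  induction k generalizing a with
  | zero => rfl
  | succ k ih => exact ih _

/-- For θ of degree 0 all signs are trivial, so each of the `k + 1` positions of π contributes the
same iterated bracket. -/
theorem derivedSum_replicate {M : Type*} [AddCommGroup M] [Module K M] {d : ℤ}
    {π θ : CochainSum K M} (hπ : π ∈ homog K M d) (hθ : θ ∈ homog K M 0)
    (x : ℤ × (CochainSum K M × CochainSum K M)) (h1 : x.2.1 = π) (h2 : x.2.2 = θ) (k : ℕ) :
    derivedSum (List.replicate (k + 1) x) = (k + 1) • foldBr (List.replicate k θ) π := by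
  have hmem : ∀ k, foldBr (List.replicate k θ) π ∈ homog K M d := by
    intro k
    induction k with
    | zero => exact hπ
    | succ k ih =>
      rw [List.replicate_succ', foldBr_append_singleton]
      simpa using nrBracket_mem ih hθ
  induction k with
  | zero =>
    rw [List.replicate_one, derivedSum_cons, derivedSum, map_zero, h1]
    simp [foldBr_nil, rop]
  | succ k ih =>
    rw [List.replicate_succ, derivedSum_cons, ih, rop_replicate, h1, h2, map_nsmul,
      lop_eq hθ (hmem k), ← foldBr_append_singleton, ← List.replicate_succ', zero_mul,
      Int.negOnePow_zero, one_smul, succ_nsmul _ (k + 1)]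

theorem bracketPair_replicate {M : Type*} [AddCommGroup M] [Module K M]
    (x : ℤ × (CochainSum K M × CochainSum K M)) {k : ℕ} (hk : k ≠ 2) :
    bracketPair (List.replicate k x) = 0 := by
  rcases k with _ | _ | _ | k
  · rfl
  · rfl
  · exact absurd rfl hk
  · rfl

theorem derivedBracket_const_fst (α : Ctrl K 𝔤 V) {k : ℕ} (hk : k ≠ 2) :
    ((derivedBracket K 𝔤 V k fun _ => α).1 : CochainSum K (𝔤 × V)) = 0 := by
  rw [derivedBracket_apply, List.ofFn_const]
  change bracketPair ((List.replicate k α).map raw) = 0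
  rw [List.map_replicate, bracketPair_replicate _ hk]

theorem derivedBracket_two_fst {α : Ctrl K 𝔤 V}
    (h : (α.1 : CochainSum K (𝔤 × V)) ∈ homog K (𝔤 × V) 1) :
    ((derivedBracket K 𝔤 V 2 fun _ => α).1 : CochainSum K (𝔤 × V)) =
      -nrBracket K (𝔤 × V) α.1 α.1 := by
  have e : ((derivedBracket K 𝔤 V 2 fun _ => α).1 : CochainSum K (𝔤 × V)) =
    nrBracket K (𝔤 × V) (par K (𝔤 × V) α.1) α.1 := rfl
  rw [e, par_of_mem h, Int.negOnePow_one, Units.neg_smul, one_smul, map_neg, LinearMap.neg_apply]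

theorem derivedBracket_const_snd {α : Ctrl K 𝔤 V}
    (h : (α.1 : CochainSum K (𝔤 × V)) ∈ homog K (𝔤 × V) 1)
    (h' : (α.2 : CochainSum K (𝔤 × V)) ∈ homog K (𝔤 × V) 0) (k : ℕ) :
    ((derivedBracket K 𝔤 V (k + 1) fun _ => α).2 : CochainSum K (𝔤 × V)) =
      (k + 1) • projH K 𝔤 V (foldBr (List.replicate k (α.2 : CochainSum K (𝔤 × V))) α.1) := by
  rw [derivedBracket_apply, List.ofFn_const]
  change projH K 𝔤 V (derivedSum ((List.replicate (k + 1) α).map raw)) = _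
  rw [List.map_replicate, derivedSum_replicate h h' (raw α) rfl rfl, map_nsmul]

/-- The L'-component has degree 1, so by weights only brackets with exactly two copies of the
𝔥-component survive P. -/
theorem projH_foldBr_replicate {α : Ctrl K 𝔤 V}
    (h : (α.1 : CochainSum K (𝔤 × V)) ∈ homog K (𝔤 × V) 1)
    (h' : (α.2 : CochainSum K (𝔤 × V)) ∈ homog K (𝔤 × V) 0) {k : ℕ} (hk : k ≠ 2) :
    projH K 𝔤 V (foldBr (List.replicate k (α.2 : CochainSum K (𝔤 × V))) α.1) = 0 := by
  refine projH_foldBr_eq_zero (q := 1) α.1.2 h (fun θ hθ => ?_) (by simpa using hk.symm)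
  rw [List.eq_of_mem_replicate hθ]
  exact ⟨α.2.2, 0, h'⟩

theorem derivedBracket_const_eq_zero {α : Ctrl K 𝔤 V}
    (h : (α.1 : CochainSum K (𝔤 × V)) ∈ homog K (𝔤 × V) 1)
    (h' : (α.2 : CochainSum K (𝔤 × V)) ∈ homog K (𝔤 × V) 0) {k : ℕ} (hk : 1 ≤ k) (h2 : k ≠ 2)
    (h3 : k ≠ 3) : (derivedBracket K 𝔤 V k fun _ => α) = 0 := by
  obtain ⟨k, rfl⟩ := Nat.exists_eq_add_of_le' hk
  refine ctrl_ext (derivedBracket_const_fst α h2) ?_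
  rw [derivedBracket_const_snd h h', projH_foldBr_replicate h h' (by omega), smul_zero]
  rfl

/-- If all but the second and the third operation vanish on `α`, then the Maurer–Cartan series
is a finite sum. -/
theorem isMaurerCartan_iff_of_eq_zero {E : Type*} [AddCommGroup E] [Module K E]
    {𝒜 : ℤ → Submodule K E} (A : LInfinityAlgebra 𝒜) (F : ℕ → Submodule K E) {α : E}
    (hα : α ∈ 𝒜 0) (h : ∀ k, 1 ≤ k → k ≠ 2 → k ≠ 3 → (A.l k fun _ => α) = 0)
    {n : ℕ} (hn : 1 ≤ n) (hF : ∀ x ∈ F n, x ∈ 𝒜 1 → x = 0) :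
    IsMaurerCartan A F α ↔
      (2 : K)⁻¹ • (A.l 2 fun _ => α) + (6 : K)⁻¹ • (A.l 3 fun _ => α) = 0 := by
  have hsum : ∀ N ≥ 3, ∑ k ∈ Finset.Icc 1 N, (k.factorial : K)⁻¹ • A.l k (fun _ => α) =
      (2 : K)⁻¹ • (A.l 2 fun _ => α) + (6 : K)⁻¹ • (A.l 3 fun _ => α) := by
    intro N hN
    have hsub : ({2, 3} : Finset ℕ) ⊆ Finset.Icc 1 N := by
      intro k hk
      simp only [Finset.mem_insert, Finset.mem_singleton] at hk
      rw [Finset.mem_Icc]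
      omega
    rw [← Finset.sum_subset hsub, Finset.sum_pair (by norm_num)]
    · norm_num [Nat.factorial]
    · intro k hk hk'
      simp only [Finset.mem_insert, Finset.mem_singleton, not_or] at hk'
      rw [h k (Finset.mem_Icc.1 hk).1 hk'.1 hk'.2, smul_zero]
  have hmem : ∀ k, (A.l k fun _ => α) ∈ 𝒜 1 := fun k => by
    simpa using A.degree_one k (fun _ => 0) (fun _ => α) fun _ => hα
  constructor
  · rintro ⟨-, hm⟩
    -- The partial sums are constant from 3 on and of degree 1, and `F n` meets that degree only in
    -- 0; convergence to 0 therefore means that this constant is 0.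
    obtain ⟨N₀, hN₀⟩ := hm n hn
    have := hN₀ (max N₀ 3) (le_max_left _ _)
    rw [hsum _ (le_max_right _ _)] at this
    exact hF _ this (Submodule.add_mem _ (Submodule.smul_mem _ _ (hmem 2))
      (Submodule.smul_mem _ _ (hmem 3)))
  · intro h0
    refine ⟨hα, fun m _ => ⟨3, fun N hN => ?_⟩⟩
    rw [hsum N hN, h0]
    exact Submodule.zero_mem _

end MaurerCartan


/-! ### Relative Rota–Baxter Lie algebras as Maurer–Cartan elements -/

section RelativeRotaBaxter

variable {K : Type*} [Field K] [CharZero K] {𝔤 : Type w} {V : Type v} [AddCommGroup 𝔤] [Module K 𝔤]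
  [AddCommGroup V] [Module K V]

/-- On α the binary operation takes values in s⁻¹L' and the ternary one in 𝔥, so their sum vanishes
only if both do. The fourth step of the filtration is the first with no part in degree 1. -/
theorem isMaurerCartan_ctrlLInfinity_iff {α : Ctrl K 𝔤 V}
    (h : (α.1 : CochainSum K (𝔤 × V)) ∈ homog K (𝔤 × V) 1)
    (h' : (α.2 : CochainSum K (𝔤 × V)) ∈ homog K (𝔤 × V) 0) :
    IsMaurerCartan (ctrlLInfinity K 𝔤 V) (ctrlFiltration K 𝔤 V) α ↔
      nrBracket K (𝔤 × V) α.1 α.1 = 0 ∧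
        projH K 𝔤 V (nrBracket K (𝔤 × V) (nrBracket K (𝔤 × V) α.1 α.2) α.2) = 0 := by
  have hα : α ∈ ctrlGrading K 𝔤 V 0 := mem_ctrlGrading.2 ⟨by simpa using h, h'⟩
  have h0 : ∀ k, 1 ≤ k → k ≠ 2 → k ≠ 3 → ((ctrlLInfinity K 𝔤 V).l k fun _ => α) = 0 :=
    fun k hk h2 h3 => derivedBracket_const_eq_zero h h' hk h2 h3
  have hF : ∀ x ∈ ctrlFiltration K 𝔤 V 4, x ∈ ctrlGrading K 𝔤 V 1 → x = 0 :=
    fun x hx hi => eq_zero_of_mem_ctrlFiltration (by norm_num) (by norm_num) hx hi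
  have key := isMaurerCartan_iff_of_eq_zero (E := Ctrl K 𝔤 V) (𝒜 := ctrlGrading K 𝔤 V)
    (ctrlLInfinity K 𝔤 V) (ctrlFiltration K 𝔤 V) hα h0 (n := 4) (by norm_num) hF
  refine key.trans ?_
  have e2 : (ctrlSnd K 𝔤 V) (derivedBracket K 𝔤 V 2 fun _ => α) = 0 := by
    change ((derivedBracket K 𝔤 V 2 fun _ => α).2 : CochainSum K (𝔤 × V)) = 0
    rw [derivedBracket_const_snd h h', projH_foldBr_replicate h h' (by norm_num), smul_zero]
  have e3 : (ctrlFst K 𝔤 V) (derivedBracket K 𝔤 V 3 fun _ => α) = 0 :=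
    derivedBracket_const_fst α (k := 3) (by norm_num)
  have e2' : (ctrlFst K 𝔤 V) (derivedBracket K 𝔤 V 2 fun _ => α) =
    -nrBracket K (𝔤 × V) α.1 α.1 := derivedBracket_two_fst h
  have e3' : (ctrlSnd K 𝔤 V) (derivedBracket K 𝔤 V 3 fun _ => α) =
      3 • projH K 𝔤 V (nrBracket K (𝔤 × V) (nrBracket K (𝔤 × V) α.1 α.2) α.2) :=
    derivedBracket_const_snd h h' 2
  have hz : ∀ x : Ctrl K 𝔤 V, x = 0 ↔ ctrlFst K 𝔤 V x = 0 ∧ ctrlSnd K 𝔤 V x = 0 := fun x =>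
    ⟨fun hx => by rw [hx, map_zero, map_zero]; exact ⟨rfl, rfl⟩, fun hx => ctrl_ext hx.1 hx.2⟩
  have h6 : (6 : K)⁻¹ ≠ 0 := inv_ne_zero (by norm_num)
  have h2 : (2 : K)⁻¹ ≠ 0 := inv_ne_zero (by norm_num)
  change (2 : K)⁻¹ • derivedBracket K 𝔤 V 2 (fun _ => α) +
    (6 : K)⁻¹ • derivedBracket K 𝔤 V 3 (fun _ => α) = 0 ↔ _
  rw [hz, map_add, map_add, map_smul, map_smul, map_smul, map_smul, e2, e3, e2', e3', smul_zero,
    add_zero, smul_zero, zero_add, smul_eq_zero, smul_eq_zero, neg_eq_zero,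
    ← Nat.cast_smul_eq_nsmul K, smul_eq_zero]
  simp

theorem eq_zero_iff_hat {M : Type*} [AddCommGroup M] [Module K M] {n : ℕ} {a : CochainSum K M}
    (ha : a ∈ homog K M n) : a = 0 ↔ ∀ l : List M, l.length = n + 1 → hat a l = 0 := by
  refine ⟨fun h l _ => by rw [h, hat_zero, Pi.zero_apply], fun h => hat_injective ?_⟩
  funext l
  rw [hat_zero, Pi.zero_apply]
  by_cases hl : l.length = n + 1
  · exact h l hl
  · exact hat_of_mem_homog ha (by exact_mod_cast hl)

theorem hat_liftPi (μ : 𝔤 [⋀^Fin 2]→ₗ[K] 𝔤) (ρ : 𝔤 →ₗ[K] V →ₗ[K] V) (a b : 𝔤 × V) :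
    hat (DirectSum.lof K ℕ (Cochain K (𝔤 × V)) 1 (liftPi μ ρ)) [a, b] =
      (μ ![a.1, b.1], ρ a.1 b.2 - ρ b.1 a.2) := by
  rw [hat_of_length _ (n := 1) _ rfl, DirectSum.lof_apply]
  rfl

theorem hat_liftT (T : V →ₗ[K] 𝔤) (a : 𝔤 × V) :
    hat (DirectSum.lof K ℕ (Cochain K (𝔤 × V)) 0 (liftT T)) [a] = (T a.2, 0) := by
  rw [hat_of_length _ (n := 0) _ rfl, DirectSum.lof_apply]
  rfl

section

variable {M : Type*} [AddCommGroup M] [Module K M]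

/-- In odd degree the commutator of P with itself is 2 P ∘̄ P, and P ∘̄ P is the Jacobiator. -/
theorem hat_nrBracket_self {P : CochainSum K M} (hP : P ∈ homog K M 1) (a b c : M) :
    hat (nrBracket K M P P) [a, b, c] = (2 : K) • (hat P [hat P [a, b], c] +
      hat P [hat P [b, c], a] + hat P [hat P [c, a], b]) := by
  have h0 : hat P [] = 0 := rfl
  have h1 : ∀ x, hat P [x] = 0 := fun x => hat_of_mem_homog hP (by simp)
  have h3 : ∀ x y z l, hat P (x :: y :: z :: l) = 0 := fun x y z l =>
    hat_of_mem_homog hP (by simp; omega)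
  have hl := (isAlt_hat P).lin
  have hn : ∀ x y, hat P [x, -y] = -hat P [x, y] := fun x y => (hl [x] []).map_neg y
  have hn' : ∀ x y, hat P [-x, y] = -hat P [x, y] := fun x y => (hl [] [y]).map_neg x
  have hs : ∀ x y, hat P [x, y] = -hat P [y, x] := fun x y => (isAlt_hat P).swap [] x y []
  have hc : circ (hat P) (hat P) [a, b, c] = hat P [hat P [a, b], c] +
      hat P [hat P [b, c], a] + hat P [hat P [c, a], b] := by
    rw [hs c a, hn', hs (hat P [a, b]), hs (hat P [b, c]), hs (hat P [a, c])]
    simp [circ, contr, parity, h0, h1, h3, hn]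
    abel
  rw [nrBracket_eq hP hP, hat_sub, Units.smul_def, hat_zsmul, hat_circL, Pi.sub_apply, Pi.smul_apply,
    hc, two_smul]
  simp
  abel

theorem hat_nrBracket_of_degree_zero {P T : CochainSum K M} (hP : P ∈ homog K M 1)
    (hT : T ∈ homog K M 0) (a b : M) :
    hat (nrBracket K M P T) [a, b] =
      hat P [hat T [a], b] + hat P [a, hat T [b]] - hat T [hat P [a, b]] := by
  have h1 : ∀ x, hat P [x] = 0 := fun x => hat_of_mem_homog hP (by simp)
  have h3 : ∀ x y z l, hat P (x :: y :: z :: l) = 0 := fun x y z l =>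
    hat_of_mem_homog hP (by simp; omega)
  have h2' : ∀ x y l, hat T (x :: y :: l) = 0 := fun x y l =>
    hat_of_mem_homog hT (by simp; omega)
  have hl := (isAlt_hat P).lin
  have hn : ∀ x y, hat P [x, -y] = -hat P [x, y] := fun x y => (hl [x] []).map_neg y
  have hz : ∀ x, hat P [x, 0] = 0 := fun x => (hl [x] []).map_zero
  have hs : hat P [hat T [a], b] = -hat P [b, hat T [a]] := (isAlt_hat P).swap [] _ _ []
  have hc : circ (hat P) (hat T) [a, b] = hat P [hat T [a], b] + hat P [a, hat T [b]] := by
    rw [hs]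
    simp [circ, contr, parity, h1, h3, hn, h2']
  rw [nrBracket_eq hP hT, mul_zero, Int.negOnePow_zero, one_smul, hat_sub, hat_circL, hat_circL,
    Pi.sub_apply, hc, circ_of_le_one (isAlt_hat T) h2']

/-- Terms with T applied twice in a row vanish, and each remaining term arises from both brackets;
hence the factor 2. -/
theorem hat_nrBracket_nrBracket {P T : CochainSum K M} (hP : P ∈ homog K M 1)
    (hT : T ∈ homog K M 0) (hTT : ∀ x, hat T [hat T [x]] = 0) (a b : M) :
    hat (nrBracket K M (nrBracket K M P T) T) [a, b] = (2 : K) • (hat P [hat T [a], hat T [b]] -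
      hat T [hat P [hat T [a], b] + hat P [a, hat T [b]]]) := by
  have hB : nrBracket K M P T ∈ homog K M 1 := by simpa using nrBracket_mem hP hT
  have hl := (isAlt_hat P).lin
  have hz : ∀ x, hat P [x, 0] = 0 := fun x => (hl [x] []).map_zero
  have hz' : ∀ x, hat P [0, x] = 0 := fun x => (hl [] [x]).map_zero
  have hs := ((isAlt_hat T).lin [] []).map_sub
  have ha := ((isAlt_hat T).lin [] []).map_add
  simp only [List.nil_append] at hs ha
  rw [hat_nrBracket_of_degree_zero hB hT, hat_nrBracket_of_degree_zero hP hT,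
    hat_nrBracket_of_degree_zero hP hT, hat_nrBracket_of_degree_zero hP hT, hTT, hTT, hz, hz', hs,
    hTT, ha, two_smul]
  abel

end

theorem isRelRotaBaxterLie_iff (μ : 𝔤 [⋀^Fin 2]→ₗ[K] 𝔤) (ρ : 𝔤 →ₗ[K] V →ₗ[K] V) (T : V →ₗ[K] 𝔤) :
    IsRelRotaBaxterLie μ ρ T ↔
      IsMaurerCartan (ctrlLInfinity K 𝔤 V) (ctrlFiltration K 𝔤 V) (ctrlPoint μ ρ T) := by
  have hπ : DirectSum.lof K ℕ (Cochain K (𝔤 × V)) 1 (liftPi μ ρ) ∈ homog K (𝔤 × V) 1 :=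
    lof_mem_homog _
  have hT : DirectSum.lof K ℕ (Cochain K (𝔤 × V)) 0 (liftT T) ∈ homog K (𝔤 × V) 0 :=
    lof_mem_homog _
  have hTT : ∀ x, hat (DirectSum.lof K ℕ (Cochain K (𝔤 × V)) 0 (liftT T))
      [hat (DirectSum.lof K ℕ (Cochain K (𝔤 × V)) 0 (liftT T)) [x]] = 0 := fun x => by
    rw [hat_liftT, hat_liftT, map_zero]
    rfl
  have e0 : ∀ y : 𝔤, μ ![0, y] = 0 := fun y => μ.map_coord_zero 0 rfl
  have e1 : ∀ y : 𝔤, μ ![y, 0] = 0 := fun y => μ.map_coord_zero 1 rfl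
  have h1 : nrBracket K (𝔤 × V) (DirectSum.lof K ℕ _ 1 (liftPi μ ρ))
      (DirectSum.lof K ℕ _ 1 (liftPi μ ρ)) = 0 ↔
      (∀ x y z : 𝔤, μ ![μ ![x, y], z] + μ ![μ ![y, z], x] + μ ![μ ![z, x], y] = 0) ∧
        ∀ (x y : 𝔤) (v : V), ρ (μ ![x, y]) v = ρ x (ρ y v) - ρ y (ρ x v) := by
    have hm : nrBracket K (𝔤 × V) (DirectSum.lof K ℕ _ 1 (liftPi μ ρ))
      (DirectSum.lof K ℕ _ 1 (liftPi μ ρ)) ∈ homog K (𝔤 × V) ((2 : ℕ) : ℤ) := nrBracket_mem hπ hπ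
    rw [eq_zero_iff_hat hm]
    constructor
    · intro h
      have h' := fun a b c : 𝔤 × V => (hat_nrBracket_self hπ a b c).symm.trans (h [a, b, c] rfl)
      simp only [hat_liftPi, smul_eq_zero, two_ne_zero, false_or, Prod.ext_iff, Prod.fst_add,
        Prod.snd_add, Prod.fst_zero, Prod.snd_zero] at h'
      refine ⟨fun x y z => (h' (x, 0) (y, 0) (z, 0)).1, fun x y v => ?_⟩
      have := (h' (x, 0) (y, 0) (0, v)).2
      simp only [map_zero, sub_zero, zero_sub, map_neg, sub_neg_eq_add] at this
      rw [← sub_eq_zero, ← this]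
      abel
    · rintro ⟨hj, hr⟩ l hl
      obtain ⟨a, b, c, rfl⟩ := List.length_eq_three.1 hl
      rw [hat_nrBracket_self hπ]
      simp only [hat_liftPi]
      rw [smul_eq_zero]
      refine Or.inr (Prod.ext (hj _ _ _) ?_)
      simp only [Prod.snd_add, hr, map_sub]
      abel_nf
      rfl
  have h2 : projH K 𝔤 V (nrBracket K (𝔤 × V) (nrBracket K (𝔤 × V)
      (DirectSum.lof K ℕ _ 1 (liftPi μ ρ)) (DirectSum.lof K ℕ _ 0 (liftT T)))
      (DirectSum.lof K ℕ _ 0 (liftT T))) = 0 ↔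
      ∀ u v : V, μ ![T u, T v] = T (ρ (T u) v - ρ (T v) u) := by
    have hm : projH K 𝔤 V (nrBracket K (𝔤 × V) (nrBracket K (𝔤 × V)
      (DirectSum.lof K ℕ _ 1 (liftPi μ ρ)) (DirectSum.lof K ℕ _ 0 (liftT T)))
      (DirectSum.lof K ℕ _ 0 (liftT T))) ∈ homog K (𝔤 × V) ((1 : ℕ) : ℤ) :=
      projH_apply_mem (nrBracket_mem (nrBracket_mem hπ hT) hT)
    rw [eq_zero_iff_hat hm]
    have key : ∀ a b : 𝔤 × V, hat (projH K 𝔤 V (nrBracket K (𝔤 × V) (nrBracket K (𝔤 × V)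
        (DirectSum.lof K ℕ _ 1 (liftPi μ ρ)) (DirectSum.lof K ℕ _ 0 (liftT T)))
        (DirectSum.lof K ℕ _ 0 (liftT T)))) [a, b] =
        ((2 : K) • (μ ![T a.2, T b.2] - T (ρ (T a.2) b.2 - ρ (T b.2) a.2)), 0) := by
      intro a b
      rw [hat_projH]
      simp only [List.map_cons, List.map_nil]
      rw [hat_nrBracket_nrBracket hπ hT hTT]
      simp only [hat_liftT, hat_liftPi, projV_apply, projG_apply]
      simp [e0, e1, sub_eq_add_neg]
    constructor
    · intro h u v
      have := key (0, u) (0, v)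
      rw [h _ rfl, Prod.ext_iff] at this
      have := (smul_eq_zero.1 this.1.symm).resolve_left two_ne_zero
      exact sub_eq_zero.1 this
    · intro h l hl
      obtain ⟨a, b, rfl⟩ := List.length_eq_two.1 hl
      rw [key, h, sub_self, smul_zero]
      rfl
  rw [isMaurerCartan_ctrlLInfinity_iff (α := ctrlPoint μ ρ T) hπ hT]
  refine Iff.trans ?_ (and_congr h1 h2).symm
  exact ⟨fun h => ⟨⟨h.jacobi, h.rep⟩, h.rotaBaxter⟩, fun h => ⟨h.1.1, h.1.2, h.2⟩⟩

end RelativeRotaBaxter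

end RelRB

theorem theorem3 (K : Type*) [Field K] [CharZero K] (𝔤 V : Type*) [AddCommGroup 𝔤] [Module K 𝔤]
    [AddCommGroup V] [Module K V] :
    (∃! A : LInfinityAlgebra (E := Ctrl K 𝔤 V) (ctrlGrading K 𝔤 V),
      IsHigherDerivedBrackets A.l) ∧
    ∀ A : LInfinityAlgebra (E := Ctrl K 𝔤 V) (ctrlGrading K 𝔤 V), IsHigherDerivedBrackets A.l →
      IsWeaklyFiltered A (ctrlFiltration K 𝔤 V) 3 ∧
      ∀ (μ : 𝔤 [⋀^Fin 2]→ₗ[K] 𝔤) (ρ : 𝔤 →ₗ[K] V →ₗ[K] V) (T : V →ₗ[K] 𝔤),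
        IsRelRotaBaxterLie μ ρ T ↔
          IsMaurerCartan A (ctrlFiltration K 𝔤 V) (ctrlPoint μ ρ T) := by
  refine ⟨⟨ctrlLInfinity K 𝔤 V, derivedBracket_isHigherDerivedBrackets, fun A hA =>
    hA.eq_ctrlLInfinity⟩, fun A hA => ?_⟩
  rw [hA.eq_ctrlLInfinity]
  exact ⟨ctrlFiltration_isWeaklyFiltered fun k hk => ctrlFiltration_succ_le hk,
    isRelRotaBaxterLie_iff⟩
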